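/- Let $G$ be a finite group. A finite $(G,G)$-biset is a finite set with a left and a right action of $G$ that commute. The double Burnside ring $B(G,G)$ is the Grothendieck group, with respect to disjoint union, of isomorphism classes of finite $(G,G)$-bisets, with the multiplication induced by $[X][Y]=[X\times_G Y]$, where $X\times_G Y$ is the set of orbits of $X\times Y$ under $h\cdot(x,y)=(xh^{-1},hy)$. Its identity element is $\mathrm{Id}_G=[G]$, the class of $G$ acting on itself by left and right multiplication. For a biset $X$, the opposite biset $X^\circ$ is the set $X$ with actions $h\cdot x\cdot g=g^{-1}xh^{-1}$; this induces an anti-involution $a\mapsto a^\circ$ of $B(G,G)$. Let $$B_\circ(G,G)=\{u\in B(G,G)^\times : uu^\circ=u^\circ u=\mathrm{Id}_G\}$$ be the group of orthogonal units of $B(G,G)$. **Theorem 1.1.** Let $p$ be a prime and let $G$ be a cyclic $p$-group. 1. If $G$ is trivial, then $B_\circ(G,G)\cong C_2$. 2. If $|G|=2$, then $B_\circ(G,G)\cong C_2\times D_8$, where $D_8$ is the dihedral group of order $8$. 3. If $p$ is odd and $|G|=p^n$ with $n\ge 1$, then $$B_\circ(G,G)\cong\begin{cases} C_2^{\,n+2}\times\prod_{i=1}^n\mathrm{Out}(C_{p^i})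 & \text{if } p=3,\\ C_2^{\,n+1}\times\prod_{i=1}^n\mathrm{Out}(C_{p^i}) & \text{if } p>3.\end{cases}$$ Here $C_m$ is the cyclic group of order $m$ and $\mathrm{Out}$ denotes the outer automorphism group. -/

import Mathlib

universe u

/-- A finite `(G, H)`-biset: a finite set with a left `G`-action `g · x` and a right `H`-action
`x · h` such that `(g · x) · h = g · (x · h)`. -/
structure FinBiset (G H : Type u) [Group G] [Group H] where
  carrier : Type u
  finite : Finite carrier
  l : G → carrier → carrier
  r : carrier → H → carrier
  one_l : ∀ x, l 1 x = x
  mul_l : ∀ a b x, l (a * b) x = l a (l b x)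
  r_one : ∀ x, r x 1 = x
  r_mul : ∀ x a b, r x (a * b) = r (r x a) b
  l_r : ∀ g x h, r (l g x) h = l g (r x h)

namespace FinBiset

section

variable {G H K L : Type u} [Group G] [Group H] [Group K] [Group L]

/-- Isomorphisms of `(G, H)`-bisets: bijections commuting with both actions. -/
structure Iso (X Y : FinBiset G H) where
  toEquiv : X.carrier ≃ Y.carrier
  map_l : ∀ (g : G) (x : X.carrier), toEquiv (X.l g x) = Y.l g (toEquiv x)
  map_r : ∀ (x : X.carrier) (h : H), toEquiv (X.r x h) = Y.r (toEquiv x) h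

theorem Iso.symm_l {X Y : FinBiset G H} (e : Iso X Y) (g : G) (y : Y.carrier) :
    e.toEquiv.symm (Y.l g y) = X.l g (e.toEquiv.symm y) := by
  rw [Equiv.symm_apply_eq, e.map_l, Equiv.apply_symm_apply]

theorem Iso.symm_r {X Y : FinBiset G H} (e : Iso X Y) (y : Y.carrier) (h : H) :
    e.toEquiv.symm (Y.r y h) = X.r (e.toEquiv.symm y) h := by
  rw [Equiv.symm_apply_eq, e.map_r, Equiv.apply_symm_apply]

/-- Being isomorphic, as an equivalence relation on finite `(G, H)`-bisets. -/
instance isoSetoid (G H : Type u) [Group G] [Group H] : Setoid (FinBiset G H) where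
  r X Y := Nonempty (Iso X Y)
  iseqv :=
    { refl := fun X => ⟨⟨Equiv.refl _, fun _ _ => rfl, fun _ _ => rfl⟩⟩
      symm := fun ⟨e⟩ => ⟨⟨e.toEquiv.symm, e.symm_l, e.symm_r⟩⟩
      trans := fun ⟨e⟩ ⟨f⟩ => ⟨⟨e.toEquiv.trans f.toEquiv,
        fun g x => by simp [e.map_l, f.map_l],
        fun h x => by simp [e.map_r, f.map_r]⟩⟩ }

/-- The empty `(G, H)`-biset. -/
@[reducible]
def empty (G H : Type u) [Group G] [Group H] : FinBiset G H where
  carrier := PEmpty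
  finite := inferInstance
  l _ x := x
  r x _ := x
  one_l _ := rfl
  mul_l _ _ _ := rfl
  r_one _ := rfl
  r_mul _ _ _ := rfl
  l_r _ _ _ := rfl

/-- The disjoint union of two bisets. -/
@[reducible]
def sum (X Y : FinBiset G H) : FinBiset G H where
  carrier := X.carrier ⊕ Y.carrier
  finite := haveI := X.finite; haveI := Y.finite; inferInstance
  l g := Sum.map (X.l g) (Y.l g)
  r s h := Sum.map (fun x => X.r x h) (fun y => Y.r y h) s
  one_l := by rintro (x | y) <;> simp [one_l]
  mul_l := by rintro a b (x | y) <;> simp [mul_l]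
  r_one := by rintro (x | y) <;> simp [r_one]
  r_mul := by rintro (x | y) a b <;> simp [r_mul]
  l_r := by rintro g (x | y) h <;> simp [l_r]

/-- The group `G` as a `(G, G)`-biset, with left and right multiplication. -/
@[reducible]
def regular (G : Type u) [Group G] [Finite G] : FinBiset G G where
  carrier := G
  finite := inferInstance
  l g x := g * x
  r x g := x * g
  one_l := one_mul
  mul_l := mul_assoc
  r_one := mul_one
  r_mul x a b := (mul_assoc x a b).symm
  l_r := mul_assoc

/-- The opposite biset: the same set, with `h · x · g = g⁻¹ x h⁻¹`. -/
@[reducible]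
def opposite (X : FinBiset G H) : FinBiset H G where
  carrier := X.carrier
  finite := X.finite
  l h x := X.r x h⁻¹
  r x g := X.l g⁻¹ x
  one_l x := by simp [r_one]
  mul_l a b x := by simp [r_mul]
  r_one x := by simp [one_l]
  r_mul x a b := by simp [mul_l]
  l_r h x g := by simp [l_r]

/-- The relation on `X × Y` whose classes are the orbits of the `H`-action
`h · (x, y) = (x h⁻¹, h y)`. -/
def tensorSetoid (X : FinBiset G H) (Y : FinBiset H K) : Setoid (X.carrier × Y.carrier) where
  r a b := ∃ h : H, b = (X.r a.1 h⁻¹, Y.l h a.2)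
  iseqv :=
    { refl := fun a => ⟨1, by simp [r_one, one_l]⟩
      symm := fun {a b} ⟨h, e⟩ => ⟨h⁻¹, by
        subst e; simp [← r_mul, ← mul_l, r_one, one_l]⟩
      trans := fun {a b c} ⟨h, e⟩ ⟨k, f⟩ => ⟨k * h, by
        subst e; subst f; simp [r_mul, mul_l]⟩ }

/-- The underlying set of the tensor product `X ×_H Y`: the `H`-orbits on `X × Y`. -/
def TensorCarrier (X : FinBiset G H) (Y : FinBiset H K) : Type u :=
  Quotient (tensorSetoid X Y)

/-- The class of `(x, y)` in `X ×_H Y`. -/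
def tmk (X : FinBiset G H) (Y : FinBiset H K) (x : X.carrier) (y : Y.carrier) :
    TensorCarrier X Y :=
  Quotient.mk (tensorSetoid X Y) (x, y)

theorem tmk_r (X : FinBiset G H) (Y : FinBiset H K) (x : X.carrier) (h : H) (y : Y.carrier) :
    tmk X Y (X.r x h) y = tmk X Y x (Y.l h y) :=
  Quotient.sound ⟨h, by simp [← r_mul, r_one]⟩

theorem TensorCarrier.ind {X : FinBiset G H} {Y : FinBiset H K} {P : TensorCarrier X Y → Prop}
    (h : ∀ x y, P (tmk X Y x y)) (t : TensorCarrier X Y) : P t :=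
  Quotient.ind (fun a => h a.1 a.2) t

/-- Functions out of `X ×_H Y` from balanced functions on `X × Y`. -/
def tlift {X : FinBiset G H} {Y : FinBiset H K} {T : Type*} (f : X.carrier → Y.carrier → T)
    (hf : ∀ x (h : H) y, f (X.r x h) y = f x (Y.l h y)) (t : TensorCarrier X Y) : T :=
  Quotient.lift (s := tensorSetoid X Y) (fun a => f a.1 a.2)
    (by rintro a b ⟨h, rfl⟩; simp [hf, ← mul_l, one_l]) t

@[simp]
theorem tlift_tmk {X : FinBiset G H} {Y : FinBiset H K} {T : Type*}
    (f : X.carrier → Y.carrier → T) (hf) (x : X.carrier) (y : Y.carrier) :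
    tlift f hf (tmk X Y x y) = f x y := rfl

/-- The tensor product `X ×_H Y`, with `g · (x, y) · k = (g x, y k)`. -/
@[reducible]
def tensor (X : FinBiset G H) (Y : FinBiset H K) : FinBiset G K where
  carrier := TensorCarrier X Y
  finite := haveI := X.finite; haveI := Y.finite; Quotient.finite _
  l g := tlift (fun x y => tmk X Y (X.l g x) y) fun x h y => by rw [← l_r, tmk_r]
  r t k := tlift (fun x y => tmk X Y x (Y.r y k)) (fun x h y => by rw [tmk_r, l_r]) t
  one_l := TensorCarrier.ind fun x y => by simp [one_l]
  mul_l a b := TensorCarrier.ind fun x y => by simp [mul_l]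
  r_one := TensorCarrier.ind fun x y => by simp [r_one]
  r_mul := TensorCarrier.ind fun x y a b => by simp [r_mul]
  l_r _ := TensorCarrier.ind fun _ _ _ => rfl

/-! The isomorphisms of bisets behind the ring axioms. -/

theorem sum_congr {X X' Y Y' : FinBiset G H} (e : Iso X X') (f : Iso Y Y') :
    Nonempty (Iso (sum X Y) (sum X' Y')) :=
  ⟨⟨Equiv.sumCongr e.toEquiv f.toEquiv,
    by rintro g (x | x) <;> simp [e.map_l, f.map_l],
    by rintro (x | x) h <;> simp [e.map_r, f.map_r]⟩⟩

theorem sum_comm (X Y : FinBiset G H) : Nonempty (Iso (sum X Y) (sum Y X)) :=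
  ⟨⟨Equiv.sumComm _ _, by rintro g (x | x) <;> rfl, by rintro (x | x) h <;> rfl⟩⟩

theorem sum_assoc (X Y Z : FinBiset G H) :
    Nonempty (Iso (sum (sum X Y) Z) (sum X (sum Y Z))) :=
  ⟨⟨Equiv.sumAssoc _ _ _, by rintro g ((x | x) | x) <;> rfl,
    by rintro ((x | x) | x) h <;> rfl⟩⟩

theorem empty_sum (X : FinBiset G H) : Nonempty (Iso (sum (empty G H) X) X) :=
  ⟨⟨Equiv.emptySum PEmpty X.carrier, by rintro g (x | x); exacts [x.elim, rfl],
    by rintro (x | x) h; exacts [x.elim, rfl]⟩⟩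

theorem opposite_congr {X X' : FinBiset G H} (e : Iso X X') :
    Nonempty (Iso (opposite X) (opposite X')) :=
  ⟨⟨e.toEquiv, fun h x => e.map_r x h⁻¹, fun x g => e.map_l g⁻¹ x⟩⟩

theorem opposite_opposite (X : FinBiset G H) : Nonempty (Iso (opposite (opposite X)) X) :=
  ⟨⟨Equiv.refl _, fun g x => by simp, fun x h => by simp⟩⟩

theorem opposite_sum (X Y : FinBiset G H) :
    Nonempty (Iso (opposite (sum X Y)) (sum (opposite X) (opposite Y))) :=
  ⟨⟨Equiv.refl _, by rintro h (x | x) <;> rfl, by rintro (x | x) g <;> rfl⟩⟩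

theorem opposite_empty (G H : Type u) [Group G] [Group H] :
    Nonempty (Iso (opposite (empty G H)) (empty H G)) :=
  ⟨⟨Equiv.refl _, fun _ x => x.elim, fun x _ => x.elim⟩⟩

theorem tensor_congr {X X' : FinBiset G H} {Y Y' : FinBiset H K} (e : Iso X X') (f : Iso Y Y') :
    Nonempty (Iso (tensor X Y) (tensor X' Y')) :=
  ⟨{ toEquiv :=
      { toFun := tlift (fun x y => tmk X' Y' (e.toEquiv x) (f.toEquiv y)) fun x h y => by
          rw [e.map_r, f.map_l, tmk_r]
        invFun := tlift (fun x y => tmk X Y (e.toEquiv.symm x) (f.toEquiv.symm y))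
          fun x h y => by rw [e.symm_r, f.symm_l, tmk_r]
        left_inv := TensorCarrier.ind fun x y => by simp
        right_inv := TensorCarrier.ind fun x y => by simp }
     map_l := fun g => TensorCarrier.ind fun x y => by simp [e.map_l]
     map_r := TensorCarrier.ind fun x y k => by simp [f.map_r] }⟩

theorem tensor_assoc (X : FinBiset G H) (Y : FinBiset H K) (Z : FinBiset K L) :
    Nonempty (Iso (tensor (tensor X Y) Z) (tensor X (tensor Y Z))) :=
  ⟨{ toEquiv :=
      { toFun := tlift (X := tensor X Y) (Y := Z)
          (fun t z => tlift (fun x y => tmk X (tensor Y Z) x (tmk Y Z y z))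
            (fun x h y => tmk_r X (tensor Y Z) x h (tmk Y Z y z)) t)
          (fun t k z => by
            induction t using TensorCarrier.ind with
            | h x y => exact congrArg (tmk X (tensor Y Z) x) (tmk_r Y Z y k z))
        invFun := tlift (X := X) (Y := tensor Y Z)
          (fun x t => tlift (fun y z => tmk (tensor X Y) Z (tmk X Y x y) z)
            (fun y k z => tmk_r (tensor X Y) Z (tmk X Y x y) k z) t)
          (fun x h t => by
            induction t using TensorCarrier.ind with
            | h y z => exact congrArg (fun t => tmk (tensor X Y) Z t z) (tmk_r X Y x h y))
        left_inv := TensorCarrier.ind fun t z => by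
          induction t using TensorCarrier.ind with
          | h x y => rfl
        right_inv := TensorCarrier.ind fun x t => by
          induction t using TensorCarrier.ind with
          | h y z => rfl }
     map_l := fun g => TensorCarrier.ind fun t z => by
      induction t using TensorCarrier.ind with
      | h x y => rfl
     map_r := TensorCarrier.ind fun t z l => by
      induction t using TensorCarrier.ind with
      | h x y => rfl }⟩

theorem regular_tensor [Finite G] (X : FinBiset G H) :
    Nonempty (Iso (tensor (regular G) X) X) :=
  ⟨{ toEquiv :=
      { toFun := tlift (X := regular G) (fun (g : G) x => X.l g x)
          fun (a : G) g x => X.mul_l a g x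
        invFun := fun x => tmk (regular G) X (1 : G) x
        left_inv := TensorCarrier.ind fun (g : G) x => by
          have := tmk_r (regular G) X (1 : G) g x
          simpa using this.symm
        right_inv := fun x => X.one_l x }
     map_l := fun g => TensorCarrier.ind fun (a : G) x => X.mul_l g a x
     map_r := TensorCarrier.ind fun (a : G) x h => (X.l_r a x h).symm }⟩

theorem tensor_regular [Finite H] (X : FinBiset G H) :
    Nonempty (Iso (tensor X (regular H)) X) :=
  ⟨{ toEquiv :=
      { toFun := tlift (Y := regular H) (fun x (h : H) => X.r x h)
          fun x h (a : H) => (X.r_mul x h a).symm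
        invFun := fun x => tmk X (regular H) x (1 : H)
        left_inv := TensorCarrier.ind fun x (h : H) => by
          have := tmk_r X (regular H) x h (1 : H)
          simpa using this
        right_inv := fun x => X.r_one x }
     map_l := fun g => TensorCarrier.ind fun x (a : H) => X.l_r g x a
     map_r := TensorCarrier.ind fun x (a : H) h => X.r_mul x a h }⟩

theorem sum_tensor (X X' : FinBiset G H) (Y : FinBiset H K) :
    Nonempty (Iso (tensor (sum X X') Y) (sum (tensor X Y) (tensor X' Y))) :=
  ⟨{ toEquiv :=
      { toFun := tlift (X := sum X X')
          (fun s y => Sum.elim (fun x => Sum.inl (tmk X Y x y))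
            (fun x => Sum.inr (tmk X' Y x y)) s)
          (fun s h y => by rcases s with x | x <;> simp [tmk_r])
        invFun := Sum.elim
          (tlift (fun x y => tmk (sum X X') Y (Sum.inl x) y)
            fun x h y => tmk_r (sum X X') Y (Sum.inl x) h y)
          (tlift (fun x y => tmk (sum X X') Y (Sum.inr x) y)
            fun x h y => tmk_r (sum X X') Y (Sum.inr x) h y)
        left_inv := TensorCarrier.ind fun s y => by rcases s with x | x <;> rfl
        right_inv := by
          rintro (t | t) <;>
          · induction t using TensorCarrier.ind with
            | h x y => rfl }
     map_l := fun g => TensorCarrier.ind fun s y => by rcases s with x | x <;> rfl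
     map_r := TensorCarrier.ind fun s y k => by rcases s with x | x <;> rfl }⟩

theorem empty_tensor (G : Type u) [Group G] (Y : FinBiset H K) :
    Nonempty (Iso (tensor (empty G H) Y) (empty G K)) :=
  ⟨{ toEquiv :=
      { toFun := tlift (X := empty G H) (fun x _ => x) (fun x => x.elim)
        invFun := fun x => x.elim
        left_inv := TensorCarrier.ind fun x => x.elim
        right_inv := fun x => x.elim }
     map_l := fun _ => TensorCarrier.ind fun x => x.elim
     map_r := TensorCarrier.ind fun x => x.elim }⟩

theorem opposite_tensor (X : FinBiset G H) (Y : FinBiset H K) :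
    Nonempty (Iso (opposite (tensor X Y)) (tensor (opposite Y) (opposite X))) :=
  ⟨{ toEquiv :=
      { toFun := tlift (X := X) (Y := Y) (fun x y => tmk (opposite Y) (opposite X) y x)
          fun x h y => by
            have := tmk_r (opposite Y) (opposite X) y h⁻¹ x
            simpa using this.symm
        invFun := tlift (X := opposite Y) (Y := opposite X) (fun y x => tmk X Y x y)
          fun y h x => by simp [tmk_r]
        left_inv := TensorCarrier.ind fun _ _ => rfl
        right_inv := TensorCarrier.ind fun _ _ => rfl }
     map_l := fun _ => TensorCarrier.ind fun _ _ => rfl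
     map_r := TensorCarrier.ind fun _ _ _ => rfl }⟩

end

end FinBiset

/-- Isomorphism classes of finite `(G, H)`-bisets. -/
def BisetClass (G H : Type u) [Group G] [Group H] : Type (u + 1) :=
  Quotient (FinBiset.isoSetoid G H)

namespace BisetClass

section

variable {G H K L : Type u} [Group G] [Group H] [Group K] [Group L]

/-- The isomorphism class of a biset. -/
def mk (X : FinBiset G H) : BisetClass G H := Quotient.mk _ X

theorem mk_eq {X Y : FinBiset G H} (h : Nonempty (FinBiset.Iso X Y)) : mk X = mk Y :=
  Quotient.sound h

theorem ind {P : BisetClass G H → Prop} (h : ∀ X, P (mk X)) (a : BisetClass G H) : P a :=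
  Quotient.ind h a

instance : Add (BisetClass G H) where
  add := Quotient.map₂ FinBiset.sum fun _ _ ⟨e⟩ _ _ ⟨f⟩ => FinBiset.sum_congr e f

instance : Zero (BisetClass G H) where
  zero := mk (FinBiset.empty G H)

/-- Isomorphism classes of finite bisets form a commutative monoid under disjoint union. -/
instance : AddCommMonoid (BisetClass G H) where
  add_assoc a b c := by
    induction a using ind; induction b using ind; induction c using ind
    exact mk_eq (FinBiset.sum_assoc _ _ _)
  add_comm a b := by
    induction a using ind; induction b using ind
    exact mk_eq (FinBiset.sum_comm _ _)
  zero_add a := by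
    induction a using ind
    exact mk_eq (FinBiset.empty_sum _)
  add_zero a := by
    induction a using ind
    exact (mk_eq (FinBiset.sum_comm _ _)).trans (mk_eq (FinBiset.empty_sum _))
  nsmul := nsmulRec

/-- The opposite biset, on isomorphism classes. -/
def opHom : BisetClass G H →+ BisetClass H G where
  toFun := Quotient.map FinBiset.opposite fun _ _ ⟨e⟩ => FinBiset.opposite_congr e
  map_zero' := mk_eq (FinBiset.opposite_empty G H)
  map_add' a b := by
    induction a using ind; induction b using ind
    exact mk_eq (FinBiset.opposite_sum _ _)

/-- The tensor product of bisets, on isomorphism classes. -/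
def tensor : BisetClass G H → BisetClass H K → BisetClass G K :=
  Quotient.map₂ FinBiset.tensor fun _ _ ⟨e⟩ _ _ ⟨f⟩ => FinBiset.tensor_congr e f

theorem add_tensor (a b : BisetClass G H) (c : BisetClass H K) :
    tensor (a + b) c = tensor a c + tensor b c := by
  induction a using ind; induction b using ind; induction c using ind
  exact mk_eq (FinBiset.sum_tensor _ _ _)

theorem zero_tensor (c : BisetClass H K) : tensor (0 : BisetClass G H) c = 0 := by
  induction c using ind
  exact mk_eq (FinBiset.empty_tensor _ _)

theorem opHom_opHom (a : BisetClass G H) : opHom (opHom a) = a := by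
  induction a using ind
  exact mk_eq (FinBiset.opposite_opposite _)

theorem opHom_tensor (a : BisetClass G H) (b : BisetClass H K) :
    opHom (tensor a b) = tensor (opHom b) (opHom a) := by
  induction a using ind; induction b using ind
  exact mk_eq (FinBiset.opposite_tensor _ _)

theorem tensor_add (a : BisetClass G H) (b c : BisetClass H K) :
    tensor a (b + c) = tensor a b + tensor a c := by
  rw [← opHom_opHom (tensor a (b + c)), opHom_tensor, map_add, add_tensor, map_add,
    ← opHom_tensor, ← opHom_tensor, opHom_opHom, opHom_opHom]

theorem tensor_zero (a : BisetClass G H) : tensor a (0 : BisetClass H K) = 0 := by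
  rw [← opHom_opHom (tensor a 0), opHom_tensor, map_zero, zero_tensor, map_zero]

theorem tensor_assoc (a : BisetClass G H) (b : BisetClass H K) (c : BisetClass K L) :
    tensor (tensor a b) c = tensor a (tensor b c) := by
  induction a using ind; induction b using ind; induction c using ind
  exact mk_eq (FinBiset.tensor_assoc _ _ _)

theorem regular_tensor [Finite G] (a : BisetClass G H) :
    tensor (mk (FinBiset.regular G)) a = a := by
  induction a using ind
  exact mk_eq (FinBiset.regular_tensor _)

theorem tensor_regular [Finite H] (a : BisetClass G H) :
    tensor a (mk (FinBiset.regular H)) = a := by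
  induction a using ind
  exact mk_eq (FinBiset.tensor_regular _)

/-- The tensor product of bisets as a biadditive map. -/
def tensorHom : BisetClass G H →+ BisetClass H K →+ BisetClass G K where
  toFun a := ⟨⟨tensor a, tensor_zero a⟩, tensor_add a⟩
  map_zero' := AddMonoidHom.ext zero_tensor
  map_add' a b := AddMonoidHom.ext (add_tensor a b)

end

end BisetClass

/-- The group `B(G, H)`: the Grothendieck group of the monoid of isomorphism classes of finite
`(G, H)`-bisets with respect to disjoint union. -/
def BurnsideGroup (G H : Type u) [Group G] [Group H] : Type (u + 1) :=
  Algebra.GrothendieckAddGroup (BisetClass G H)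

namespace BurnsideGroup

section

variable {G H K L : Type u} [Group G] [Group H] [Group K] [Group L]

noncomputable instance instAddCommGroup : AddCommGroup (BurnsideGroup G H) :=
  inferInstanceAs (AddCommGroup (Algebra.GrothendieckAddGroup (BisetClass G H)))

/-- The canonical map from isomorphism classes of bisets to `B(G, H)`. -/
noncomputable def of : BisetClass G H →+ BurnsideGroup G H :=
  Algebra.GrothendieckAddGroup.of

/-- The universal property of the Grothendieck group. -/
noncomputable def lift {A : Type*} [AddCommGroup A] (f : BisetClass G H →+ A) :
    BurnsideGroup G H →+ A :=
  Algebra.GrothendieckAddGroup.lift f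

@[simp]
theorem lift_of {A : Type*} [AddCommGroup A] (f : BisetClass G H →+ A) (a : BisetClass G H) :
    lift f (of a) = f a :=
  DFunLike.congr_fun (Algebra.GrothendieckAddGroup.lift.symm_apply_apply f) a

theorem hom_ext {A : Type*} [AddCommGroup A] {f g : BurnsideGroup G H →+ A}
    (h : ∀ a, f (of a) = g (of a)) : f = g :=
  Algebra.GrothendieckAddGroup.lift.symm.injective (AddMonoidHom.ext h)

/-- The duality `B(G, H) → B(H, G)` with `[X] ↦ [X°]`. -/
noncomputable def dual : BurnsideGroup G H →+ BurnsideGroup H G :=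
  lift (of.comp BisetClass.opHom)

@[simp]
theorem dual_of (a : BisetClass G H) : dual (of a) = of (BisetClass.opHom a) := by
  simp [dual]

/-- The biadditive product `B(G, H) × B(H, K) → B(G, K)` with `[X] ∘ [Y] = [X ×_H Y]`. -/
noncomputable def comp : BurnsideGroup G H →+ BurnsideGroup H K →+ BurnsideGroup G K :=
  lift
    { toFun := fun a => lift (of.comp (BisetClass.tensorHom a))
      map_zero' := hom_ext fun b => by simp
      map_add' := fun a a' => hom_ext fun b => by simp }

@[simp]
theorem comp_of (a : BisetClass G H) (b : BisetClass H K) :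
    comp (of a) (of b) = of (BisetClass.tensor a b) := by
  simp [comp, BisetClass.tensorHom]

theorem ext_of {A : Type*} [AddCommGroup A] {f g : BurnsideGroup G H →+ A}
    (h : ∀ a, f (of a) = g (of a)) (x : BurnsideGroup G H) : f x = g x :=
  DFunLike.congr_fun (hom_ext h) x

theorem comp_assoc (x : BurnsideGroup G H) (y : BurnsideGroup H K) (z : BurnsideGroup K L) :
    comp (comp x y) z = comp x (comp y z) := by
  refine ext_of (f := (comp.flip z).comp (comp.flip y)) (g := comp.flip (comp y z))
    (fun a => ?_) x
  refine ext_of (f := (comp.flip z).comp (comp (of a))) (g := (comp (of a)).comp (comp.flip z))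
    (fun b => ?_) y
  refine ext_of (f := comp (comp (of a) (of b))) (g := (comp (of a)).comp (comp (of b)))
    (fun c => ?_) z
  simp [BisetClass.tensor_assoc]

theorem dual_dual (x : BurnsideGroup G H) : dual (dual x) = x :=
  ext_of (f := dual.comp dual) (g := AddMonoidHom.id _)
    (fun a => by simp [BisetClass.opHom_opHom]) x

theorem dual_comp (x : BurnsideGroup G H) (y : BurnsideGroup H K) :
    dual (comp x y) = comp (dual y) (dual x) := by
  refine ext_of (f := dual.comp (comp.flip y)) (g := (comp (dual y)).comp dual) (fun a => ?_) x
  refine ext_of (f := dual.comp (comp (of a))) (g := (comp.flip (dual (of a))).comp dual)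
    (fun b => ?_) y
  simp [BisetClass.opHom_tensor]

end

variable {G : Type u} [Group G] [Finite G]

theorem id_comp (x : BurnsideGroup G G) :
    comp (of (BisetClass.mk (FinBiset.regular G))) x = x :=
  ext_of (f := comp (of (BisetClass.mk (FinBiset.regular G)))) (g := AddMonoidHom.id _)
    (fun a => by simp [BisetClass.regular_tensor]) x

theorem comp_id (x : BurnsideGroup G G) :
    comp x (of (BisetClass.mk (FinBiset.regular G))) = x :=
  ext_of (f := comp.flip (of (BisetClass.mk (FinBiset.regular G)))) (g := AddMonoidHom.id _)
    (fun a => by simp [BisetClass.tensor_regular]) x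

/-- The double Burnside ring `B(G, G)`: the product is `[X] [Y] = [X ×_G Y]` and the identity
is the class of the biset `G`. -/
noncomputable instance : Ring (BurnsideGroup G G) where
  __ := (instAddCommGroup : AddCommGroup (BurnsideGroup G G))
  mul x y := comp x y
  one := of (BisetClass.mk (FinBiset.regular G))
  mul_assoc := comp_assoc
  left_distrib x y z := map_add (comp x) y z
  right_distrib x y z := by
    change comp (x + y) z = comp x z + comp y z
    rw [map_add, AddMonoidHom.add_apply]
  zero_mul x := by
    change comp 0 x = 0
    rw [map_zero, AddMonoidHom.zero_apply]
  mul_zero x := map_zero (comp x)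
  one_mul := id_comp
  mul_one := comp_id

/-- Duality is an anti-involution of the ring `B(G, G)`. -/
noncomputable instance : StarRing (BurnsideGroup G G) where
  star := dual
  star_involutive := dual_dual
  star_mul x y := dual_comp x y
  star_add x y := map_add dual x y

end BurnsideGroup

/-- The group `B_∘(G, G)` of orthogonal units: the units `u` of the double Burnside ring with
`u u° = u° u = Id_G`. -/
def orthogonalUnits (G : Type u) [Group G] [Finite G] : Subgroup (BurnsideGroup G G)ˣ where
  carrier := {u | (u : BurnsideGroup G G) * star (u : BurnsideGroup G G) = 1 ∧
    star (u : BurnsideGroup G G) * (u : BurnsideGroup G G) = 1}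
  one_mem' := by simp
  mul_mem' := by
    rintro u v ⟨hu, hu'⟩ ⟨hv, hv'⟩
    constructor
    · rw [Units.val_mul, star_mul, mul_assoc, ← mul_assoc (v : BurnsideGroup G G), hv, one_mul, hu]
    · rw [Units.val_mul, star_mul, mul_assoc, ← mul_assoc (star (u : BurnsideGroup G G)), hu',
        one_mul, hv']
  inv_mem' := by
    rintro u ⟨hu, hu'⟩
    have h : ((u⁻¹ : (BurnsideGroup G G)ˣ) : BurnsideGroup G G) = star (u : BurnsideGroup G G) :=
      Units.inv_eq_of_mul_eq_one_right hu
    exact ⟨by rw [h, star_star, hu'], by rw [h, star_star, hu]⟩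

instance innerNormal (G : Type*) [Group G] : (MulAut.conj (G := G)).range.Normal where
  conj_mem := by
    rintro _ ⟨g, rfl⟩ φ
    exact ⟨φ g, by ext x; simp⟩

/-- The outer automorphism group `Out(G) = Aut(G) / Inn(G)`. -/
abbrev Out (G : Type*) [Group G] : Type _ := MulAut G ⧸ (MulAut.conj (G := G)).range

/-- The (multiplicative) cyclic group of order `m` (for `m` nonzero). -/
abbrev CyclicGrp (m : ℕ) : Type := Multiplicative (ZMod m)

/-! For commutative $G$ the stabiliser of a point is constant along its orbit, so $B(G,G)$ is free
on the classes $[L]$ of $(G\times G)/L$ (`basis`). Counting points gives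
$[L][M]=|G:p_2(L)p_1(M)|\,[L*M]$, where $*$ is composition of relations (`basis_mul`), and
$[L]^\circ$ is the class of the transposed relation. Call $(P,N)$ the right section of $L$, where
$P=p_2(L)$ and $N=\{h:(1,h)\in L\}$.

Let $u^\circ u=1$ and let $e$ be the class of `diag P N` with $N<P$. Then $(ue)^\circ(ue)=|G:P|\,e$.
Since the subgroups of $G$ form a chain, two relations $T,T'$ with right section $(P,N)$ satisfy
$T^\circ*T'=$ `diag P N` only if $T=T'$; comparing coefficients at $e$ gives $\sum_T
c_T^2\,|G:p_1(T)|=|G:P|$ over the $T$ of that section (`sum_sq_coord_mul_index`). For $P=G$ this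
leaves one coefficient $\pm1$, at the graph of an automorphism of $G/N$. Such signs and
automorphisms are realised by explicit units: the successive differences of the classes $[G/N]$
along the chain are orthogonal idempotents commuting with $\mathrm{Aut}(G)$, and `blockUnit` acts on
the $i$-th one by a sign and a unit modulo $p^i$. Once $u$ is normalised by such a unit, induction
from large sections to small ones shows that $u$ is congruent to $1$ modulo the ideal spanned by the
classes $[A\times B]$ (`coord_eq_of_star_mul_self`), provided that no nontrivial proper subgroup has
index $2$.

In that ideal the classes $[A\times G]$ behave like vectors: $x^\circ y$ is an integer multiple of
$[G\times G]$, and the Gram matrix is $p^{\min(i,j)}$. Differences along the chain give orthogonal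
vectors of norms $1,\ p-1,\ p(p-1),\ p^2(p-1),\dots$. For odd $p$ the equations on column norms
force $u-1$ to be diagonal with entries $0$ or $-2/d$, where $d$ is the norm
(`coord_ofMatrix_of_odd`). Integrality leaves $d=1$, which is the sign on block $0$ and hence
already a `blockUnit`, and $d=2$, which occurs only for $p=3$ and gives one further commuting
reflection. This yields $\prod_{i=0}^n\{\pm1\}\times(\mathbb Z/p^i)^\times$, times $C_2$ if $p=3$.
For $|G|=2$ both norms are $1$; the elements in question form a copy of $\mathbb
Z\times\mathrm{Mat}_2(\mathbb Z)$ with transposition as involution, and the orthogonal units are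
$\{\pm1\}\times O_2(\mathbb Z)$ with $O_2(\mathbb Z)\cong D_8$. -/

/-! ### Subgroups of direct products as relations. -/

namespace Subgroup

variable {G H K : Type*} [Group G] [Group H] [Group K]

/-- The composition of two subgroups of direct products, seen as relations. -/
def relComp (L : Subgroup (G × H)) (M : Subgroup (H × K)) : Subgroup (G × K) where
  carrier := {x | ∃ h, (x.1, h) ∈ L ∧ (h, x.2) ∈ M}
  one_mem' := ⟨1, L.one_mem, M.one_mem⟩
  mul_mem' := by
    rintro _ _ ⟨h, hL, hM⟩ ⟨k, kL, kM⟩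
    exact ⟨h * k, L.mul_mem hL kL, M.mul_mem hM kM⟩
  inv_mem' := by
    rintro _ ⟨h, hL, hM⟩
    exact ⟨h⁻¹, L.inv_mem hL, M.inv_mem hM⟩

/-- The transposed subgroup of a subgroup of a direct product. -/
def relInv (L : Subgroup (G × H)) : Subgroup (H × G) where
  carrier := {x | (x.2, x.1) ∈ L}
  one_mem' := L.one_mem
  mul_mem' hx hy := L.mul_mem hx hy
  inv_mem' hx := L.inv_mem hx

/-- The first projection of a subgroup of a direct product. -/
def fstProj (L : Subgroup (G × H)) : Subgroup G := L.map (MonoidHom.fst G H)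

/-- The second projection of a subgroup of a direct product. -/
def sndProj (L : Subgroup (G × H)) : Subgroup H := L.map (MonoidHom.snd G H)

/-- The elements `g` with `(g, 1) ∈ L`. -/
def fstKer (L : Subgroup (G × H)) : Subgroup G := L.comap (MonoidHom.inl G H)

/-- The elements `h` with `(1, h) ∈ L`. -/
def sndKer (L : Subgroup (G × H)) : Subgroup H := L.comap (MonoidHom.inr G H)

theorem mem_relComp {L : Subgroup (G × H)} {M : Subgroup (H × K)} {g : G} {k : K} :
    (g, k) ∈ relComp L M ↔ ∃ h, (g, h) ∈ L ∧ (h, k) ∈ M := Iff.rfl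

theorem mem_relInv {L : Subgroup (G × H)} {g : G} {h : H} : (h, g) ∈ relInv L ↔ (g, h) ∈ L :=
  Iff.rfl

theorem mem_fstProj {L : Subgroup (G × H)} {g : G} : g ∈ fstProj L ↔ ∃ h, (g, h) ∈ L := by
  simp [fstProj]

theorem mem_sndProj {L : Subgroup (G × H)} {h : H} : h ∈ sndProj L ↔ ∃ g, (g, h) ∈ L := by
  simp [sndProj]

theorem mem_fstKer {L : Subgroup (G × H)} {g : G} : g ∈ fstKer L ↔ (g, 1) ∈ L := Iff.rfl

theorem mem_sndKer {L : Subgroup (G × H)} {h : H} : h ∈ sndKer L ↔ (1, h) ∈ L := Iff.rfl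

end Subgroup

/-- The map `θ` takes the quotient of the two middle entries of a pair in `L × M`; it is a
homomorphism because `H` is commutative. Its kernel consists of the composable pairs and maps onto
`L.relComp M`, with kernel a copy of `L.sndKer ⊓ M.fstKer`. Lagrange's theorem is applied to both
maps. -/
theorem Subgroup.card_mul_card_eq_relComp {G H K : Type*} [Group G] [CommGroup H] [Group K]
    [Finite G] [Finite H] [Finite K] (L : Subgroup (G × H)) (M : Subgroup (H × K)) :
    Nat.card L * Nat.card M = Nat.card (L.sndProj ⊔ M.fstProj : Subgroup H) *
      (Nat.card (L.sndKer ⊓ M.fstKer : Subgroup H) * Nat.card (L.relComp M)) := by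
  let θ : L × M →* H :=
    ((MonoidHom.snd G H).comp (L.subtype.comp (MonoidHom.fst L M))) /
      ((MonoidHom.fst H K).comp (M.subtype.comp (MonoidHom.snd L M)))
  have hθ (x : L × M) : θ x = x.1.1.2 / x.2.1.1 := rfl
  let κ : θ.ker →* G × K :=
    (((MonoidHom.fst G H).comp (L.subtype.comp (MonoidHom.fst L M))).prod
      ((MonoidHom.snd H K).comp (M.subtype.comp (MonoidHom.snd L M)))).comp θ.ker.subtype
  have hκ (x : θ.ker) : κ x = (x.1.1.1.1, x.1.2.1.2) := rfl
  have hrange : θ.range = L.sndProj ⊔ M.fstProj := by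
    ext h
    rw [Subgroup.mem_sup]
    constructor
    · rintro ⟨x, rfl⟩
      exact ⟨_, mem_sndProj.2 ⟨_, x.1.2⟩, _, inv_mem (mem_fstProj.2 ⟨_, x.2.2⟩),
        by rw [hθ, div_eq_mul_inv]⟩
    · rintro ⟨y, hy, z, hz, rfl⟩
      obtain ⟨g, hg⟩ := mem_sndProj.1 hy
      obtain ⟨k, hk⟩ := mem_fstProj.1 (inv_mem hz)
      exact ⟨(⟨_, hg⟩, ⟨_, hk⟩), by simp [hθ]⟩
  have hrange' : κ.range = L.relComp M := by
    ext ⟨g, k⟩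
    rw [mem_relComp]
    constructor
    · rintro ⟨⟨⟨⟨⟨a, b⟩, hL⟩, ⟨⟨c, d⟩, hM⟩⟩, h⟩, hx⟩
      rw [MonoidHom.mem_ker, hθ, div_eq_one] at h
      rw [hκ, Prod.mk.injEq] at hx
      simp only at h hx
      obtain ⟨rfl, rfl⟩ := hx
      subst h
      exact ⟨b, hL, hM⟩
    · rintro ⟨h, hL, hM⟩
      exact ⟨⟨(⟨_, hL⟩, ⟨_, hM⟩), by rw [MonoidHom.mem_ker, hθ, div_eq_one]⟩, rfl⟩
  have hker : Nat.card κ.ker = Nat.card (L.sndKer ⊓ M.fstKer : Subgroup H) := by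
    have hmem (x : κ.ker) : x.1.1.1.1 = (1, x.1.1.1.1.2) ∧ x.1.1.2.1 = (x.1.1.1.1.2, 1) := by
      have h1 := x.2
      have h2 := x.1.2
      rw [MonoidHom.mem_ker, hκ, Prod.mk_eq_one] at h1
      rw [MonoidHom.mem_ker, hθ, div_eq_one] at h2
      exact ⟨Prod.ext h1.1 rfl, Prod.ext h2.symm h1.2⟩
    refine Nat.card_congr
      { toFun := fun x => ⟨x.1.1.1.1.2, ?_, ?_⟩
        invFun := fun h => ⟨⟨(⟨(1, h.1), h.2.1⟩, ⟨(h.1, 1), h.2.2⟩), ?_⟩, ?_⟩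
        left_inv := fun x => ?_
        right_inv := fun h => rfl }
    · have := x.1.1.1.2
      rw [(hmem x).1] at this
      exact this
    · have := x.1.1.2.2
      rw [(hmem x).2] at this
      exact this
    · rw [MonoidHom.mem_ker, hθ, div_eq_one]
    · rw [MonoidHom.mem_ker, hκ]
      rfl
    · refine Subtype.ext (Subtype.ext (Prod.ext (Subtype.ext ?_) (Subtype.ext ?_)))
      · exact (hmem x).1.symm
      · exact (hmem x).2.symm
  rw [← Nat.card_prod, ← card_mul_index θ.ker, index_ker, hrange, ← card_mul_index κ.ker,
    index_ker, hrange', hker, mul_comm]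

theorem MulAction.card_eq_card_orbits_mul_index {H α : Type*} [Group H] [MulAction H α]
    (J : Subgroup H) (hJ : ∀ a : α, MulAction.stabilizer H a = J) :
    Nat.card α = Nat.card (Quotient (MulAction.orbitRel H α)) * J.index := by
  have e : ((ω : Quotient (MulAction.orbitRel H α)) × H ⧸ MulAction.stabilizer H ω.out) ≃
      Quotient (MulAction.orbitRel H α) × H ⧸ J :=
    (Equiv.sigmaCongrRight
      (α := Quotient (MulAction.orbitRel H α))
      (β₁ := fun ω => H ⧸ MulAction.stabilizer H ω.out) (β₂ := fun _ => H ⧸ J)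
      fun ω => Subgroup.quotientEquivOfEq (hJ ω.out)).trans
      (Equiv.sigmaEquivProd _ _)
  exact (Nat.card_congr ((MulAction.selfEquivSigmaOrbitsQuotientStabilizer H α).trans e)).trans
    (Nat.card_prod _ _)

/-! ### Stabilisers of points, and transitive bisets. -/

namespace FinBiset

section

variable {G H K : Type u} [Group G] [Group H] [Group K]

/-- The pairs `(a, b)` with `a · x = x · b`. -/
def stab (X : FinBiset G H) (x : X.carrier) : Subgroup (G × H) where
  carrier := {g | X.l g.1 x = X.r x g.2}
  one_mem' := by simp [one_l, r_one]
  mul_mem' := by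
    rintro ⟨a, b⟩ ⟨a', b'⟩ h h'
    simp only [Set.mem_ofPred_eq, Prod.mk_mul_mk] at h h' ⊢
    rw [mul_l, h', ← l_r, h, r_mul]
  inv_mem' := by
    rintro ⟨a, b⟩ h
    simp only [Set.mem_ofPred_eq, Prod.inv_mk] at h ⊢
    have : X.r (X.l a⁻¹ x) b = x := by rw [l_r, ← h, ← mul_l, inv_mul_cancel, one_l]
    conv_rhs => rw [← this, ← r_mul, mul_inv_cancel, r_one]

theorem mem_stab {X : FinBiset G H} {x : X.carrier} {a : G} {b : H} :
    (a, b) ∈ X.stab x ↔ X.l a x = X.r x b := Iff.rfl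

theorem Iso.stab_eq {X Y : FinBiset G H} (e : Iso X Y) (x : X.carrier) :
    Y.stab (e.toEquiv x) = X.stab x := by
  ext ⟨a, b⟩
  rw [mem_stab, mem_stab, ← e.map_l, ← e.map_r, e.toEquiv.apply_eq_iff_eq]

theorem stab_inl (X Y : FinBiset G H) (x : X.carrier) :
    (sum X Y).stab (Sum.inl x) = X.stab x := by
  ext ⟨a, b⟩
  simp [mem_stab]

theorem stab_inr (X Y : FinBiset G H) (y : Y.carrier) :
    (sum X Y).stab (Sum.inr y) = Y.stab y := by
  ext ⟨a, b⟩
  simp [mem_stab]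

theorem stab_opposite (X : FinBiset G H) (x : X.carrier) :
    (opposite X).stab x = (X.stab x).relInv := by
  ext ⟨b, a⟩
  rw [Subgroup.mem_relInv, mem_stab, ← inv_mem_iff, Prod.inv_mk, mem_stab]
  exact eq_comm

theorem tmk_eq_tmk {X : FinBiset G H} {Y : FinBiset H K} {x x' : X.carrier} {y y' : Y.carrier} :
    tmk X Y x y = tmk X Y x' y' ↔ ∃ h : H, x' = X.r x h⁻¹ ∧ y' = Y.l h y := by
  refine Quotient.eq.trans (exists_congr fun h => ?_)
  exact Prod.mk_inj

theorem stab_tmk (X : FinBiset G H) (Y : FinBiset H K) (x : X.carrier) (y : Y.carrier) :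
    (tensor X Y).stab (tmk X Y x y) = (X.stab x).relComp (Y.stab y) := by
  ext ⟨a, c⟩
  rw [Subgroup.mem_relComp, mem_stab]
  change tmk X Y (X.l a x) y = tmk X Y x (Y.r y c) ↔ _
  rw [tmk_eq_tmk]
  refine exists_congr fun h => ?_
  rw [mem_stab, mem_stab]
  refine and_congr ⟨fun e => ?_, fun e => ?_⟩ eq_comm
  · conv_rhs => rw [e, ← r_mul, inv_mul_cancel, r_one]
  · rw [e, ← r_mul, mul_inv_cancel, r_one]

/-- The action of `H` on `X × Y` whose orbits form the tensor product. -/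
@[reducible]
def tensorAction (X : FinBiset G H) (Y : FinBiset H K) :
    MulAction H (X.carrier × Y.carrier) where
  smul h a := (X.r a.1 h⁻¹, Y.l h a.2)
  one_smul a := Prod.ext (by simp [HSMul.hSMul, r_one]) (one_l _ _)
  mul_smul h k a := Prod.ext (by simp [HSMul.hSMul, r_mul]) (mul_l _ _ _ _)

/-- The stabiliser of `(x, y)` under the action defining the tensor product is `(X.stab x).sndKer ⊓
(Y.stab y).fstKer`, so all orbits have the same length `J.index`. -/
theorem card_tensor_mul_index (X : FinBiset G H) (Y : FinBiset H K) (J : Subgroup H)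
    (hJ : ∀ x y, (X.stab x).sndKer ⊓ (Y.stab y).fstKer = J) :
    Nat.card (tensor X Y).carrier * J.index = Nat.card X.carrier * Nat.card Y.carrier := by
  let _ := tensorAction X Y
  have hst (a : X.carrier × Y.carrier) : MulAction.stabilizer H a = J := by
    rw [← hJ a.1 a.2]
    ext h
    rw [MulAction.mem_stabilizer_iff, Subgroup.mem_inf, Subgroup.mem_sndKer, Subgroup.mem_fstKer,
      ← inv_mem_iff, Prod.inv_mk, inv_one, mem_stab, mem_stab, one_l, r_one]
    refine Prod.ext_iff.trans (and_congr ?_ Iff.rfl)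
    exact eq_comm
  have hs : MulAction.orbitRel H (X.carrier × Y.carrier) = tensorSetoid X Y := by
    refine Setoid.ext fun a b => ?_
    rw [MulAction.orbitRel_apply, Setoid.comm']
    exact exists_congr fun h => eq_comm
  rw [← Nat.card_prod X.carrier, MulAction.card_eq_card_orbits_mul_index J hst, hs]
  rfl

theorem l_inj {X : FinBiset G H} (g : G) {x y : X.carrier} : X.l g x = X.l g y ↔ x = y :=
  ⟨fun e => by simpa only [← mul_l, inv_mul_cancel, one_l] using congrArg (X.l g⁻¹) e,
    fun e => e ▸ rfl⟩

theorem r_inj {X : FinBiset G H} (h : H) {x y : X.carrier} : X.r x h = X.r y h ↔ x = y :=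
  ⟨fun e => by simpa only [← r_mul, mul_inv_cancel, r_one] using congrArg (X.r · h⁻¹) e,
    fun e => e ▸ rfl⟩

/-- The sub-biset carried by an invariant subset. -/
@[reducible]
def restrict (X : FinBiset G H) (s : Set X.carrier) (hl : ∀ g, ∀ x ∈ s, X.l g x ∈ s)
    (hr : ∀ h, ∀ x ∈ s, X.r x h ∈ s) : FinBiset G H where
  carrier := s
  finite := haveI := X.finite; inferInstance
  l g x := ⟨X.l g x, hl g x x.2⟩
  r x h := ⟨X.r x h, hr h x x.2⟩
  one_l x := Subtype.ext (X.one_l x)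
  mul_l a b x := Subtype.ext (X.mul_l a b x)
  r_one x := Subtype.ext (X.r_one x)
  r_mul x a b := Subtype.ext (X.r_mul x a b)
  l_r g x h := Subtype.ext (X.l_r g x h)

theorem sum_restrict_compl (X : FinBiset G H) (s : Set X.carrier) (hl hr hl' hr') :
    Nonempty (Iso (sum (X.restrict s hl hr) (X.restrict sᶜ hl' hr')) X) := by
  classical
  exact ⟨⟨Equiv.Set.sumCompl s, by rintro g (x | x) <;> rfl, by rintro (x | x) h <;> rfl⟩⟩

theorem restrict_compl_l (X : FinBiset G H) (s : Set X.carrier)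
    (hl : ∀ g, ∀ x ∈ s, X.l g x ∈ s) (g : G) (x : X.carrier) (hx : x ∈ sᶜ) : X.l g x ∈ sᶜ := by
  intro h
  have := hl g⁻¹ _ h
  rw [← mul_l, inv_mul_cancel, one_l] at this
  exact hx this

theorem restrict_compl_r (X : FinBiset G H) (s : Set X.carrier)
    (hr : ∀ h, ∀ x ∈ s, X.r x h ∈ s) (h : H) (x : X.carrier) (hx : x ∈ sᶜ) : X.r x h ∈ sᶜ := by
  intro h'
  have := hr h⁻¹ _ h'
  rw [← r_mul, mul_inv_cancel, r_one] at this
  exact hx this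

end

section

variable {G H : Type u} [CommGroup G] [CommGroup H] [Finite G] [Finite H]

/-- The transitive biset `(G × H) / L`. -/
@[reducible]
def transitive (L : Subgroup (G × H)) : FinBiset G H where
  carrier := (G × H) ⧸ L
  finite := inferInstance
  l g x := (g, (1 : H)) • x
  r x h := ((1 : G), h⁻¹) • x
  one_l x := one_smul _ x
  mul_l a b x := by rw [smul_smul]; simp
  r_one x := by rw [inv_one]; exact one_smul _ x
  r_mul x a b := by rw [smul_smul, Prod.mk_mul_mk, mul_inv_rev, mul_one]
  l_r g x h := by rw [smul_smul, smul_smul, Prod.mk_mul_mk, Prod.mk_mul_mk]; simp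

theorem stab_transitive (L : Subgroup (G × H)) (x : (transitive L).carrier) :
    (transitive L).stab x = L := by
  ext ⟨a, b⟩
  induction x using QuotientGroup.induction_on with | H x => ?_
  rw [mem_stab]
  change (((a, (1 : H)) * x : G × H) : (G × H) ⧸ L) = (((1 : G), b⁻¹) * x : G × H) ↔ _
  rw [QuotientGroup.eq, ← inv_mem_iff]
  have : (((a, (1 : H)) * x)⁻¹ * (((1 : G), b⁻¹) * x))⁻¹ = (a, b) := by
    obtain ⟨c, d⟩ := x
    simp
  rw [this]

theorem iso_transitive_orbit (X : FinBiset G H) (x : X.carrier) (hl hr) :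
    Nonempty (Iso (transitive (X.stab x))
      (X.restrict {y | ∃ a b, y = X.r (X.l a x) b} hl hr)) := by
  have key (a c : G) (b d : H) : X.r (X.l a x) b⁻¹ = X.r (X.l c x) d⁻¹ ↔
      (a, b)⁻¹ * (c, d) ∈ X.stab x := by
    rw [Prod.inv_mk, Prod.mk_mul_mk, mem_stab, ← l_inj a (x := X.l (a⁻¹ * c) x), ← mul_l, mul_inv_cancel_left,
      ← r_inj d⁻¹ (x := X.l c x), ← l_r, ← r_mul, mul_inv_cancel_right]
    exact eq_comm
  let f : (G × H) ⧸ X.stab x → (X.restrict {y | ∃ a b, y = X.r (X.l a x) b} hl hr).carrier :=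
    Quotient.lift (s := QuotientGroup.leftRel _)
      (fun a => ⟨X.r (X.l a.1 x) a.2⁻¹, a.1, a.2⁻¹, rfl⟩) (by
        rintro ⟨a, b⟩ ⟨c, d⟩ h
        rw [← Quotient.eq_iff_equiv, Quotient.eq, QuotientGroup.leftRel_apply] at h
        exact Subtype.ext ((key a c b d).2 h))
  have hf : Function.Bijective f := by
    constructor
    · intro p q
      induction p using QuotientGroup.induction_on with | H p => ?_
      induction q using QuotientGroup.induction_on with | H q => ?_
      intro e
      rw [QuotientGroup.eq]
      exact (key p.1 q.1 p.2 q.2).1 (congrArg Subtype.val e)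
    · rintro ⟨y, a, b, rfl⟩
      exact ⟨((a, b⁻¹) : G × H), Subtype.ext (by
        change X.r (X.l a x) b⁻¹⁻¹ = _
        rw [inv_inv])⟩
  refine ⟨⟨Equiv.ofBijective f hf, fun g p => ?_, fun p h => ?_⟩⟩
  · induction p using QuotientGroup.induction_on with | H p => ?_
    refine Subtype.ext ?_
    change X.r (X.l (g * p.1) x) (1 * p.2)⁻¹ = X.l g (X.r (X.l p.1 x) p.2⁻¹)
    rw [one_mul, mul_l, l_r]
  · induction p using QuotientGroup.induction_on with | H p => ?_
    refine Subtype.ext ?_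
    change X.r (X.l (1 * p.1) x) (h⁻¹ * p.2)⁻¹ = X.r (X.r (X.l p.1 x) p.2⁻¹) h
    rw [one_mul, ← r_mul, mul_inv_rev, inv_inv]

end

end FinBiset

/-! ### Marks and the basis of transitive bisets. -/

namespace FinBiset

variable {G H : Type u} [Group G] [Group H]

/-- The number of points with a given stabiliser. -/
noncomputable def mark (L : Subgroup (G × H)) (X : FinBiset G H) : ℕ :=
  Nat.card {x // X.stab x = L}

theorem Iso.mark_eq {X Y : FinBiset G H} (e : Iso X Y) (L : Subgroup (G × H)) :
    mark L X = mark L Y :=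
  Nat.card_congr (e.toEquiv.subtypeEquiv fun x => by rw [e.stab_eq])

theorem mark_empty (L : Subgroup (G × H)) : mark L (empty G H) = 0 :=
  haveI : IsEmpty {x // (empty G H).stab x = L} := ⟨fun x => x.1.elim⟩
  Nat.card_of_isEmpty

theorem mark_sum (L : Subgroup (G × H)) (X Y : FinBiset G H) :
    mark L (sum X Y) = mark L X + mark L Y := by
  have := X.finite
  have := Y.finite
  rw [mark, mark, mark, ← Nat.card_sum]
  refine Nat.card_congr (Equiv.trans (Equiv.subtypeSum) (Equiv.sumCongr ?_ ?_))
  · exact Equiv.subtypeEquivRight fun x => by rw [stab_inl]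
  · exact Equiv.subtypeEquivRight fun x => by rw [stab_inr]

end FinBiset

namespace BurnsideGroup

section

variable {G H : Type u} [Group G] [Group H]

/-- The number of points with a given stabiliser, as an additive map. -/
noncomputable def markHom (L : Subgroup (G × H)) : BurnsideGroup G H →+ ℤ :=
  lift
    { toFun := Quotient.lift (fun X => (FinBiset.mark L X : ℤ))
        fun _ _ ⟨e⟩ => congrArg Nat.cast (e.mark_eq L)
      map_zero' := congrArg Nat.cast (FinBiset.mark_empty L)
      map_add' := fun a b => by
        induction a using BisetClass.ind; induction b using BisetClass.ind
        exact (congrArg Nat.cast (FinBiset.mark_sum L _ _)).trans (Nat.cast_add _ _) }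

theorem markHom_of_mk (L : Subgroup (G × H)) (X : FinBiset G H) :
    markHom L (of (BisetClass.mk X)) = FinBiset.mark L X :=
  lift_of _ _

theorem closure_range_of : AddSubgroup.closure (Set.range (of (G := G) (H := H))) = ⊤ := by
  have := hom_ext (f := QuotientAddGroup.mk'
    (AddSubgroup.closure (Set.range (of (G := G) (H := H))))) (g := 0) fun a =>
      (QuotientAddGroup.eq_zero_iff _).2 (AddSubgroup.subset_closure ⟨a, rfl⟩)
  rw [← QuotientAddGroup.ker_mk' (AddSubgroup.closure _), this]
  exact AddMonoidHom.ker_zero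

end

section

variable {G H : Type u} [CommGroup G] [CommGroup H] [Finite G] [Finite H]

/-- The class of the transitive biset `(G × H) / L`. -/
noncomputable def single (L : Subgroup (G × H)) : BurnsideGroup G H :=
  of (BisetClass.mk (FinBiset.transitive L))

/-- Marks count the points whose stabiliser is exactly `L`, not the fixed points of `L`. With
commutative groups this makes the table of marks diagonal, so linear independence is immediate. -/
theorem markHom_single [DecidableEq (Subgroup (G × H))] (L M : Subgroup (G × H)) :
    markHom L (single M) = if M = L then (M.index : ℤ) else 0 := by
  rw [single, markHom_of_mk, FinBiset.mark]
  split_ifs with h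
  · rw [Nat.card_congr (Equiv.subtypeUnivEquiv fun x => by rw [FinBiset.stab_transitive, h])]
    rfl
  · have : IsEmpty {x // (FinBiset.transitive M).stab x = L} :=
      ⟨fun x => h ((FinBiset.stab_transitive M x.1).symm.trans x.2)⟩
    simp

/-- Induction on the number of points: the orbit of a point is isomorphic to a `transitive` biset,
and its complement is a smaller biset. -/
theorem of_mk_mem_closure (X : FinBiset G H) :
    of (BisetClass.mk X) ∈ AddSubgroup.closure (Set.range (single (G := G) (H := H))) := by
  induction hn : Nat.card X.carrier using Nat.strong_induction_on generalizing X with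
  | _ n ih =>
    have := X.finite
    rcases isEmpty_or_nonempty X.carrier with hX | ⟨⟨x⟩⟩
    · have : BisetClass.mk X = 0 := BisetClass.mk_eq
        ⟨⟨Equiv.equivOfIsEmpty _ _, fun _ x => hX.elim x, fun x _ => hX.elim x⟩⟩
      rw [this, map_zero]
      exact zero_mem _
    · have hl : ∀ g, ∀ y ∈ {y | ∃ a b, y = X.r (X.l a x) b},
          X.l g y ∈ {y | ∃ a b, y = X.r (X.l a x) b} := by
        rintro g _ ⟨a, b, rfl⟩
        exact ⟨g * a, b, by rw [← X.l_r, X.mul_l]⟩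
      have hr : ∀ h, ∀ y ∈ {y | ∃ a b, y = X.r (X.l a x) b},
          X.r y h ∈ {y | ∃ a b, y = X.r (X.l a x) b} := by
        rintro h _ ⟨a, b, rfl⟩
        exact ⟨a, b * h, by rw [X.r_mul]⟩
      have hl' := X.restrict_compl_l _ hl
      have hr' := X.restrict_compl_r _ hr
      rw [← BisetClass.mk_eq (X.sum_restrict_compl _ hl hr hl' hr')]
      change of (BisetClass.mk _ + BisetClass.mk _) ∈ _
      rw [map_add, ← BisetClass.mk_eq (X.iso_transitive_orbit x hl hr)]
      refine add_mem (AddSubgroup.subset_closure ⟨_, rfl⟩) (ih _ ?_ _ rfl)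
      rw [← hn]
      refine Finite.card_subtype_lt (x := x) fun h => h ⟨1, 1, by rw [X.one_l, X.r_one]⟩

theorem closure_range_single :
    AddSubgroup.closure (Set.range (single (G := G) (H := H))) = ⊤ := by
  rw [eq_top_iff, ← closure_range_of, AddSubgroup.closure_le]
  rintro _ ⟨a, rfl⟩
  induction a using BisetClass.ind
  exact of_mk_mem_closure _

end

variable {G : Type u} [CommGroup G] [Finite G]

theorem linearIndependent_single : LinearIndependent ℤ (single (G := G) (H := G)) := by
  classical
  rw [linearIndependent_iff']
  intro s g hg L hL
  have := congrArg (markHom L) hg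
  rw [map_sum, map_zero, Finset.sum_eq_single L] at this
  · rw [map_zsmul, markHom_single, if_pos rfl, smul_eq_mul] at this
    exact (mul_eq_zero.1 this).resolve_right (by exact_mod_cast Subgroup.index_ne_zero_of_finite)
  · intro M _ h
    rw [map_zsmul, markHom_single, if_neg h, smul_zero]
  · exact fun h => (h hL).elim

/-- The basis of the double Burnside ring of a commutative group formed by the classes of
transitive bisets. -/
noncomputable def basis (G : Type u) [CommGroup G] [Finite G] :
    Module.Basis (Subgroup (G × G)) ℤ (BurnsideGroup G G) :=
  Module.Basis.mk linearIndependent_single fun x hx => by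
    clear hx
    have : x ∈ AddSubgroup.closure (Set.range (single (G := G) (H := G))) := by
      rw [closure_range_single]; trivial
    induction this using AddSubgroup.closure_induction with
    | mem y hy => exact Submodule.subset_span hy
    | zero => exact zero_mem _
    | add y z _ _ hy hz => exact add_mem hy hz
    | neg y _ hy => exact neg_mem hy

theorem basis_apply (L : Subgroup (G × G)) : basis G L = single L := by
  simp [basis]

/-- An element is determined by its marks, each being a coordinate times an index. A biset with a
single stabiliser is therefore identified by counting its points, without an explicit isomorphism.
-/
theorem eq_smul_single_of_stab_eq (X : FinBiset G G) (L : Subgroup (G × G))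
    (hX : ∀ x, X.stab x = L) (c : ℕ) (hc : Nat.card X.carrier = c * L.index) :
    of (BisetClass.mk X) = (c : ℤ) • basis G L := by
  classical
  have key (M : Subgroup (G × G)) (x : BurnsideGroup G G) :
      markHom M x = (basis G).repr x M * M.index := by
    conv_lhs => rw [← (basis G).linearCombination_repr x, Finsupp.linearCombination_apply,
      Finsupp.sum, map_sum]
    simp only [map_zsmul, basis_apply, markHom_single, smul_eq_mul, mul_ite, mul_zero]
    rw [Finset.sum_ite_eq' ((basis G).repr x).support M]
    split_ifs with h
    · rfl
    · rw [Finsupp.notMem_support_iff.1 h, zero_mul]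
  have hi (M : Subgroup (G × G)) : (M.index : ℤ) ≠ 0 := by
    exact_mod_cast Subgroup.index_ne_zero_of_finite
  refine (basis G).repr.injective (Finsupp.ext fun M => mul_right_cancel₀ (hi M) ?_)
  rw [← key, ← key, map_zsmul, basis_apply, markHom_single, markHom_of_mk, FinBiset.mark]
  split_ifs with h
  · subst h
    rw [Nat.card_congr (Equiv.subtypeUnivEquiv hX), hc]
    simp
  · have : IsEmpty {x // X.stab x = M} := ⟨fun x => h ((hX x.1).symm.trans x.2)⟩
    simp

/-- The Mackey formula in the commutative case. Every point of the tensor product has stabiliser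
`L.relComp M`; the multiplicity results from comparing `card_tensor_mul_index` with
`card_mul_card_eq_relComp`. -/
theorem basis_mul (L M : Subgroup (G × G)) :
    basis G L * basis G M =
      ((L.sndProj ⊔ M.fstProj : Subgroup G).index : ℤ) • basis G (L.relComp M) := by
  rw [basis_apply, basis_apply]
  change comp (of _) (of _) = _
  rw [comp_of]
  refine eq_smul_single_of_stab_eq (FinBiset.tensor _ _) _
    (FinBiset.TensorCarrier.ind fun x y => ?_) _ ?_
  · rw [FinBiset.stab_tmk, FinBiset.stab_transitive, FinBiset.stab_transitive]
  · have h1 := FinBiset.card_tensor_mul_index (FinBiset.transitive L) (FinBiset.transitive M)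
      (L.sndKer ⊓ M.fstKer) fun x y => by
        rw [FinBiset.stab_transitive, FinBiset.stab_transitive]
    have h2 := Subgroup.card_mul_card_eq_relComp L M
    change _ = Nat.card ((G × G) ⧸ L) * Nat.card ((G × G) ⧸ M) at h1
    change _ = L.index * M.index at h1
    have h3 := L.card_mul_index
    have h4 := M.card_mul_index
    have h5 := (L.relComp M).card_mul_index
    have h6 := (L.sndKer ⊓ M.fstKer).card_mul_index
    have h7 := (L.sndProj ⊔ M.fstProj).card_mul_index
    have p1 : 0 < Nat.card L := Nat.card_pos
    have p2 : 0 < Nat.card M := Nat.card_pos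
    have p3 : 0 < (L.sndKer ⊓ M.fstKer).index := Nat.pos_of_ne_zero Subgroup.index_ne_zero_of_finite
    rw [Nat.card_prod] at h3 h4 h5
    -- After multiplication by these orders and this index, each index pairs with the order of its
    -- subgroup and both sides become the fourth power of the order of `G`.
    refine Nat.eq_of_mul_eq_mul_right (Nat.mul_pos (Nat.mul_pos p1 p2) p3) ?_
    generalize Nat.card (FinBiset.tensor (FinBiset.transitive L) (FinBiset.transitive M)).carrier = t
      at *
    generalize Nat.card G = g at *
    calc t * (Nat.card L * Nat.card M * (L.sndKer ⊓ M.fstKer).index)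
        = (t * (L.sndKer ⊓ M.fstKer).index) * (Nat.card L * Nat.card M) := by ring
      _ = (Nat.card L * L.index) * (Nat.card M * M.index) := by rw [h1]; ring
      _ = g * (g * g) * g := by rw [h3, h4]; ring
      _ = _ := by
        rw [h2]
        conv_lhs => rw [← h5]
        conv_lhs => enter [1, 1]; rw [← h7]
        conv_lhs => enter [2]; rw [← h6]
        ring

theorem star_basis (L : Subgroup (G × G)) : star (basis G L) = basis G L.relInv := by
  rw [basis_apply]
  change dual (of _) = _
  rw [dual_of]
  change of (BisetClass.mk (FinBiset.opposite _)) = _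
  rw [eq_smul_single_of_stab_eq _ L.relInv (fun x => by
    rw [FinBiset.stab_opposite, FinBiset.stab_transitive]) 1, Nat.cast_one, one_smul]
  rw [one_mul]
  have h : Nat.card L = Nat.card L.relInv :=
    Nat.card_congr ((Equiv.prodComm G G).subtypeEquiv fun x => Iff.rfl)
  refine Nat.eq_of_mul_eq_mul_left (Nat.card_pos (α := L)) ?_
  refine L.card_mul_index.trans ?_
  rw [h, L.relInv.card_mul_index]

theorem one_eq_basis :
    (1 : BurnsideGroup G G) = basis G (MonoidHom.id G).graph := by
  change of (BisetClass.mk (FinBiset.regular G)) = _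
  have hstab (x : G) : (FinBiset.regular G).stab x = (MonoidHom.id G).graph := by
    ext ⟨a, b⟩
    rw [FinBiset.mem_stab, MonoidHom.mem_graph]
    change a * x = x * b ↔ a = b
    rw [mul_comm, mul_left_cancel_iff]
  rw [eq_smul_single_of_stab_eq _ _ hstab 1, Nat.cast_one, one_smul]
  rw [one_mul]
  have h : Nat.card (MonoidHom.id G).graph = Nat.card G :=
    Nat.card_congr
      { toFun := fun x => x.1.1
        invFun := fun x => ⟨(x, x), rfl⟩
        left_inv := fun x => Subtype.ext (Prod.ext rfl x.2)
        right_inv := fun x => rfl }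
  refine Nat.eq_of_mul_eq_mul_left (Nat.card_pos (α := G)) ?_
  have := (MonoidHom.id G).graph.card_mul_index
  rw [h, Nat.card_prod] at this
  exact this.symm

end BurnsideGroup

/-! ### Right sections of relations, and rigidity when the subgroups form a chain. -/

namespace Subgroup

variable {G H K : Type*} [Group G] [Group H] [Group K]

theorem sndKer_le_sndProj (L : Subgroup (G × H)) : L.sndKer ≤ L.sndProj :=
  fun _ h => mem_sndProj.2 ⟨1, h⟩

theorem relInv_relInv (L : Subgroup (G × H)) : L.relInv.relInv = L := rfl

theorem sndProj_relInv (L : Subgroup (G × H)) : L.relInv.sndProj = L.fstProj := by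
  ext x
  rw [mem_sndProj, mem_fstProj]
  rfl

theorem relInv_relComp (L : Subgroup (G × H)) (M : Subgroup (H × K)) :
    (L.relComp M).relInv = M.relInv.relComp L.relInv := by
  ext ⟨a, b⟩
  exact exists_congr fun h => and_comm

theorem sndProj_relComp_le (L : Subgroup (G × H)) (M : Subgroup (H × K)) :
    (L.relComp M).sndProj ≤ M.sndProj := by
  intro x hx
  obtain ⟨g, h, -, hM⟩ := mem_sndProj.1 hx
  exact mem_sndProj.2 ⟨h, hM⟩

theorem sndKer_le_sndKer_relComp (L : Subgroup (G × H)) (M : Subgroup (H × K)) :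
    M.sndKer ≤ (L.relComp M).sndKer :=
  fun _ hx => ⟨1, L.one_mem, hx⟩

/-- The pairs of elements of `P` that are congruent modulo `N`. -/
def diag {G : Type*} [CommGroup G] (P N : Subgroup G) : Subgroup (G × G) where
  carrier := {x | x.1 ∈ P ∧ x.2 ∈ P ∧ x.1 / x.2 ∈ N}
  one_mem' := ⟨P.one_mem, P.one_mem, by simp⟩
  mul_mem' := by
    rintro a b ⟨h1, h2, h3⟩ ⟨k1, k2, k3⟩
    exact ⟨P.mul_mem h1 k1, P.mul_mem h2 k2, by
      simpa [mul_div_mul_comm] using N.mul_mem h3 k3⟩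
  inv_mem' := by
    rintro a ⟨h1, h2, h3⟩
    exact ⟨P.inv_mem h1, P.inv_mem h2, by
      have := N.inv_mem h3
      rwa [inv_div'] at this⟩

section

variable {G : Type*} [CommGroup G] {P N : Subgroup G}

theorem mem_diag {a b : G} : (a, b) ∈ diag P N ↔ a ∈ P ∧ b ∈ P ∧ a / b ∈ N := Iff.rfl

theorem relInv_diag : (diag P N).relInv = diag P N := by
  ext ⟨a, b⟩
  rw [mem_relInv, mem_diag, mem_diag, ← inv_mem_iff (x := b / a), inv_div]
  tauto

theorem sndProj_diag : (diag P N).sndProj = P := by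
  ext x
  rw [mem_sndProj]
  exact ⟨fun ⟨_, h⟩ => h.2.1, fun h => ⟨x, h, h, by simp⟩⟩

theorem fstProj_diag : (diag P N).fstProj = P := by
  rw [← sndProj_relInv, relInv_diag, sndProj_diag]

theorem sndKer_diag (h : N ≤ P) : (diag P N).sndKer = N := by
  ext x
  rw [mem_sndKer, mem_diag, one_div, inv_mem_iff]
  exact ⟨fun h => h.2.2, fun hx => ⟨P.one_mem, h hx, hx⟩⟩

/-- `diag P N` is a right identity for the relations whose right section is `(P, N)`. -/
theorem relComp_diag_of_eq {L : Subgroup (G × G)} (hP : L.sndProj = P) (hN : L.sndKer = N) :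
    L.relComp (diag P N) = L := by
  ext ⟨a, c⟩
  rw [mem_relComp]
  constructor
  · rintro ⟨b, hb, -, -, h⟩
    rw [← hN, mem_sndKer] at h
    simpa using L.mul_mem hb (L.inv_mem h)
  · intro h
    have hc : c ∈ P := hP ▸ mem_sndProj.2 ⟨a, h⟩
    exact ⟨c, h, hc, hc, by simp⟩

theorem diag_relComp_diag (h : N ≤ P) : (diag P N).relComp (diag P N) = diag P N :=
  relComp_diag_of_eq sndProj_diag (sndKer_diag h)

theorem diag_top_bot_relComp (L : Subgroup (G × G)) : (diag ⊤ ⊥).relComp L = L := by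
  ext ⟨a, c⟩
  rw [mem_relComp]
  constructor
  · rintro ⟨b, ⟨-, -, h⟩, hb⟩
    rw [mem_bot] at h
    rwa [show a = b from div_eq_one.1 h]
  · intro h
    exact ⟨a, ⟨trivial, trivial, by simp⟩, h⟩

theorem relInv_relComp_self (L : Subgroup (G × G)) (hP : L.sndProj = P) (hN : L.sndKer = N) :
    L.relInv.relComp L = diag P N := by
  ext ⟨a, c⟩
  rw [mem_relComp, mem_diag]
  constructor
  · rintro ⟨b, hb, h⟩
    refine ⟨hP ▸ mem_sndProj.2 ⟨b, hb⟩, hP ▸ mem_sndProj.2 ⟨b, h⟩, hN ▸ ?_⟩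
    have := L.mul_mem hb (L.inv_mem h)
    simpa [mem_sndKer, div_eq_mul_inv] using this
  · rintro ⟨ha, hc, h⟩
    obtain ⟨b, hb⟩ := mem_sndProj.1 (hP ▸ ha : a ∈ L.sndProj)
    rw [← hN, mem_sndKer] at h
    refine ⟨b, hb, ?_⟩
    have := L.mul_mem (L.inv_mem h) hb
    simpa using this

theorem section_le_of_relInv_relComp {S T : Subgroup (G × G)} (hN : N ≤ P)
    (h : S.relInv.relComp T = diag P N) : P ≤ T.sndProj ∧ T.sndKer ≤ N := by
  constructor
  · rw [← sndProj_diag (P := P) (N := N), ← h]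
    exact sndProj_relComp_le _ _
  · rw [← sndKer_diag hN, ← h]
    exact sndKer_le_sndKer_relComp _ _

/-- Elements of `S` and `T` over the same `x` have second entries congruent modulo `N`, whence `S ≤
T`. As the second projections agree, `T.fstProj` is generated by `S.fstProj` and `T.fstKer`. These
two are comparable: either the first projections coincide, which gives `S = T`, or `T.fstProj =
T.fstKer`, which makes the right section trivial. -/
theorem eq_of_relInv_relComp_of_le (hch : ∀ A B : Subgroup G, A ≤ B ∨ B ≤ A)
    {S T : Subgroup (G × G)} (hNP : N ≠ P) (hSP : S.sndProj = P) (hSN : S.sndKer = N)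
    (hTP : T.sndProj = P) (hTN : T.sndKer = N) (h : S.relInv.relComp T = diag P N)
    (hle : S.fstProj ≤ T.fstProj) : S = T := by
  have hST : S ≤ T := by
    rintro ⟨x, g⟩ hx
    obtain ⟨g', hg'⟩ := mem_fstProj.1 (hle (mem_fstProj.2 ⟨g, hx⟩))
    have h1 : (g, g') ∈ S.relInv.relComp T := ⟨x, hx, hg'⟩
    rw [h, mem_diag, ← hTN, mem_sndKer] at h1
    simpa using T.mul_mem h1.2.2 hg'
  have hdecomp : ∀ x ∈ T.fstProj, ∃ y ∈ S.fstProj, x / y ∈ T.fstKer := by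
    intro x hx
    obtain ⟨g, hg⟩ := mem_fstProj.1 hx
    have : g ∈ S.sndProj := by rw [hSP, ← hTP]; exact mem_sndProj.2 ⟨x, hg⟩
    obtain ⟨y, hy⟩ := mem_sndProj.1 this
    refine ⟨y, mem_fstProj.2 ⟨g, hy⟩, ?_⟩
    simpa [mem_fstKer, div_eq_mul_inv] using T.mul_mem hg (T.inv_mem (hST hy))
  have hle' : T.fstProj ≤ S.fstProj := by
    rcases hch T.fstKer S.fstProj with hc | hc
    · intro x hx
      obtain ⟨y, hy, hxy⟩ := hdecomp x hx
      simpa using S.fstProj.mul_mem (hc hxy) hy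
    -- Here `S.fstProj ≤ T.fstKer`, so `T.fstProj = T.fstKer`; then every element of `T.sndProj`
    -- lies in `T.sndKer`.
    · refine (hNP (le_antisymm ?_ ?_)).elim
      · rw [← hTP, ← hTN]
        exact sndKer_le_sndProj T
      · intro b hb
        obtain ⟨x, hx⟩ := mem_sndProj.1 (hTP ▸ hb : b ∈ T.sndProj)
        obtain ⟨y, hy, hxy⟩ := hdecomp x (mem_fstProj.2 ⟨b, hx⟩)
        have hx1 : x ∈ T.fstKer := by
          simpa using T.fstKer.mul_mem hxy (hc hy)
        rw [mem_fstKer] at hx1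
        rw [← hTN, mem_sndKer]
        simpa using T.mul_mem (T.inv_mem hx1) hx
  refine le_antisymm hST ?_
  rintro ⟨x, g⟩ hx
  obtain ⟨g', hg'⟩ := mem_fstProj.1 (hle' (mem_fstProj.2 ⟨g, hx⟩))
  have h1 : g / g' ∈ T.sndKer := by
    simpa [mem_sndKer, div_eq_mul_inv] using T.mul_mem hx (T.inv_mem (hST hg'))
  rw [hTN, ← hSN, mem_sndKer] at h1
  simpa using S.mul_mem h1 hg'

theorem eq_of_relInv_relComp (hch : ∀ A B : Subgroup G, A ≤ B ∨ B ≤ A)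
    {S T : Subgroup (G × G)} (hNP : N ≠ P) (hSP : S.sndProj = P) (hSN : S.sndKer = N)
    (hTP : T.sndProj = P) (hTN : T.sndKer = N) (h : S.relInv.relComp T = diag P N) : S = T := by
  rcases hch S.fstProj T.fstProj with hle | hle
  · exact eq_of_relInv_relComp_of_le hch hNP hSP hSN hTP hTN h hle
  · refine (eq_of_relInv_relComp_of_le hch hNP hTP hTN hSP hSN ?_ hle).symm
    rw [← relInv_diag, ← h, relInv_relComp]
    rfl

/-- Only relations with a section at least as large as `(P, N)` can contribute to a coordinate of
that section after multiplication by `diag P N`. Comparability with `N` settles the projection and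
comparability with `P` settles the kernel; in each case the wrong alternative forces `P ≤ N`. -/
theorem le_of_relComp_diag (hch : ∀ A B : Subgroup G, A ≤ B ∨ B ≤ A)
    {L T : Subgroup (G × G)} (hNP : N < P) (hTP : T.sndProj = P) (hTN : T.sndKer = N)
    (h : L.relComp (diag P N) = T) : P ≤ L.sndProj ∧ L.sndKer ≤ N := by
  have hmem : ∀ b ∈ L.sndKer, b ∈ P → b ∈ N := by
    intro b hb hbP
    rw [← hTN, ← h]
    exact ⟨b, hb, hbP, hbP, by simp⟩
  constructor
  · intro c hc
    rw [← hTP, ← h] at hc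
    obtain ⟨a, b, hab, hb, hc', hbc⟩ := mem_sndProj.1 hc
    simp only at hab hb hc' hbc
    rcases hch L.sndProj N with hL | hL
    · exfalso
      refine hNP.not_ge fun x hx => ?_
      rw [← hTP, ← h] at hx
      obtain ⟨a, b, hab, hb, hc', hbc⟩ := mem_sndProj.1 hx
      simp only at hab hb hc' hbc
      have := N.div_mem (hL (mem_sndProj.2 ⟨a, hab⟩)) hbc
      simpa using this
    · have := L.sndProj.div_mem (mem_sndProj.2 ⟨a, hab⟩) (hL hbc)
      simpa using this
  · rcases hch L.sndKer P with hL | hL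
    · exact fun b hb => hmem b hb (hL hb)
    · exact (hNP.not_ge fun b hb => hmem b (hL hb) hb).elim

end

end Subgroup

/-! ### Coordinates of an orthogonal element. -/

namespace BurnsideGroup

open Subgroup

open scoped Classical

variable {G : Type u} [CommGroup G] [Finite G]

theorem one_eq_basis_diag : (1 : BurnsideGroup G G) = basis G (diag ⊤ ⊥) := by
  rw [one_eq_basis]
  congr 1
  ext ⟨a, b⟩
  rw [MonoidHom.mem_graph, mem_diag, mem_bot, div_eq_one]
  simp

theorem eq_sum_coord [Fintype (Subgroup (G × G))] (x : BurnsideGroup G G) :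
    x = ∑ L, (basis G).coord L x • basis G L :=
  ((basis G).sum_repr x).symm

theorem coord_basis (L T : Subgroup (G × G)) :
    (basis G).coord T (basis G L) = if L = T then 1 else 0 := by
  rw [Module.Basis.coord_apply, Module.Basis.repr_self, Finsupp.single_apply]

theorem coord_mul_basis [Fintype (Subgroup (G × G))]
    (x : BurnsideGroup G G) (S T : Subgroup (G × G)) :
    (basis G).coord T (x * basis G S) =
      ∑ L, (basis G).coord L x *
        (if L.relComp S = T then ((L.sndProj ⊔ S.fstProj : Subgroup G).index : ℤ) else 0) := by
  conv_lhs => rw [eq_sum_coord x, Finset.sum_mul, map_sum]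
  refine Finset.sum_congr rfl fun L _ => ?_
  rw [smul_mul_assoc, basis_mul, map_smul, map_smul, coord_basis, smul_eq_mul, smul_eq_mul,
    mul_ite, mul_one, mul_zero]

/-- Every basis element occurring in `x * basis G S` has the form `L.relComp S`, and composition on
the left can only shrink the projection and enlarge the kernel on the right. -/
theorem section_le_of_coord_mul_basis_ne_zero {x : BurnsideGroup G G} {S T : Subgroup (G × G)}
    (h : (basis G).coord T (x * basis G S) ≠ 0) :
    S.sndKer ≤ T.sndKer ∧ T.sndProj ≤ S.sndProj := by
  have := Fintype.ofFinite (Subgroup (G × G))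
  rw [coord_mul_basis] at h
  obtain ⟨L, -, hL⟩ := Finset.exists_ne_zero_of_sum_ne_zero h
  have hLT : L.relComp S = T := by
    by_contra hne
    exact hL (by rw [if_neg hne, mul_zero])
  subst hLT
  exact ⟨sndKer_le_sndKer_relComp _ _, sndProj_relComp_le _ _⟩

theorem coord_star_mul_self [Fintype (Subgroup (G × G))]
    (y : BurnsideGroup G G) (S : Subgroup (G × G)) :
    (basis G).coord S (star y * y) = ∑ T, ∑ T', (basis G).coord T y * (basis G).coord T' y *
      (if T.relInv.relComp T' = S then ((T.fstProj ⊔ T'.fstProj : Subgroup G).index : ℤ)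
        else 0) := by
  conv_lhs => rw [eq_sum_coord y, star_sum, Finset.sum_mul, map_sum]
  refine Finset.sum_congr rfl fun T _ => ?_
  rw [Finset.mul_sum, map_sum]
  refine Finset.sum_congr rfl fun T' _ => ?_
  rw [star_zsmul, star_basis, smul_mul_smul_comm, basis_mul, map_smul, map_smul, coord_basis,
    sndProj_relInv, smul_eq_mul, smul_eq_mul, mul_ite, mul_one, mul_zero]

/-- Put `e = basis G (diag P N)`. Orthogonality gives `star (u * e) * (u * e) = star e * e`, which
is `P.index • e`; the coordinate at `diag P N` is compared. By `eq_of_relInv_relComp` the mixed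
terms vanish, so a sum of weighted squares remains. -/
theorem sum_sq_coord_mul_index (hch : ∀ A B : Subgroup G, A ≤ B ∨ B ≤ A)
    [Fintype (Subgroup (G × G))] {u : BurnsideGroup G G}
    (hu : star u * u = 1) {P N : Subgroup G} (hNP : N < P) :
    ∑ T ∈ Finset.univ.filter (fun T : Subgroup (G × G) => T.sndProj = P ∧ T.sndKer = N),
      (basis G).coord T (u * basis G (diag P N)) ^ 2 * (T.fstProj.index : ℤ) = P.index := by
  have h1 : star (u * basis G (diag P N)) * (u * basis G (diag P N)) =
      (P.index : ℤ) • basis G (diag P N) := by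
    rw [star_mul, star_basis, relInv_diag, mul_assoc, ← mul_assoc (star u), hu, one_mul, basis_mul,
      diag_relComp_diag hNP.le, sndProj_diag, fstProj_diag, sup_idem]
  have h2 := congrArg ((basis G).coord (diag P N)) h1
  rw [map_smul, coord_basis, if_pos rfl, smul_eq_mul, mul_one, coord_star_mul_self] at h2
  rw [← h2, Finset.sum_filter]
  refine Finset.sum_congr rfl fun T _ => ?_
  -- The section of `T'` contains `(P, N)` because of the product and is contained in it because
  -- `T'` occurs in `u * basis G (diag P N)`.
  have hsec {T T' : Subgroup (G × G)} (h : T.relInv.relComp T' = diag P N)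
      (h0 : (basis G).coord T' (u * basis G (diag P N)) ≠ 0) :
      T'.sndProj = P ∧ T'.sndKer = N := by
    have h3 := section_le_of_relInv_relComp hNP.le h
    have h4 := section_le_of_coord_mul_basis_ne_zero h0
    rw [sndProj_diag, sndKer_diag hNP.le] at h4
    exact ⟨le_antisymm h4.2 h3.1, le_antisymm h3.2 h4.1⟩
  have hsymm {T T' : Subgroup (G × G)} (h : T.relInv.relComp T' = diag P N) :
      T'.relInv.relComp T = diag P N := by
    rw [← relInv_diag, ← h, relInv_relComp, relInv_relInv]
  rw [Finset.sum_eq_single T]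
  · split_ifs with hT hTT hTT
    · rw [sup_idem, sq]
    · exact (hTT (relInv_relComp_self T hT.1 hT.2)).elim
    · by_cases h0 : (basis G).coord T (u * basis G (diag P N)) = 0
      · rw [h0, zero_mul, zero_mul]
      · exact (hT (hsec hTT h0)).elim
    · rw [mul_zero]
  · intro T' _ hne
    split_ifs with hTT
    · by_cases h0 : (basis G).coord T (u * basis G (diag P N)) = 0
      · rw [h0, zero_mul, zero_mul]
      by_cases h0' : (basis G).coord T' (u * basis G (diag P N)) = 0
      · rw [h0', mul_zero, zero_mul]
      have h3 := hsec hTT h0'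
      have h4 := hsec (hsymm hTT) h0
      exact (hne (eq_of_relInv_relComp hch hNP.ne h4.1 h4.2 h3.1 h3.2 hTT).symm).elim
    · rw [mul_zero]
  · exact fun h => (h (Finset.mem_univ T)).elim

/-- By `le_of_relComp_diag` a contributing `L` has section at least `(P, N)`. With equal section, `L
= T`; with a larger one, the hypothesis leaves only the identity relation, which contributes `1` to
`diag P N`. The condition `T ≠ diag ⊤ ⊥` avoids counting the identity twice when `(P, N) = (⊤, ⊥)`.
-/
theorem coord_mul_basis_diag (hch : ∀ A B : Subgroup G, A ≤ B ∨ B ≤ A)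
    (x : BurnsideGroup G G) {P N : Subgroup G} (hNP : N < P)
    (hx : ∀ L : Subgroup (G × G), P ≤ L.sndProj → L.sndKer ≤ N →
      ¬ (L.sndProj = P ∧ L.sndKer = N) →
      (basis G).coord L x = if L = diag ⊤ ⊥ then 1 else 0)
    {T : Subgroup (G × G)} (hTP : T.sndProj = P) (hTN : T.sndKer = N) :
    (basis G).coord T (x * basis G (diag P N)) = (basis G).coord T x * P.index +
      if T = diag P N ∧ T ≠ diag ⊤ ⊥ then 1 else 0 := by
  have := Fintype.ofFinite (Subgroup (G × G))
  have hTS : T.relComp (diag P N) = T := relComp_diag_of_eq hTP hTN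
  have key (L : Subgroup (G × G)) : (basis G).coord L x *
      (if L.relComp (diag P N) = T then
        ((L.sndProj ⊔ (diag P N).fstProj : Subgroup G).index : ℤ) else 0) =
      (if L = T then (basis G).coord T x * P.index else 0) +
        if L = diag ⊤ ⊥ then (if T = diag P N ∧ T ≠ diag ⊤ ⊥ then 1 else 0) else 0 := by
    by_cases hLT : L = T
    · subst hLT
      rw [if_pos hTS, if_pos rfl, fstProj_diag, hTP, sup_idem]
      split_ifs with h1 h2
      · exact (h2.2 h1).elim
      · rw [add_zero]
      · rw [add_zero]
    · rw [if_neg hLT, zero_add]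
      by_cases hLS : L.relComp (diag P N) = T
      · have hle := le_of_relComp_diag hch hNP hTP hTN hLS
        rw [if_pos hLS, hx L hle.1 hle.2 fun h => hLT ?_]
        · by_cases hL : L = diag ⊤ ⊥
          · subst hL
            rw [diag_top_bot_relComp] at hLS
            rw [if_pos rfl, if_pos rfl, if_pos ⟨hLS.symm, fun h => hLT h.symm⟩, sndProj_diag,
              top_sup_eq, index_top, Nat.cast_one, one_mul]
          · rw [if_neg hL, if_neg hL, zero_mul]
        · rw [← hLS, relComp_diag_of_eq h.1 h.2]
      · rw [if_neg hLS, mul_zero]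
        split_ifs with h1 h2
        · subst h1
          rw [diag_top_bot_relComp] at hLS
          exact (hLS h2.1.symm).elim
        · rfl
        · rfl
  rw [coord_mul_basis, Finset.sum_congr rfl fun L _ => key L, Finset.sum_add_distrib,
    Finset.sum_ite_eq' Finset.univ T, Finset.sum_ite_eq' Finset.univ, if_pos (Finset.mem_univ _),
    if_pos (Finset.mem_univ _)]

/-- An orthogonal element whose columns at the idempotents `G / N` are normalised agrees with the
identity, up to linear combinations of the classes of the products `A × B`. -/
theorem coord_eq_of_star_mul_self (hch : ∀ A B : Subgroup G, A ≤ B ∨ B ≤ A)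
   
    (hidx : ∀ P : Subgroup G, P ≠ ⊥ → P ≠ ⊤ → 2 < P.index) {u : BurnsideGroup G G}
    (hu : star u * u = 1)
    (hnorm : ∀ N : Subgroup G, N ≠ ⊤ →
      (basis G).coord (diag ⊤ N) (u * basis G (diag ⊤ N)) = 1)
    (T : Subgroup (G × G)) (hT : T.sndKer ≠ T.sndProj) :
    (basis G).coord T u = if T = diag ⊤ ⊥ then 1 else 0 := by
  have := Fintype.ofFinite (Subgroup (G × G))
  -- This measure decreases strictly when the right section grows, so larger sections are treated
  -- first.
  induction hn : Nat.card T.sndKer + T.sndProj.index using Nat.strong_induction_on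
    generalizing T with
  | _ n ih =>
    obtain ⟨P, hTP⟩ : ∃ P, T.sndProj = P := ⟨_, rfl⟩
    obtain ⟨N, hTN⟩ : ∃ N, T.sndKer = N := ⟨_, rfl⟩
    have hNP : N < P := lt_of_le_of_ne (hTN ▸ hTP ▸ sndKer_le_sndProj T) (hTN ▸ hTP ▸ hT)
    have hx : ∀ L : Subgroup (G × G), P ≤ L.sndProj → L.sndKer ≤ N →
        ¬ (L.sndProj = P ∧ L.sndKer = N) →
        (basis G).coord L u = if L = diag ⊤ ⊥ then 1 else 0 := by
      intro L hLP hLN hne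
      refine ih _ ?_ L (hLN.trans_lt (hNP.trans_le hLP)).ne rfl
      rw [← hn, hTP, hTN]
      have h1 : Nat.card L.sndKer ≤ Nat.card N := Subgroup.card_le_of_le hLN
      have h2 : L.sndProj.index ≤ P.index := Subgroup.index_antitone hLP
      by_cases h : L.sndKer = N
      · have : L.sndProj.index < P.index := Subgroup.index_strictAnti
          (lt_of_le_of_ne hLP fun h' => hne ⟨h'.symm, h⟩)
        omega
      · have : Nat.card L.sndKer < Nat.card N := lt_of_not_ge fun hge =>
          h (Subgroup.eq_of_le_of_card_ge hLN hge)
        omega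
    have hform {T' : Subgroup (G × G)} (hP : T'.sndProj = P) (hN : T'.sndKer = N) :=
      coord_mul_basis_diag hch u hNP hx hP hN
    have hS := hform sndProj_diag (sndKer_diag hNP.le)
    have hPi : (0 : ℤ) < P.index := by
      exact_mod_cast Nat.pos_of_ne_zero Subgroup.index_ne_zero_of_finite
    have hsum := sum_sq_coord_mul_index hch hu hNP
    rw [← Finset.add_sum_erase _ _ (show diag P N ∈ _ from Finset.mem_filter.2
      ⟨Finset.mem_univ _, sndProj_diag, sndKer_diag hNP.le⟩), fstProj_diag] at hsum
    have hnn : ∀ T' ∈ (Finset.univ.filter fun T : Subgroup (G × G) =>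
        T.sndProj = P ∧ T.sndKer = N).erase (diag P N),
        0 ≤ (basis G).coord T' (u * basis G (diag P N)) ^ 2 * (T'.fstProj.index : ℤ) :=
      fun T' _ => by positivity
    -- For `P = ⊤` the value is normalised to `1`; otherwise it is `1` modulo `P.index`, and that
    -- index exceeds `1`.
    have hS0 : (basis G).coord (diag P N) (u * basis G (diag P N)) ≠ 0 := by
      by_cases hP : P = ⊤
      · subst hP
        rw [hnorm N hNP.ne]
        exact one_ne_zero
      · rw [hS, if_pos ⟨rfl, fun h => hP (by
          rw [← sndProj_diag (P := P) (N := N), h, sndProj_diag])⟩]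
        intro h0
        have h3 := hidx P (bot_le.trans_lt hNP).ne' hP
        have h4 : (P.index : ℤ) ∣ 1 :=
          ⟨-(basis G).coord (diag P N) u, by linear_combination h0⟩
        have h5 := Int.le_of_dvd one_pos h4
        omega
    have hsq : 1 ≤ (basis G).coord (diag P N) (u * basis G (diag P N)) ^ 2 :=
      Order.one_le_iff_pos.2 (sq_pos_iff.2 hS0)
    have hge := Finset.sum_nonneg hnn
    -- The term at `diag P N` alone already reaches the total `P.index`, so all other terms of the
    -- section vanish.
    have hz : ∑ T' ∈ (Finset.univ.filter fun T : Subgroup (G × G) =>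
        T.sndProj = P ∧ T.sndKer = N).erase (diag P N),
        (basis G).coord T' (u * basis G (diag P N)) ^ 2 * (T'.fstProj.index : ℤ) = 0 := by
      nlinarith
    have hsq1 : (basis G).coord (diag P N) (u * basis G (diag P N)) ^ 2 = 1 := by
      rw [hz, add_zero] at hsum
      exact mul_right_cancel₀ hPi.ne' (hsum.trans (one_mul _).symm)
    rw [Finset.sum_eq_zero_iff_of_nonneg hnn] at hz
    by_cases hTS : T = diag P N
    · subst hTS
      rw [hS] at hsq1
      by_cases hΔ : diag P N = diag ⊤ ⊥
      · have hP : P = ⊤ := by rw [← sndProj_diag (P := P) (N := N), hΔ, sndProj_diag]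
        subst hP
        rw [hnorm N hNP.ne, index_top, if_neg fun h => h.2 hΔ] at hS
        rw [if_pos hΔ]
        simpa using hS.symm
      · rw [if_pos ⟨rfl, hΔ⟩] at hsq1 hS
        rw [if_neg hΔ]
        by_cases hP : P = ⊤
        · subst hP
          rw [hnorm N hNP.ne, index_top] at hS
          simpa using hS
        · have h3 := hidx P (bot_le.trans_lt hNP).ne' hP
          rcases sq_eq_one_iff.1 hsq1 with h | h
          · exact (mul_eq_zero.1 (add_eq_right.1 h)).resolve_right hPi.ne'
          -- The value `-1` would mean that `P.index` divides `2`; this is where subgroups of index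
          -- `2` are excluded.
          · have h4 : (P.index : ℤ) ∣ 2 :=
              ⟨-(basis G).coord (diag P N) u, by linear_combination h⟩
            have h5 := Int.le_of_dvd two_pos h4
            omega
    · have h0 := hz T (Finset.mem_erase.2 ⟨hTS, Finset.mem_filter.2 ⟨Finset.mem_univ _, hTP, hTN⟩⟩)
      have hi : (T.fstProj.index : ℤ) ≠ 0 := by
        exact_mod_cast Subgroup.index_ne_zero_of_finite
      have h1 := pow_eq_zero_iff (two_ne_zero) |>.1 ((mul_eq_zero.1 h0).resolve_right hi)
      rw [hform hTP hTN, if_neg fun h => hTS h.1, add_zero] at h1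
      have h2 := (mul_eq_zero.1 h1).resolve_right hPi.ne'
      rw [h2, if_neg]
      rintro rfl
      apply hTS
      rw [sndProj_diag] at hTP
      rw [sndKer_diag bot_le] at hTN
      rw [← hTP, ← hTN]

end BurnsideGroup

/-! ### Graphs of power maps on quotients, and products of subgroups. -/

namespace Subgroup

variable {G : Type*} [CommGroup G]

/-- The pairs `(a, b)` with `b ≡ a ^ k` modulo `N`. -/
def powGraph (N : Subgroup G) (k : ℕ) : Subgroup (G × G) where
  carrier := {x | x.2 / x.1 ^ k ∈ N}
  one_mem' := by simp
  mul_mem' := by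
    rintro a b h1 h2
    simpa [mul_pow, mul_div_mul_comm] using N.mul_mem h1 h2
  inv_mem' := by
    rintro a h
    have := N.inv_mem h
    rw [inv_div'] at this
    simpa using this

variable {M N : Subgroup G} {k l : ℕ}

theorem mem_powGraph {a b : G} : (a, b) ∈ powGraph N k ↔ b / a ^ k ∈ N := Iff.rfl

theorem powGraph_one : powGraph N 1 = diag ⊤ N := by
  ext ⟨a, b⟩
  rw [mem_powGraph, mem_diag, pow_one, ← inv_mem_iff, inv_div]
  simp

theorem sndKer_powGraph : (powGraph N k).sndKer = N := by
  ext x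
  rw [mem_sndKer, mem_powGraph, one_pow, div_one]

theorem fstProj_powGraph : (powGraph N k).fstProj = ⊤ :=
  eq_top_iff.2 fun x _ => mem_fstProj.2 ⟨x ^ k, by simp [mem_powGraph]⟩

theorem exists_pow_eq_of_coprime [Finite G] (hk : (Nat.card G).Coprime k) {x : G} (hx : x ∈ N) :
    ∃ y ∈ N, y ^ k = x := by
  have h : (Nat.card N).Coprime k := hk.coprime_dvd_left N.card_subgroup_dvd_card
  obtain ⟨y, hy⟩ := (powCoprime h).surjective ⟨x, hx⟩
  exact ⟨y, y.2, congrArg Subtype.val hy⟩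

theorem sndProj_powGraph [Finite G] (hk : (Nat.card G).Coprime k) :
    (powGraph N k).sndProj = ⊤ := by
  refine eq_top_iff.2 fun x _ => mem_sndProj.2 ?_
  obtain ⟨y, -, hy⟩ := exists_pow_eq_of_coprime hk (mem_top x)
  exact ⟨y, by simp [mem_powGraph, hy]⟩

/-- Coprimality of `l` is used to write the component in `N` as an `l`-th power of an element of
`N`. -/
theorem powGraph_relComp [Finite G] (hl : (Nat.card G).Coprime l) :
    (powGraph N k).relComp (powGraph M l) = powGraph (N ⊔ M) (k * l) := by
  ext ⟨a, c⟩
  rw [mem_relComp, mem_powGraph, mem_sup]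
  constructor
  · rintro ⟨b, h1, h2⟩
    rw [mem_powGraph] at h1 h2
    refine ⟨_, N.pow_mem h1 l, _, h2, ?_⟩
    rw [div_pow, ← pow_mul, mul_comm, div_mul_div_cancel]
  · rintro ⟨x, hx, y, hy, h⟩
    obtain ⟨z, hz, rfl⟩ := exists_pow_eq_of_coprime hl hx
    refine ⟨z * a ^ k, by simpa [mem_powGraph] using hz, ?_⟩
    rw [mem_powGraph]
    convert hy
    rw [mul_pow, ← pow_mul, ← div_div, div_right_comm, ← h, mul_div_cancel_left]

theorem powGraph_congr (h : k ≡ l [MOD N.index]) : powGraph N k = powGraph N l := by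
  have key (a : G) : a ^ k / a ^ l ∈ N := by
    rw [← QuotientGroup.eq_one_iff, QuotientGroup.mk_div, QuotientGroup.mk_pow,
      QuotientGroup.mk_pow, div_eq_one, pow_eq_pow_iff_modEq]
    exact h.of_dvd (_root_.orderOf_dvd_natCard _)
  ext ⟨a, b⟩
  rw [mem_powGraph, mem_powGraph]
  constructor <;> intro h'
  · simpa using N.mul_mem h' (key a)
  · simpa using N.div_mem h' (key a)

/-- The image of a generator of `G` generates `G ⧸ N`, so its order is the full index. -/
theorem powGraph_inj [Finite G] [IsCyclic G] (h : powGraph N k = powGraph N l) :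
    k ≡ l [MOD N.index] := by
  obtain ⟨g, hg⟩ := IsCyclic.exists_generator (α := G)
  have h1 : (g, g ^ k) ∈ powGraph N k := by simp [mem_powGraph]
  rw [h, mem_powGraph, ← QuotientGroup.eq_one_iff, QuotientGroup.mk_div, QuotientGroup.mk_pow,
      QuotientGroup.mk_pow, div_eq_one, pow_eq_pow_iff_modEq] at h1
  convert h1
  refine (orderOf_eq_card_of_forall_mem_zpowers fun x => ?_).symm
  induction x using QuotientGroup.induction_on with | H x => ?_
  obtain ⟨j, rfl⟩ := hg x
  exact ⟨j, rfl⟩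

theorem relInv_powGraph (h : k * l ≡ 1 [MOD N.index]) :
    (powGraph N k).relInv = powGraph N l := by
  have key (k l : ℕ) (h : k * l ≡ 1 [MOD N.index]) : (powGraph N k).relInv ≤ powGraph N l := by
    rintro ⟨b, a⟩ hb
    rw [mem_relInv, mem_powGraph] at hb
    rw [mem_powGraph]
    have h1 : (a, a) ∈ powGraph N (k * l) := by
      rw [powGraph_congr h, mem_powGraph]
      simp
    rw [mem_powGraph] at h1
    have h2 := N.div_mem h1 (N.pow_mem hb l)
    convert h2 using 1
    rw [div_pow, pow_mul, div_div_div_cancel_right]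
  refine le_antisymm (key k l h) ?_
  rintro ⟨a, b⟩ hab
  exact key l k (by rwa [mul_comm]) hab

/-- Choosing one element of `T` over a generator of `G` fixes the exponent; the remaining freedom
over each point is exactly `T.sndKer`. -/
theorem exists_eq_powGraph [Finite G] [IsCyclic G] {T : Subgroup (G × G)} (h : T.fstProj = ⊤) :
    ∃ k, T = powGraph T.sndKer k := by
  obtain ⟨g, hg⟩ := IsCyclic.exists_monoid_generator (α := G)
  obtain ⟨b, hb⟩ := mem_fstProj.1 (h ▸ mem_top g : g ∈ T.fstProj)
  obtain ⟨k, hk⟩ := hg b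
  refine ⟨k, ?_⟩
  have key (x : G) : (x, x ^ k) ∈ T := by
    obtain ⟨j, rfl⟩ := hg x
    have := T.pow_mem hb j
    simp only [Prod.pow_mk] at this ⊢
    rwa [← hk, ← pow_mul, mul_comm, pow_mul] at this
  ext ⟨x, y⟩
  rw [mem_powGraph, mem_sndKer]
  constructor <;> intro h'
  · simpa [div_eq_mul_inv] using T.mul_mem h' (T.inv_mem (key x))
  · simpa using T.mul_mem h' (key x)

theorem eq_prod_of_sndKer_eq {T : Subgroup (G × G)} (h : T.sndKer = T.sndProj) :
    T = T.fstProj.prod T.sndProj := by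
  ext ⟨a, b⟩
  rw [mem_prod]
  constructor
  · exact fun hT => ⟨mem_fstProj.2 ⟨b, hT⟩, mem_sndProj.2 ⟨a, hT⟩⟩
  · rintro ⟨ha, hb⟩
    obtain ⟨b', hb'⟩ := mem_fstProj.1 ha
    have h2 : b / b' ∈ T.sndKer := by
      rw [h]
      exact T.sndProj.div_mem hb (mem_sndProj.2 ⟨a, hb'⟩)
    rw [mem_sndKer] at h2
    simpa using T.mul_mem hb' h2

theorem fstProj_prod {A B : Subgroup G} : (A.prod B).fstProj = A := by
  ext x
  rw [mem_fstProj]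
  exact ⟨fun ⟨_, h⟩ => h.1, fun h => ⟨1, h, B.one_mem⟩⟩

theorem sndProj_prod {A B : Subgroup G} : (A.prod B).sndProj = B := by
  ext x
  rw [mem_sndProj]
  exact ⟨fun ⟨_, h⟩ => h.2, fun h => ⟨1, A.one_mem, h⟩⟩

theorem relInv_prod {A B : Subgroup G} : (A.prod B).relInv = B.prod A := by
  ext ⟨a, b⟩
  rw [mem_relInv, mem_prod, mem_prod]
  exact and_comm

theorem prod_relComp_prod {A B C D : Subgroup G} :
    (A.prod B).relComp (C.prod D) = A.prod D := by
  ext ⟨a, b⟩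
  rw [mem_relComp, mem_prod]
  exact ⟨fun ⟨_, h1, h2⟩ => ⟨h1.1, h2.2⟩,
    fun h => ⟨1, ⟨h.1, B.one_mem⟩, C.one_mem, h.2⟩⟩

theorem prod_top_top : (⊤ : Subgroup G).prod (⊤ : Subgroup G) = diag ⊤ ⊤ := by
  ext ⟨a, b⟩
  simp [mem_diag]

end Subgroup

/-! ### The chain of subgroups of a cyclic group of prime power order. -/

section

open Subgroup

variable {G : Type*} [CommGroup G] [Finite G] [IsCyclic G]

/-- In a cyclic group the kernel of the power map by `Nat.card B` has order `Nat.card B`, so it is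
no larger than `B`. -/
theorem IsCyclic.mem_iff_pow_card_eq_one {B : Subgroup G} {x : G} :
    x ∈ B ↔ x ^ Nat.card B = 1 := by
  have hle : B ≤ (powMonoidHom (Nat.card B) : G →* G).ker := fun x hx => by
    rw [MonoidHom.mem_ker, powMonoidHom_apply, ← orderOf_dvd_iff_pow_eq_one]
    exact B.orderOf_dvd_natCard hx
  have hB : B = (powMonoidHom (Nat.card B) : G →* G).ker := by
    refine Subgroup.eq_of_le_of_card_ge hle ?_
    rw [IsCyclic.card_powMonoidHom_ker, Nat.gcd_eq_right B.card_subgroup_dvd_card]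
  constructor
  · exact fun hx => hle hx
  · intro hx
    rw [hB]
    exact hx

theorem IsCyclic.le_of_card_dvd {A B : Subgroup G} (h : Nat.card A ∣ Nat.card B) : A ≤ B := by
  intro x hx
  rw [IsCyclic.mem_iff_pow_card_eq_one, ← orderOf_dvd_iff_pow_eq_one]
  exact (A.orderOf_dvd_natCard hx).trans h

theorem IsCyclic.eq_of_index_eq {A B : Subgroup G} (h : A.index = B.index) : A = B := by
  have h' : Nat.card A = Nat.card B := by
    have h1 := A.card_mul_index
    rw [← B.card_mul_index, h] at h1
    exact Nat.eq_of_mul_eq_mul_right (Nat.pos_of_ne_zero Subgroup.index_ne_zero_of_finite) h1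
  exact le_antisymm (IsCyclic.le_of_card_dvd h'.dvd) (IsCyclic.le_of_card_dvd h'.symm.dvd)

variable {p n : ℕ}

theorem IsCyclic.subgroup_total (hp : p.Prime) (hG : Nat.card G = p ^ n) (A B : Subgroup G) :
    A ≤ B ∨ B ≤ A := by
  obtain ⟨a, -, ha⟩ := (Nat.dvd_prime_pow hp).1 (hG ▸ A.card_subgroup_dvd_card)
  obtain ⟨b, -, hb⟩ := (Nat.dvd_prime_pow hp).1 (hG ▸ B.card_subgroup_dvd_card)
  rcases le_total a b with h | h
  · exact Or.inl (IsCyclic.le_of_card_dvd (ha ▸ hb ▸ pow_dvd_pow p h))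
  · exact Or.inr (IsCyclic.le_of_card_dvd (ha ▸ hb ▸ pow_dvd_pow p h))

/-- The subgroup of `m`-th powers. -/
def powerSubgroup (G : Type*) [CommGroup G] (m : ℕ) : Subgroup G := (powMonoidHom m : G →* G).range

theorem powerSubgroup_le_of_dvd {G : Type*} [CommGroup G] {m l : ℕ} (h : m ∣ l) :
    powerSubgroup G l ≤ powerSubgroup G m := by
  obtain ⟨c, rfl⟩ := h
  rintro _ ⟨x, rfl⟩
  refine ⟨x ^ c, ?_⟩
  rw [powMonoidHom_apply, powMonoidHom_apply, ← pow_mul, mul_comm]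

theorem powerSubgroup_one {G : Type*} [CommGroup G] : powerSubgroup G 1 = ⊤ :=
  eq_top_iff.2 fun x _ => ⟨x, pow_one x⟩

theorem powerSubgroup_card {G : Type*} [CommGroup G] [Finite G] : powerSubgroup G (Nat.card G) = ⊥ := by
  rw [eq_bot_iff]
  rintro _ ⟨x, rfl⟩
  exact pow_card_eq_one'

theorem index_powerSubgroup_pow (hG : Nat.card G = p ^ n) {i : ℕ} (hi : i ≤ n) :
    (powerSubgroup G (p ^ i)).index = p ^ i := by
  rw [powerSubgroup, IsCyclic.index_powMonoidHom_range, hG]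
  exact Nat.gcd_eq_right (pow_dvd_pow p hi)

theorem exists_eq_powerSubgroup_pow (hp : p.Prime) (hG : Nat.card G = p ^ n) (A : Subgroup G) :
    ∃ i ≤ n, A = powerSubgroup G (p ^ i) := by
  obtain ⟨i, hi, h⟩ := (Nat.dvd_prime_pow hp).1 (hG ▸ A.index_dvd_card)
  exact ⟨i, hi, IsCyclic.eq_of_index_eq (h.trans (index_powerSubgroup_pow hG hi).symm)⟩

theorem powerSubgroup_pow_sup {G : Type*} [CommGroup G] (p i j : ℕ) :
    powerSubgroup G (p ^ i) ⊔ powerSubgroup G (p ^ j) = powerSubgroup G (p ^ min i j) := by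
  rcases le_total i j with h | h
  · rw [min_eq_left h, sup_eq_left]
    exact powerSubgroup_le_of_dvd (pow_dvd_pow p h)
  · rw [min_eq_right h, sup_eq_right]
    exact powerSubgroup_le_of_dvd (pow_dvd_pow p h)

theorem powerSubgroup_pow_injective (hp : p.Prime) (hG : Nat.card G = p ^ n) {i j : ℕ}
    (hi : i ≤ n) (hj : j ≤ n) (h : powerSubgroup G (p ^ i) = powerSubgroup G (p ^ j)) : i = j := by
  have := congrArg Subgroup.index h
  rw [index_powerSubgroup_pow hG hi, index_powerSubgroup_pow hG hj] at this
  exact Nat.pow_right_injective hp.two_le this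

theorem le_powerSubgroup_of_ne_top (hp : p.Prime) (hG : Nat.card G = p ^ n) {A : Subgroup G}
    (hA : A ≠ ⊤) : A ≤ powerSubgroup G p := by
  obtain ⟨i, -, rfl⟩ := exists_eq_powerSubgroup_pow hp hG A
  refine powerSubgroup_le_of_dvd (dvd_pow_self p ?_)
  rintro rfl
  exact hA (by rw [pow_zero, powerSubgroup_one])

theorem powerSubgroup_prime_ne_top (hp : p.Prime) (hG : Nat.card G = p ^ n) (hn : n ≠ 0) :
    powerSubgroup G p ≠ ⊤ := by
  intro h
  have h1 := index_powerSubgroup_pow hG (Nat.one_le_iff_ne_zero.2 hn)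
  rw [pow_one, h, Subgroup.index_top] at h1
  exact hp.one_lt.ne h1

/-- If `p` divided `k`, both the `k`-th powers and the proper subgroup `A` would lie in the subgroup
of `p`-th powers, and so would the second projection. -/
theorem coprime_of_sndProj_powGraph (hp : p.Prime) (hG : Nat.card G = p ^ n) {A : Subgroup G}
    (hA : A ≠ ⊤) {k : ℕ} (h : (powGraph A k).sndProj = ⊤) : (Nat.card G).Coprime k := by
  have hn : n ≠ 0 := by
    rintro rfl
    obtain ⟨i, hi, rfl⟩ := exists_eq_powerSubgroup_pow hp hG A
    obtain rfl := Nat.le_zero.1 hi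
    exact hA (by rw [pow_zero, powerSubgroup_one])
  rw [hG, Nat.coprime_pow_left_iff (Nat.pos_of_ne_zero hn), hp.coprime_iff_not_dvd]
  intro hk
  apply powerSubgroup_prime_ne_top hp hG hn
  rw [eq_top_iff, ← h]
  intro x hx
  obtain ⟨a, ha⟩ := mem_sndProj.1 hx
  have h1 := le_powerSubgroup_of_ne_top hp hG hA (mem_powGraph.1 ha)
  have h2 : a ^ k ∈ powerSubgroup G p := powerSubgroup_le_of_dvd hk ⟨a, rfl⟩
  simpa using (powerSubgroup G p).mul_mem h1 h2

end

/-! ### Representatives of units modulo prime powers. -/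

section

variable {p n i : ℕ}

/-- A natural number prime to `p` that represents a unit modulo `p ^ i`. -/
def unitRep (k : (ZMod (p ^ i))ˣ) : ℕ := (k : ZMod (p ^ i)).val + p ^ i

theorem natCast_unitRep [NeZero p] (k : (ZMod (p ^ i))ˣ) :
    ((unitRep k : ℕ) : ZMod (p ^ i)) = k := by
  rw [unitRep, Nat.cast_add, ZMod.natCast_self, add_zero, ZMod.natCast_val, ZMod.cast_id]

theorem coprime_unitRep (hp : p.Prime) (k : (ZMod (p ^ i))ˣ) : p.Coprime (unitRep k) := by
  have := NeZero.mk hp.ne_zero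
  rcases Nat.eq_zero_or_pos i with rfl | hi
  -- Modulo `1` the residue is `0`; the summand `p ^ i` in `unitRep` turns the representative into
  -- `1`, which is prime to `p`.
  · have h : (k : ZMod (p ^ 0)).val = 0 := by
      have h1 := ZMod.val_lt (k : ZMod (p ^ 0))
      have h2 : p ^ 0 = 1 := pow_zero p
      omega
    rw [unitRep, h, pow_zero]
    exact Nat.coprime_one_right p
  · have h := (ZMod.isUnit_iff_coprime (unitRep k) (p ^ i)).1 (by
      rw [natCast_unitRep]
      exact k.isUnit)
    exact (Nat.Coprime.coprime_dvd_right (dvd_pow_self p hi.ne') h).symm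

theorem unitRep_mul_modEq [NeZero p] (k l : (ZMod (p ^ i))ˣ) :
    unitRep k * unitRep l ≡ unitRep (k * l) [MOD p ^ i] := by
  rw [← ZMod.natCast_eq_natCast_iff, Nat.cast_mul, natCast_unitRep, natCast_unitRep,
    natCast_unitRep, Units.val_mul]

theorem unitRep_one_modEq [NeZero p] : unitRep (1 : (ZMod (p ^ i))ˣ) ≡ 1 [MOD p ^ i] := by
  rw [← ZMod.natCast_eq_natCast_iff, natCast_unitRep, Units.val_one, Nat.cast_one]

theorem unitRep_injective_modEq [NeZero p] {k l : (ZMod (p ^ i))ˣ}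
    (h : unitRep k ≡ unitRep l [MOD p ^ i]) : k = l := by
  rw [← ZMod.natCast_eq_natCast_iff, natCast_unitRep, natCast_unitRep] at h
  exact Units.ext h

theorem exists_unitRep_modEq [NeZero p] {k : ℕ} (hk : (p ^ i).Coprime k) :
    ∃ l : (ZMod (p ^ i))ˣ, k ≡ unitRep l [MOD p ^ i] := by
  refine ⟨ZMod.unitOfCoprime k hk.symm, ?_⟩
  rw [← ZMod.natCast_eq_natCast_iff, natCast_unitRep, ZMod.coe_unitOfCoprime]

end

/-! ### Orthogonal idempotents and the units acting on their blocks. -/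

namespace BurnsideGroup

open Subgroup

open scoped Classical

variable {G : Type u} [CommGroup G] [Finite G]

/-- The class of the biset of the endomorphism `a ↦ a ^ k` of `G / N`. -/
noncomputable def powClass (N : Subgroup G) (k : ℕ) : BurnsideGroup G G := basis G (powGraph N k)

theorem powClass_mul (N M : Subgroup G) (k : ℕ) {l : ℕ} (hl : (Nat.card G).Coprime l) :
    powClass N k * powClass M l = powClass (N ⊔ M) (k * l) := by
  rw [powClass, powClass, basis_mul, fstProj_powGraph, sup_top_eq, index_top, Nat.cast_one,
    one_smul, powGraph_relComp hl, powClass]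

theorem powClass_bot_one : powClass (⊥ : Subgroup G) 1 = 1 := by
  rw [powClass, powGraph_one, one_eq_basis_diag]

theorem powClass_congr {N : Subgroup G} {k l : ℕ} (h : k ≡ l [MOD N.index]) :
    powClass N k = powClass N l := by
  rw [powClass, powGraph_congr h, powClass]

theorem star_powClass {N : Subgroup G} {k l : ℕ} (h : k * l ≡ 1 [MOD N.index]) :
    star (powClass N k) = powClass N l := by
  rw [powClass, star_basis, relInv_powGraph h, powClass]

/-- The classes of the bisets `G / N`, for `N` in the chain of subgroups of `p ^ i`-th powers,
preceded by zero. -/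
noncomputable def chainIdem (G : Type u) [CommGroup G] [Finite G] (p : ℕ) :
    ℕ → BurnsideGroup G G
  | 0 => 0
  | i + 1 => powClass (powerSubgroup G (p ^ i)) 1

/-- The product of the classes of `G / N` and `G / M` is that of `G / NM`, which along the chain is
the minimum of the indices; the initial zero makes the rule uniform, so that successive differences
are orthogonal idempotents. -/
theorem chainIdem_mul (p i j : ℕ) :
    chainIdem G p i * chainIdem G p j = chainIdem G p (min i j) := by
  rcases i with _ | i
  · rw [Nat.zero_min, chainIdem, zero_mul]
  rcases j with _ | j
  · rw [Nat.min_zero, chainIdem, mul_zero]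
  rw [Nat.succ_min_succ, chainIdem, chainIdem, chainIdem, powClass_mul _ _ _ (Nat.coprime_one_right _),
    powerSubgroup_pow_sup, mul_one]

theorem star_chainIdem (p i : ℕ) : star (chainIdem G p i) = chainIdem G p i := by
  rcases i with _ | i
  · rw [chainIdem, star_zero]
  · rw [chainIdem, star_powClass (l := 1) (Nat.ModEq.refl _)]

theorem powClass_bot_mul_chainIdem (p i k : ℕ) :
    powClass ⊥ k * chainIdem G p (i + 1) = powClass (powerSubgroup G (p ^ i)) k := by
  rw [chainIdem, powClass_mul _ _ _ (Nat.coprime_one_right _), bot_sup_eq, mul_one]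

theorem chainIdem_mul_powClass_bot (p i : ℕ) {k : ℕ} (hk : (Nat.card G).Coprime k) :
    chainIdem G p i * powClass ⊥ k = powClass ⊥ k * chainIdem G p i := by
  rcases i with _ | i
  · rw [chainIdem, mul_zero, zero_mul]
  · rw [powClass_bot_mul_chainIdem, chainIdem, powClass_mul _ _ _ hk, sup_bot_eq, one_mul]

/-- The orthogonal idempotents that are the successive differences of the classes `G / N`. -/
noncomputable def blockIdem (G : Type u) [CommGroup G] [Finite G] (p i : ℕ) : BurnsideGroup G G :=
  chainIdem G p (i + 1) - chainIdem G p i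

theorem blockIdem_mul_self (p i : ℕ) : blockIdem G p i * blockIdem G p i = blockIdem G p i := by
  simp [blockIdem, sub_mul, mul_sub, chainIdem_mul]

theorem blockIdem_mul_of_lt (p : ℕ) {i j : ℕ} (h : i < j) :
    blockIdem G p i * blockIdem G p j = 0 := by
  rw [blockIdem, blockIdem, sub_mul, mul_sub, mul_sub, chainIdem_mul, chainIdem_mul,
    chainIdem_mul, chainIdem_mul, min_eq_left (by omega), min_eq_left (by omega),
    min_eq_left (by omega), min_eq_left (by omega), sub_self, sub_self, sub_self]

theorem star_blockIdem (p i : ℕ) : star (blockIdem G p i) = blockIdem G p i := by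
  rw [blockIdem, star_sub, star_chainIdem, star_chainIdem]

theorem blockIdem_mul (p i j : ℕ) :
    blockIdem G p i * blockIdem G p j = if i = j then blockIdem G p i else 0 := by
  split_ifs with h
  · rw [← h, blockIdem_mul_self]
  · rcases lt_or_gt_of_ne h with h | h
    · exact blockIdem_mul_of_lt p h
    · rw [← star_blockIdem, ← star_blockIdem p j, ← star_mul, blockIdem_mul_of_lt p h, star_zero]

theorem blockIdem_mul_powClass_bot (p i : ℕ) {k : ℕ} (hk : (Nat.card G).Coprime k) :
    blockIdem G p i * powClass ⊥ k = powClass ⊥ k * blockIdem G p i := by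
  rw [blockIdem, sub_mul, mul_sub, chainIdem_mul_powClass_bot _ _ hk,
    chainIdem_mul_powClass_bot _ _ hk]

theorem chainIdem_mul_blockIdem_of_lt (p : ℕ) {i j : ℕ} (h : j < i) :
    chainIdem G p i * blockIdem G p j = blockIdem G p j := by
  rw [blockIdem, mul_sub, chainIdem_mul, chainIdem_mul, min_eq_right (by omega),
    min_eq_right (by omega)]

theorem chainIdem_succ (p i : ℕ) :
    chainIdem G p (i + 1) = basis G (diag ⊤ (powerSubgroup G (p ^ i))) := by
  rw [chainIdem, powClass, powGraph_one]

variable {p n : ℕ}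

/-- The group of signs and automorphisms acting on the blocks. -/
abbrev BlockGroup (p n : ℕ) : Type := (i : Fin (n + 1)) → ℤˣ × (ZMod (p ^ (i : ℕ)))ˣ

/-- The orthogonal unit that acts on each block by a sign and an automorphism. -/
noncomputable def blockUnit (G : Type u) [CommGroup G] [Finite G] {p n : ℕ}
    (w : BlockGroup p n) : BurnsideGroup G G :=
  ∑ i, ((w i).1 : ℤ) • (powClass ⊥ (unitRep (w i).2) * blockIdem G p i)

theorem blockUnit_mul_blockIdem (w : BlockGroup p n) (i : Fin (n + 1)) :
    blockUnit G w * blockIdem G p i =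
      ((w i).1 : ℤ) • (powClass ⊥ (unitRep (w i).2) * blockIdem G p i) := by
  rw [blockUnit, Finset.sum_mul, Finset.sum_eq_single i]
  · rw [smul_mul_assoc, mul_assoc, blockIdem_mul_self]
  · intro j _ hj
    rw [smul_mul_assoc, mul_assoc, blockIdem_mul, if_neg (fun h => hj (Fin.ext h)), mul_zero,
      smul_zero]
  · exact fun h => (h (Finset.mem_univ i)).elim

theorem coprime_card_unitRep {G : Type*} (hp : p.Prime) (hG : Nat.card G = p ^ n) {i : ℕ}
    (k : (ZMod (p ^ i))ˣ) : (Nat.card G).Coprime (unitRep k) := by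
  rw [hG]
  exact (coprime_unitRep hp k).pow_left n

theorem chainIdem_card_succ (hG : Nat.card G = p ^ n) : chainIdem G p (n + 1) = 1 := by
  rw [chainIdem, ← hG, powerSubgroup_card, powClass_bot_one]

theorem sum_blockIdem (hG : Nat.card G = p ^ n) :
    ∑ i : Fin (n + 1), blockIdem G p i = 1 := by
  rw [Fin.sum_univ_eq_sum_range (fun i => blockIdem G p i)]
  simp only [blockIdem]
  rw [Finset.sum_range_sub (chainIdem G p), chainIdem_card_succ hG, chainIdem, sub_zero]

theorem eq_of_mul_blockIdem_eq (hG : Nat.card G = p ^ n) {x y : BurnsideGroup G G}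
    (h : ∀ i : Fin (n + 1), x * blockIdem G p i = y * blockIdem G p i) : x = y := by
  rw [← mul_one x, ← mul_one y, ← sum_blockIdem hG, Finset.mul_sum, Finset.mul_sum]
  exact Finset.sum_congr rfl fun i _ => h i

variable [IsCyclic G]

theorem powClass_bot_mul_chainIdem_congr (hG : Nat.card G = p ^ n) {i k l : ℕ} (hi : i ≤ n)
    (h : k ≡ l [MOD p ^ i]) :
    powClass ⊥ k * chainIdem G p (i + 1) = powClass ⊥ l * chainIdem G p (i + 1) := by
  rw [powClass_bot_mul_chainIdem, powClass_bot_mul_chainIdem]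
  exact powClass_congr (by rwa [index_powerSubgroup_pow hG hi])

/-- Block `i` absorbs the class of `G / N` with `N` of index `p ^ i`, so a power map acts on it only
through its exponent modulo `p ^ i`. -/
theorem powClass_bot_mul_blockIdem_congr (hG : Nat.card G = p ^ n) {i k l : ℕ} (hi : i ≤ n)
    (h : k ≡ l [MOD p ^ i]) :
    powClass ⊥ k * blockIdem G p i = powClass ⊥ l * blockIdem G p i := by
  rw [← chainIdem_mul_blockIdem_of_lt p (Nat.lt_succ_self i), ← mul_assoc, ← mul_assoc,
    powClass_bot_mul_chainIdem_congr hG hi h]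

theorem blockUnit_mul (hp : p.Prime) (hG : Nat.card G = p ^ n) (w v : BlockGroup p n) :
    blockUnit G (w * v) = blockUnit G w * blockUnit G v := by
  have := NeZero.mk hp.ne_zero
  refine eq_of_mul_blockIdem_eq hG fun i => ?_
  have hw := coprime_card_unitRep hp hG (w i).2
  have hv := coprime_card_unitRep hp hG (v i).2
  calc blockUnit G (w * v) * blockIdem G p i
      = ((w * v) i).1 • (powClass ⊥ (unitRep ((w * v) i).2) * blockIdem G p i) :=
        blockUnit_mul_blockIdem _ _
    _ = (((w i).1 : ℤ) * ((v i).1 : ℤ)) •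
          (powClass ⊥ (unitRep (w i).2 * unitRep (v i).2) * blockIdem G p i) := by
        rw [powClass_bot_mul_blockIdem_congr hG (Nat.le_of_lt_succ i.2)
          (unitRep_mul_modEq (w i).2 (v i).2)]
        rfl
    _ = ((v i).1 : ℤ) • (blockUnit G w * blockIdem G p i * powClass ⊥ (unitRep (v i).2)) := by
        rw [blockUnit_mul_blockIdem, smul_mul_assoc, smul_smul, mul_assoc,
          blockIdem_mul_powClass_bot _ _ hv, ← mul_assoc, powClass_mul _ _ _ hv, sup_idem,
          mul_comm ((w i).1 : ℤ)]
    _ = _ := by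
        rw [mul_assoc, mul_assoc, blockIdem_mul_powClass_bot _ _ hv, blockUnit_mul_blockIdem,
          mul_smul_comm]

theorem blockUnit_one (hp : p.Prime) (hG : Nat.card G = p ^ n) :
    blockUnit G (1 : BlockGroup p n) = 1 := by
  have := NeZero.mk hp.ne_zero
  refine eq_of_mul_blockIdem_eq hG fun i => ?_
  rw [blockUnit_mul_blockIdem, Pi.one_apply, Prod.fst_one, Prod.snd_one, Units.val_one,
    one_smul, powClass_bot_mul_blockIdem_congr hG (Nat.le_of_lt_succ i.2) unitRep_one_modEq,
    powClass_bot_one]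

theorem star_blockUnit (hp : p.Prime) (hG : Nat.card G = p ^ n) (w : BlockGroup p n) :
    star (blockUnit G w) = blockUnit G w⁻¹ := by
  have := NeZero.mk hp.ne_zero
  rw [blockUnit, blockUnit, star_sum]
  refine Finset.sum_congr rfl fun i _ => ?_
  have hi := Nat.le_of_lt_succ i.2
  have key : unitRep (w i).2 * unitRep (w i).2⁻¹ ≡ 1 [MOD p ^ (i : ℕ)] := by
    refine (unitRep_mul_modEq _ _).trans ?_
    rw [mul_inv_cancel]
    exact unitRep_one_modEq
  -- Both chain terms of block `i` belong to quotients whose order divides `p ^ i`, so an inverse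
  -- modulo `p ^ i` serves for each of them.
  have hstar (j : ℕ) (hj : j ≤ i + 1) :
      star (powClass ⊥ (unitRep (w i).2) * chainIdem G p j) =
        powClass ⊥ (unitRep (w i).2⁻¹) * chainIdem G p j := by
    rcases j with _ | j
    · rw [chainIdem, mul_zero, mul_zero, star_zero]
    · rw [powClass_bot_mul_chainIdem, powClass_bot_mul_chainIdem]
      refine star_powClass ?_
      rw [index_powerSubgroup_pow hG (by omega)]
      exact key.of_dvd (pow_dvd_pow p (by omega))
  rw [star_zsmul, blockIdem, mul_sub, star_sub, hstar _ le_rfl, hstar _ (Nat.le_succ _),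
    ← mul_sub, Pi.inv_apply, Prod.fst_inv, Prod.snd_inv, Int.units_inv_eq_self]

theorem star_blockUnit_mul_self (hp : p.Prime) (hG : Nat.card G = p ^ n) (w : BlockGroup p n) :
    star (blockUnit G w) * blockUnit G w = 1 := by
  rw [star_blockUnit hp hG, ← blockUnit_mul hp hG, inv_mul_cancel, blockUnit_one hp hG]

theorem blockUnit_mul_star_self (hp : p.Prime) (hG : Nat.card G = p ^ n) (w : BlockGroup p n) :
    blockUnit G w * star (blockUnit G w) = 1 := by
  rw [star_blockUnit hp hG, ← blockUnit_mul hp hG, mul_inv_cancel, blockUnit_one hp hG]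

/-- The coordinates of an element of `B(G, G) · (G / N)` vanish at the subgroups whose right
kernel does not contain `N`. -/
theorem coord_mul_chainIdem_eq_zero (hp : p.Prime) (hG : Nat.card G = p ^ n) {i : ℕ} (hi : i ≤ n)
    (x : BurnsideGroup G G) {T : Subgroup (G × G)} (hT : T.sndKer = powerSubgroup G (p ^ i)) :
    (basis G).coord T (x * chainIdem G p i) = 0 := by
  rcases i with _ | i
  · rw [chainIdem, mul_zero, map_zero]
  · by_contra h
    rw [chainIdem_succ] at h
    have h1 := (section_le_of_coord_mul_basis_ne_zero h).1
    rw [sndKer_diag le_top, hT] at h1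
    have h2 := le_antisymm h1 (powerSubgroup_le_of_dvd (pow_dvd_pow p (Nat.le_succ i)))
    have := powerSubgroup_pow_injective hp hG (by omega) hi h2
    omega

/-- The subtracted chain term only involves strictly larger right kernels, so the coordinate is that
of a single graph. -/
theorem coord_powClass_mul_blockIdem (hp : p.Prime) (hG : Nat.card G = p ^ n) {i : ℕ} (hi : i ≤ n)
    (k l : ℕ) :
    (basis G).coord (powGraph (powerSubgroup G (p ^ i)) l) (powClass ⊥ k * blockIdem G p i) =
      if k ≡ l [MOD p ^ i] then 1 else 0 := by
  rw [blockIdem, mul_sub, map_sub, coord_mul_chainIdem_eq_zero hp hG hi _ sndKer_powGraph, sub_zero,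
    powClass_bot_mul_chainIdem, powClass, coord_basis]
  refine if_congr ⟨fun h => ?_, fun h => ?_⟩ rfl rfl
  · rw [← index_powerSubgroup_pow hG hi]
    exact powGraph_inj h
  · exact powGraph_congr (by rwa [index_powerSubgroup_pow hG hi])

theorem blockUnit_injective (hp : p.Prime) (hG : Nat.card G = p ^ n) :
    Function.Injective (blockUnit G : BlockGroup p n → BurnsideGroup G G) := by
  have := NeZero.mk hp.ne_zero
  intro w v h
  funext i
  have hi := Nat.le_of_lt_succ i.2
  have h1 := congrArg (fun x => (basis G).coord
    (powGraph (powerSubgroup G (p ^ (i : ℕ))) (unitRep (w i).2)) (x * blockIdem G p i)) h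
  simp only [blockUnit_mul_blockIdem, map_smul, coord_powClass_mul_blockIdem hp hG hi,
    smul_eq_mul] at h1
  rw [if_pos (Nat.ModEq.refl _), mul_one] at h1
  split_ifs at h1 with h2
  · rw [mul_one] at h1
    exact Prod.ext (Units.ext h1) (unitRep_injective_modEq h2).symm
  · rw [mul_zero] at h1
    exact ((w i).1.ne_zero h1).elim

/-- For `P = ⊤` the weighted sum of squares equals `1`. Exactly one coordinate is nonzero; it is a
sign, its weight is `1`, so its first projection is all of `G` and it sits at a graph. -/
theorem exists_coord_eq_unit (hp : p.Prime) (hG : Nat.card G = p ^ n) {u : BurnsideGroup G G}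
    (hu : star u * u = 1) {N : Subgroup G} (hN : N ≠ ⊤) :
    ∃ (ε : ℤˣ) (k : ℕ), (Nat.card G).Coprime k ∧ ∀ T : Subgroup (G × G), T.sndProj = ⊤ →
      T.sndKer = N → (basis G).coord T (u * basis G (diag ⊤ N)) =
        if T = powGraph N k then (ε : ℤ) else 0 := by
  have := Fintype.ofFinite (Subgroup (G × G))
  have hsum := sum_sq_coord_mul_index (IsCyclic.subgroup_total hp hG) hu (lt_top_iff_ne_top.2 hN)
  rw [index_top, Nat.cast_one] at hsum
  have hnn : ∀ T ∈ (Finset.univ.filter fun T : Subgroup (G × G) => T.sndProj = ⊤ ∧ T.sndKer = N),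
      0 ≤ (basis G).coord T (u * basis G (diag ⊤ N)) ^ 2 * (T.fstProj.index : ℤ) :=
    fun T _ => by positivity
  obtain ⟨S, hS, hS0⟩ := Finset.exists_ne_zero_of_sum_ne_zero (hsum.trans_ne one_ne_zero)
  have hge : 1 ≤ (basis G).coord S (u * basis G (diag ⊤ N)) ^ 2 * (S.fstProj.index : ℤ) :=
    Order.one_le_iff_pos.2 ((hnn S hS).lt_of_ne' hS0)
  rw [← Finset.add_sum_erase _ _ hS] at hsum
  have hnn' := fun T (hT : T ∈ Finset.erase _ S) => hnn T (Finset.mem_of_mem_erase hT)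
  have hz := le_antisymm (by linarith) (Finset.sum_nonneg hnn')
  rw [hz, add_zero] at hsum
  rw [Finset.sum_eq_zero_iff_of_nonneg hnn'] at hz
  have hS' := (Finset.mem_filter.1 hS).2
  have hidx : S.fstProj.index = 1 := by
    have := Int.isUnit_iff_natAbs_eq.1 (IsUnit.of_mul_eq_one _ ((mul_comm _ _).trans hsum))
    rwa [Int.natAbs_natCast] at this
  rw [hidx, Nat.cast_one, mul_one] at hsum
  obtain ⟨k, hk⟩ := exists_eq_powGraph (index_eq_one.1 hidx)
  rw [hS'.2] at hk
  obtain ⟨ε, hε⟩ : IsUnit ((basis G).coord S (u * basis G (diag ⊤ N))) :=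
    IsUnit.of_mul_eq_one _ ((sq _).symm.trans hsum)
  refine ⟨ε, k, coprime_of_sndProj_powGraph hp hG hN (hk ▸ hS'.1), fun T hT1 hT2 => ?_⟩
  split_ifs with h
  · rw [h, ← hk, hε]
  · have h0 := hz T (Finset.mem_erase.2 ⟨fun h' => h (h'.trans hk), Finset.mem_filter.2
      ⟨Finset.mem_univ _, hT1, hT2⟩⟩)
    have hi : (T.fstProj.index : ℤ) ≠ 0 := by
      exact_mod_cast Subgroup.index_ne_zero_of_finite
    exact pow_eq_zero_iff two_ne_zero |>.1 ((mul_eq_zero.1 h0).resolve_right hi)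

/-- On each block, the sign and the inverse of the automorphism supplied by `exists_coord_eq_unit`
cancel the leading coordinate of `u`. -/
theorem exists_blockUnit_normalising (hp : p.Prime) (hG : Nat.card G = p ^ n)
    {u : BurnsideGroup G G} (hu : star u * u = 1) :
    ∃ w : BlockGroup p n, ∀ N : Subgroup G, N ≠ ⊤ →
      (basis G).coord (diag ⊤ N) (blockUnit G w * u * basis G (diag ⊤ N)) = 1 := by
  have := NeZero.mk hp.ne_zero
  have := Fintype.ofFinite (Subgroup (G × G))
  have hex (i : Fin (n + 1)) : ∃ (ε : ℤˣ) (l : (ZMod (p ^ (i : ℕ)))ˣ),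
      powerSubgroup G (p ^ (i : ℕ)) ≠ ⊤ → ∀ T : Subgroup (G × G), T.sndProj = ⊤ →
      T.sndKer = powerSubgroup G (p ^ (i : ℕ)) →
      (basis G).coord T (u * basis G (diag ⊤ (powerSubgroup G (p ^ (i : ℕ))))) =
        if T = powGraph (powerSubgroup G (p ^ (i : ℕ))) (unitRep l) then (ε : ℤ) else 0 := by
    by_cases h : powerSubgroup G (p ^ (i : ℕ)) = ⊤
    -- The block with quotient `G / G` imposes no condition, and its sign is left equal to `1`.
    · exact ⟨1, 1, fun h' => (h' h).elim⟩
    · obtain ⟨ε, k, hk, hT⟩ := exists_coord_eq_unit hp hG hu h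
      have hi := Nat.le_of_lt_succ i.2
      obtain ⟨l, hl⟩ := exists_unitRep_modEq (p := p) (i := i)
        (hk.coprime_dvd_left (hG ▸ pow_dvd_pow p hi))
      have hkl : powGraph (powerSubgroup G (p ^ (i : ℕ))) k = powGraph _ (unitRep l) :=
        powGraph_congr (by rwa [index_powerSubgroup_pow hG hi])
      exact ⟨ε, l, fun _ => hkl ▸ hT⟩
  choose ε l hεl using hex
  refine ⟨fun i => (ε i, (l i)⁻¹), fun N hN => ?_⟩
  obtain ⟨i, hi, rfl⟩ := exists_eq_powerSubgroup_pow hp hG N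
  have hT := hεl ⟨i, Nat.lt_succ_of_le hi⟩ hN
  simp only at hT
  set w : BlockGroup p n := fun i => (ε i, (l i)⁻¹) with hw
  set j : Fin (n + 1) := ⟨i, Nat.lt_succ_of_le hi⟩ with hj
  set N := powerSubgroup G (p ^ i) with hNdef
  -- If both factors are nonzero, the inclusions of sections in the two directions force `T` to have
  -- right section `(⊤, N)`, and then `T` must be the distinguished graph.
  have key (T : Subgroup (G × G)) : (basis G).coord T (u * basis G (diag ⊤ N)) *
      (basis G).coord (diag ⊤ N) (blockUnit G w * basis G T) =
      if T = powGraph N (unitRep (l j)) then (ε j : ℤ) * (basis G).coord (diag ⊤ N)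
        (blockUnit G w * basis G (powGraph N (unitRep (l j)))) else 0 := by
    by_cases h1 : (basis G).coord T (u * basis G (diag ⊤ N)) = 0
    · rw [h1, zero_mul]
      split_ifs with h
      · have h2 := hT T (h ▸ sndProj_powGraph (coprime_card_unitRep hp hG _))
          (h ▸ sndKer_powGraph)
        rw [h1, if_pos h] at h2
        exact ((ε j).ne_zero h2.symm).elim
      · rfl
    by_cases h2 : (basis G).coord (diag ⊤ N) (blockUnit G w * basis G T) = 0
    · rw [h2, mul_zero]
      split_ifs with h
      · rw [← h, h2, mul_zero]
      · rfl
    have h3 := section_le_of_coord_mul_basis_ne_zero h1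
    have h4 := section_le_of_coord_mul_basis_ne_zero h2
    rw [sndKer_diag le_top] at h3 h4
    rw [sndProj_diag] at h4
    rw [hT T (top_le_iff.1 h4.2) (le_antisymm h4.1 h3.1)]
    split_ifs with h
    · rw [← h]
    · rw [zero_mul]
  rw [mul_assoc, eq_sum_coord (u * basis G (diag ⊤ N)), Finset.mul_sum, map_sum]
  simp only [mul_smul_comm, map_smul, smul_eq_mul]
  rw [Finset.sum_congr rfl fun T _ => key T, Finset.sum_ite_eq' Finset.univ,
    if_pos (Finset.mem_univ _)]
  -- The graph splits into its part in block `i` and a part in the lower chain, whose right kernels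
  -- are too large to affect the coordinate at `diag ⊤ N`.
  have h1 : basis G (powGraph N (unitRep (l j))) =
      blockIdem G p j * powClass ⊥ (unitRep (l j)) +
        powClass ⊥ (unitRep (l j)) * chainIdem G p i := by
    rw [blockIdem_mul_powClass_bot _ _ (coprime_card_unitRep hp hG _), ← mul_add, blockIdem,
      sub_add_cancel, powClass_bot_mul_chainIdem, powClass]
  have h2 : powClass ⊥ (unitRep (l j)⁻¹) * blockIdem G p i * powClass ⊥ (unitRep (l j)) =
      powClass ⊥ 1 * blockIdem G p i := by
    have hl := coprime_card_unitRep hp hG (l j)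
    rw [mul_assoc, blockIdem_mul_powClass_bot _ _ hl, ← mul_assoc, powClass_mul _ _ _ hl, sup_idem]
    refine powClass_bot_mul_blockIdem_congr hG hi ((unitRep_mul_modEq _ _).trans ?_)
    rw [inv_mul_cancel]
    exact unitRep_one_modEq
  rw [h1, mul_add, ← mul_assoc, blockUnit_mul_blockIdem, smul_mul_assoc, ← mul_assoc, map_add,
    coord_mul_chainIdem_eq_zero hp hG hi _ (sndKer_diag le_top), add_zero, h2, map_smul,
    ← powGraph_one, coord_powClass_mul_blockIdem hp hG hi, if_pos (Nat.ModEq.refl _), smul_eq_mul,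
    mul_one, ← Units.val_mul, Int.units_mul_self, Units.val_one]

end BurnsideGroup

/-! ### The ideal spanned by products of subgroups, as integer matrices. -/

namespace BurnsideGroup

open Subgroup

open scoped Classical

variable {G : Type u} [CommGroup G] [Finite G]

/-- The classes of the bisets `(G × G) / (N × G)`, for `N` in the chain of subgroups of `p ^ i`-th
powers, preceded by zero. -/
noncomputable def chainVec (G : Type u) [CommGroup G] [Finite G] (p : ℕ) :
    ℕ → BurnsideGroup G G
  | 0 => 0
  | i + 1 => basis G ((powerSubgroup G (p ^ i)).prod ⊤)

/-- The orthogonalisation of the classes of the bisets `(G × G) / (N × G)`. -/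
noncomputable def orthVec (G : Type u) [CommGroup G] [Finite G] (p i : ℕ) : BurnsideGroup G G :=
  chainVec G p (i + 1) - chainVec G p i

/-- The norms of the vectors `chainVec`. -/
def chainNorm (p : ℕ) : ℕ → ℤ
  | 0 => 0
  | i + 1 => p ^ i

/-- The norms of the vectors `orthVec`. -/
def orthNorm (p i : ℕ) : ℤ := chainNorm p (i + 1) - chainNorm p i

theorem sum_orthVec (p i : ℕ) :
    ∑ j ∈ Finset.range (i + 1), orthVec G p j = basis G ((powerSubgroup G (p ^ i)).prod ⊤) := by
  simp only [orthVec]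
  rw [Finset.sum_range_sub (chainVec G p), chainVec, chainVec, sub_zero]

/-- A product `A × B` is a rank-one matrix: the vector of `A` times the dual of the vector of `B`.
-/
theorem basis_prod (A B : Subgroup G) :
    basis G (A.prod B) = basis G (A.prod ⊤) * star (basis G (B.prod ⊤)) := by
  rw [star_basis, relInv_prod, basis_mul, sndProj_prod, top_sup_eq, index_top, Nat.cast_one,
    one_smul, prod_relComp_prod]

theorem basis_prod_mul_basis_top (A : Subgroup G) :
    basis G (A.prod ⊤) * basis G (diag ⊤ ⊤) = basis G (A.prod ⊤) := by
  rw [← prod_top_top, basis_mul, sndProj_prod, top_sup_eq, index_top, Nat.cast_one,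
    one_smul, prod_relComp_prod]

theorem orthVec_mul_basis_top (p i : ℕ) :
    orthVec G p i * basis G (diag ⊤ ⊤) = orthVec G p i := by
  have h (j : ℕ) : chainVec G p j * basis G (diag ⊤ ⊤) = chainVec G p j := by
    rcases j with _ | j
    · rw [chainVec, zero_mul]
    · rw [chainVec, basis_prod_mul_basis_top]
  rw [orthVec, sub_mul, h, h]

theorem orthNorm_zero (p : ℕ) : orthNorm p 0 = 1 := by
  simp [orthNorm, chainNorm]

theorem orthNorm_succ (p i : ℕ) : orthNorm p (i + 1) = p ^ i * (p - 1) := by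
  simp only [orthNorm, chainNorm]
  ring

theorem smul_basis_injective (T : Subgroup (G × G)) {a b : ℤ}
    (h : a • basis G T = b • basis G T) : a = b := by
  have := congrArg ((basis G).coord T) h
  rwa [map_smul, map_smul, coord_basis, if_pos rfl, smul_eq_mul, smul_eq_mul, mul_one,
    mul_one] at this

variable {p n : ℕ}

/-- The elements of the ideal of products that have given coordinates in the matrix units. -/
noncomputable def ofMatrix (G : Type u) [CommGroup G] [Finite G] (p : ℕ) {n : ℕ} :
    Matrix (Fin (n + 1)) (Fin (n + 1)) ℤ →+ BurnsideGroup G G where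
  toFun Y := ∑ i, ∑ j, Y i j • (orthVec G p i * star (orthVec G p j))
  map_zero' := by simp
  map_add' Y Z := by simp [add_smul, Finset.sum_add_distrib]

theorem ofMatrix_apply (Y : Matrix (Fin (n + 1)) (Fin (n + 1)) ℤ) :
    ofMatrix G p Y = ∑ i, ∑ j, Y i j • (orthVec G p i * star (orthVec G p j)) := rfl

theorem ofMatrix_single (i j : Fin (n + 1)) :
    ofMatrix G p (Matrix.single i j 1) = orthVec G p i * star (orthVec G p j) := by
  rw [ofMatrix_apply, Finset.sum_eq_single i, Finset.sum_eq_single j]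
  · simp
  · intro k _ hk
    rw [Matrix.single_apply_of_col_ne _ _ hk.symm, zero_smul]
  · simp
  · intro k _ hk
    exact Finset.sum_eq_zero fun l _ => by
      rw [Matrix.single_apply_of_row_ne hk.symm, zero_smul]
  · simp

variable [IsCyclic G]

/-- The products are multiples of the class of `G × G`, which plays the role of the scalar `1`; this
defines the Gram matrix. -/
theorem star_chainVec_mul_chainVec (hG : Nat.card G = p ^ n) {i j : ℕ} (hi : i ≤ n + 1)
    (hj : j ≤ n + 1) : star (chainVec G p i) * chainVec G p j =
      chainNorm p (min i j) • basis G (diag ⊤ ⊤) := by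
  rcases i with _ | i
  · rw [Nat.zero_min, chainVec, star_zero, zero_mul, chainNorm, zero_smul]
  rcases j with _ | j
  · rw [Nat.min_zero, chainVec, mul_zero, chainNorm, zero_smul]
  rw [Nat.succ_min_succ, chainVec, chainVec, chainNorm, star_basis, relInv_prod, basis_mul,
    sndProj_prod, fstProj_prod, prod_relComp_prod, powerSubgroup_pow_sup,
    index_powerSubgroup_pow hG (by omega), Nat.cast_pow, prod_top_top]

theorem star_orthVec_mul_self (hG : Nat.card G = p ^ n) {i : ℕ} (hi : i ≤ n) :
    star (orthVec G p i) * orthVec G p i = orthNorm p i • basis G (diag ⊤ ⊤) := by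
  rw [orthVec, star_sub, sub_mul, mul_sub, mul_sub, star_chainVec_mul_chainVec hG (by omega)
    (by omega), star_chainVec_mul_chainVec hG (by omega) (by omega), star_chainVec_mul_chainVec hG
    (by omega) (by omega), star_chainVec_mul_chainVec hG (by omega) (by omega), min_self, min_self,
    min_eq_right (by omega), min_eq_left (by omega), orthNorm, sub_smul, sub_self, sub_zero]

/-- The Gram matrix of `chainVec` depends only on the minimum of the indices, so consecutive
differences are orthogonal. -/
theorem star_orthVec_mul_of_ne (hG : Nat.card G = p ^ n) {i j : ℕ} (hi : i ≤ n) (hj : j ≤ n)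
    (h : i ≠ j) : star (orthVec G p i) * orthVec G p j = 0 := by
  rw [orthVec, orthVec, star_sub, sub_mul, mul_sub, mul_sub, star_chainVec_mul_chainVec hG (by omega)
    (by omega), star_chainVec_mul_chainVec hG (by omega) (by omega), star_chainVec_mul_chainVec hG
    (by omega) (by omega), star_chainVec_mul_chainVec hG (by omega) (by omega)]
  rcases lt_or_gt_of_ne h with h | h
  · rw [min_eq_left (by omega), min_eq_left (by omega), min_eq_left (by omega),
      min_eq_left (by omega)]
    abel
  · rw [min_eq_right (by omega), min_eq_right (by omega), min_eq_right (by omega),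
      min_eq_right (by omega)]
    abel

theorem star_orthVec_mul (hG : Nat.card G = p ^ n) (i j : Fin (n + 1)) :
    star (orthVec G p i) * orthVec G p j =
      if i = j then orthNorm p i • basis G (diag ⊤ ⊤) else 0 := by
  split_ifs with h
  · rw [← h, star_orthVec_mul_self hG (Nat.le_of_lt_succ i.2)]
  · exact star_orthVec_mul_of_ne hG (Nat.le_of_lt_succ i.2) (Nat.le_of_lt_succ j.2)
      fun h' => h (Fin.ext h')

theorem exists_eq_ofMatrix (hp : p.Prime) (hG : Nat.card G = p ^ n) {x : BurnsideGroup G G}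
    (hx : ∀ T : Subgroup (G × G), T.sndKer ≠ T.sndProj → (basis G).coord T x = 0) :
    ∃ Y : Matrix (Fin (n + 1)) (Fin (n + 1)) ℤ, ofMatrix G p Y = x := by
  have := Fintype.ofFinite (Subgroup (G × G))
  rw [← AddMonoidHom.mem_range, eq_sum_coord x]
  refine sum_mem fun T _ => ?_
  by_cases hT : T.sndKer = T.sndProj
  · refine zsmul_mem ?_ _
    obtain ⟨a, ha, haT⟩ := exists_eq_powerSubgroup_pow hp hG T.fstProj
    obtain ⟨b, hb, hbT⟩ := exists_eq_powerSubgroup_pow hp hG T.sndProj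
    rw [eq_prod_of_sndKer_eq hT, haT, hbT, basis_prod, ← sum_orthVec, ← sum_orthVec, star_sum,
      Finset.sum_mul]
    refine sum_mem fun i hi => ?_
    rw [Finset.mul_sum]
    refine sum_mem fun j hj => ?_
    rw [Finset.mem_range] at hi hj
    exact ⟨Matrix.single ⟨i, by omega⟩ ⟨j, by omega⟩ 1, ofMatrix_single _ _⟩
  · rw [hx T hT, zero_smul]
    exact zero_mem _

theorem ofMatrix_mul_orthVec (hG : Nat.card G = p ^ n)
    (Y : Matrix (Fin (n + 1)) (Fin (n + 1)) ℤ) (j : Fin (n + 1)) :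
    ofMatrix G p Y * orthVec G p j = ∑ i, (Y i j * orthNorm p j) • orthVec G p i := by
  rw [ofMatrix_apply, Finset.sum_mul]
  refine Finset.sum_congr rfl fun i _ => ?_
  rw [Finset.sum_mul, Finset.sum_eq_single j]
  · rw [smul_mul_assoc, mul_assoc, star_orthVec_mul hG, if_pos rfl, mul_smul_comm,
      orthVec_mul_basis_top, smul_smul]
  · intro k _ hk
    rw [smul_mul_assoc, mul_assoc, star_orthVec_mul hG, if_neg hk, mul_zero, smul_zero]
  · exact fun h => (h (Finset.mem_univ j)).elim

/-- The columns of an orthogonal element congruent to the identity modulo the ideal of products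
have the same norms as those of the identity. -/
theorem sum_orthNorm_mul_sq (hG : Nat.card G = p ^ n)
    {Y : Matrix (Fin (n + 1)) (Fin (n + 1)) ℤ}
    (hu : star (1 + ofMatrix G p Y) * (1 + ofMatrix G p Y) = 1) (j : Fin (n + 1)) :
    ∑ i : Fin (n + 1), orthNorm p i * ((if i = j then 1 else 0) + Y i j * orthNorm p j) ^ 2 =
      orthNorm p j := by
  have hcol : (1 + ofMatrix G p Y) * orthVec G p j =
      ∑ i : Fin (n + 1), ((if i = j then 1 else 0) + Y i j * orthNorm p j) • orthVec G p i := by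
    simp only [add_smul, Finset.sum_add_distrib]
    rw [add_mul, one_mul, ofMatrix_mul_orthVec hG]
    simp
  -- Both sides are the scalar product of the image of `orthVec G p j` with itself, and an
  -- orthogonal element preserves it.
  refine smul_basis_injective (G := G) (diag ⊤ ⊤) ?_
  rw [← star_orthVec_mul_self hG (Nat.le_of_lt_succ j.2)]
  calc _ = star ((1 + ofMatrix G p Y) * orthVec G p j) *
        ((1 + ofMatrix G p Y) * orthVec G p j) := by
        rw [hcol, star_sum, Finset.sum_mul, Finset.sum_smul]
        refine Finset.sum_congr rfl fun i _ => ?_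
        rw [Finset.mul_sum, Finset.sum_eq_single i]
        · rw [star_zsmul, smul_mul_smul_comm, star_orthVec_mul hG, if_pos rfl, smul_smul]
          congr 1
          ring
        · intro k _ hk
          rw [star_zsmul, smul_mul_smul_comm, star_orthVec_mul hG, if_neg hk.symm, smul_zero]
        · exact fun h => (h (Finset.mem_univ i)).elim
    _ = _ := by rw [star_mul, mul_assoc, ← mul_assoc (star (1 + _)), hu, one_mul]

/-- A normalised orthogonal element is congruent to the identity modulo the ideal of products. -/
theorem exists_eq_one_add_ofMatrix (hp : p.Prime) (hG : Nat.card G = p ^ n)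
    (hidx : ∀ P : Subgroup G, P ≠ ⊥ → P ≠ ⊤ → 2 < P.index) {u : BurnsideGroup G G}
    (hu : star u * u = 1)
    (hnorm : ∀ N : Subgroup G, N ≠ ⊤ →
      (basis G).coord (diag ⊤ N) (u * basis G (diag ⊤ N)) = 1) :
    ∃ Y : Matrix (Fin (n + 1)) (Fin (n + 1)) ℤ, u = 1 + ofMatrix G p Y := by
  obtain ⟨Y, hY⟩ := exists_eq_ofMatrix (x := u - 1) hp hG fun T hT => by
    rw [map_sub, coord_eq_of_star_mul_self (IsCyclic.subgroup_total hp hG) hidx hu hnorm T hT,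
      one_eq_basis_diag, coord_basis, sub_eq_zero]
    exact if_congr eq_comm rfl rfl
  exact ⟨Y, by rw [hY, add_sub_cancel]⟩

theorem orthNorm_pos (hp : p.Prime) (i : ℕ) : 0 < orthNorm p i := by
  have := hp.two_le
  rcases i with _ | i
  · rw [orthNorm_zero]
    exact one_pos
  · rw [orthNorm_succ]
    have : (2 : ℤ) ≤ p := by exact_mod_cast hp.two_le
    have : (0 : ℤ) < p := by omega
    exact mul_pos (pow_pos this i) (by omega)

/-- As `z j` is a nonzero integer, its term already exhausts the sum. -/
theorem eq_of_sum_mul_sq_eq {ι : Type*} [Fintype ι] {d z : ι → ℤ} (hd : ∀ i, 0 < d i) {j : ι}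
    (hz : z j ≠ 0) (h : ∑ i, d i * z i ^ 2 = d j) : z j ^ 2 = 1 ∧ ∀ i ≠ j, z i = 0 := by
  rw [← Finset.add_sum_erase _ _ (Finset.mem_univ j)] at h
  have hnn : ∀ i ∈ Finset.univ.erase j, 0 ≤ d i * z i ^ 2 :=
    fun i _ => mul_nonneg (hd i).le (sq_nonneg _)
  have h1 : 1 ≤ z j ^ 2 := Order.one_le_iff_pos.2 (sq_pos_iff.2 hz)
  have h2 := Finset.sum_nonneg hnn
  have h3 : d j ≤ d j * z j ^ 2 := le_mul_of_one_le_right (hd j).le h1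
  have h4 : ∑ i ∈ Finset.univ.erase j, d i * z i ^ 2 = 0 := by linarith
  rw [h4, add_zero] at h
  rw [Finset.sum_eq_zero_iff_of_nonneg hnn] at h4
  refine ⟨mul_left_cancel₀ (hd j).ne' (h.trans (mul_one _).symm), fun i hi => ?_⟩
  have h5 := h4 i (Finset.mem_erase.2 ⟨hi, Finset.mem_univ i⟩)
  exact pow_eq_zero_iff two_ne_zero |>.1 ((mul_eq_zero.1 h5).resolve_left (hd i).ne')

/-- For odd `p`, the coordinate matrix of a normalised orthogonal element is diagonal, with entries
`0` or `-2 / d`, where `d` is the norm of the basis vector. -/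
theorem coord_ofMatrix_of_odd (hp : p.Prime) (hp2 : 2 < p) (hG : Nat.card G = p ^ n)
    {Y : Matrix (Fin (n + 1)) (Fin (n + 1)) ℤ}
    (hu : star (1 + ofMatrix G p Y) * (1 + ofMatrix G p Y) = 1) (i j : Fin (n + 1)) :
    Y i j = 0 ∨ i = j ∧ Y i j * orthNorm p j = -2 := by
  have hp3 : (3 : ℤ) ≤ p := by exact_mod_cast hp2
  have hsum := sum_orthNorm_mul_sq hG hu j
  have hd (i : Fin (n + 1)) : 0 < orthNorm p i := orthNorm_pos hp i
  have hge (i : ℕ) : 2 ≤ orthNorm p (i + 1) := by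
    rw [orthNorm_succ]
    have : (1 : ℤ) ≤ p ^ i := one_le_pow₀ (by omega)
    nlinarith
  -- For `j > 0` the entry is `1` modulo a norm at least `2`. For `j = 0` the total is `1`, which no
  -- other vector can supply, since all the others have norm at least `2`.
  have hzj : (if j = j then 1 else 0) + Y j j * orthNorm p j ≠ 0 := by
    rw [if_pos rfl]
    intro h0
    rcases j with ⟨j, hj⟩
    rcases j with _ | j
    · rw [orthNorm_zero] at hsum
      obtain ⟨k, -, hk⟩ := Finset.exists_ne_zero_of_sum_ne_zero (hsum.trans_ne one_ne_zero)
      have hle := Finset.single_le_sum (fun i _ => mul_nonneg (hd i).le (sq_nonneg _))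
        (Finset.mem_univ k) |>.trans_eq hsum
      rcases k with ⟨k, hk'⟩
      rcases k with _ | k
      · rw [orthNorm_zero] at h0
        rw [if_pos rfl, h0] at hk
        simp at hk
      · have h6 := Order.one_le_iff_pos.2
          ((sq_nonneg _).lt_of_ne' (right_ne_zero_of_mul hk))
        have h7 := hge k
        nlinarith
    · have h4 : orthNorm p (j + 1) ∣ 1 := ⟨-Y ⟨j + 1, hj⟩ ⟨j + 1, hj⟩, by linear_combination h0⟩
      have h5 := Int.le_of_dvd one_pos h4
      have := hge j
      omega
  obtain ⟨h1, h2⟩ := eq_of_sum_mul_sq_eq (d := fun i : Fin (n + 1) => orthNorm p i)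
    (z := fun i => (if i = j then 1 else 0) + Y i j * orthNorm p j) hd hzj hsum
  by_cases hij : i = j
  · subst hij
    simp only [if_true] at h1
    rcases sq_eq_one_iff.1 h1 with h | h
    · exact Or.inl ((mul_eq_zero.1 (add_eq_left.1 h)).resolve_right (hd i).ne')
    · exact Or.inr ⟨rfl, by linear_combination h⟩
  · have h3 := h2 i hij
    simp only [if_neg hij, zero_add] at h3
    exact Or.inl ((mul_eq_zero.1 h3).resolve_right (hd j).ne')

end BurnsideGroup

/-! ### Orthogonal units for odd primes. -/

namespace BurnsideGroup

open Subgroup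

open scoped Classical

variable {G : Type u} [CommGroup G] [Finite G] {p n : ℕ}

theorem coord_chainVec_mul_star_chainVec (i j : ℕ) {T : Subgroup (G × G)}
    (hT : T.sndKer ≠ T.sndProj) :
    (basis G).coord T (chainVec G p i * star (chainVec G p j)) = 0 := by
  rcases i with _ | i
  · rw [chainVec, zero_mul, map_zero]
  rcases j with _ | j
  · rw [chainVec.eq_1, star_zero, mul_zero, map_zero]
  rw [chainVec, chainVec, ← basis_prod, coord_basis, if_neg]
  rintro rfl
  apply hT
  ext x
  rw [sndProj_prod, mem_sndKer, mem_prod]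
  exact and_iff_right (one_mem _)

theorem coord_orthVec_mul_star_orthVec (i j : ℕ) {T : Subgroup (G × G)}
    (hT : T.sndKer ≠ T.sndProj) :
    (basis G).coord T (orthVec G p i * star (orthVec G p j)) = 0 := by
  simp only [orthVec, star_sub, sub_mul, mul_sub, map_sub, coord_chainVec_mul_star_chainVec _ _ hT,
    sub_zero]

theorem coord_ofMatrix_eq_zero (Y : Matrix (Fin (n + 1)) (Fin (n + 1)) ℤ) {T : Subgroup (G × G)}
    (hT : T.sndKer ≠ T.sndProj) : (basis G).coord T (ofMatrix G p Y) = 0 := by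
  rw [ofMatrix_apply, map_sum]
  refine Finset.sum_eq_zero fun i _ => ?_
  rw [map_sum]
  refine Finset.sum_eq_zero fun j _ => ?_
  rw [map_smul, coord_orthVec_mul_star_orthVec _ _ hT, smul_zero]

theorem orthVec_zero_mul_star : orthVec G p 0 * star (orthVec G p 0) = blockIdem G p 0 := by
  rw [blockIdem, orthVec, chainIdem_succ, chainVec, chainVec, chainIdem, sub_zero, sub_zero,
    pow_zero, powerSubgroup_one, ← basis_prod, prod_top_top]

theorem chainIdem_mul_chainVec (i j : ℕ) :
    chainIdem G p i * chainVec G p j = chainVec G p (min i j) := by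
  rcases i with _ | i
  · rw [Nat.zero_min, chainIdem, zero_mul, chainVec]
  rcases j with _ | j
  · rw [Nat.min_zero, chainVec, mul_zero]
  rw [Nat.succ_min_succ, chainIdem, chainVec, chainVec, powClass, basis_mul,
    sndProj_powGraph (Nat.coprime_one_right _), top_sup_eq, index_top, Nat.cast_one, one_smul,
    ← powerSubgroup_pow_sup]
  congr 1
  ext ⟨a, b⟩
  rw [mem_relComp, mem_prod, mem_sup]
  constructor
  · rintro ⟨c, h1, h2, -⟩
    rw [mem_powGraph, pow_one] at h1
    exact ⟨⟨(c / a)⁻¹, inv_mem h1, c, h2, by simp⟩, trivial⟩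
  · rintro ⟨⟨x, hx, y, hy, h⟩, -⟩
    refine ⟨y, ?_, hy, trivial⟩
    simp only at h
    rw [mem_powGraph, pow_one, ← inv_mem_iff, inv_div, ← h]
    simpa using hx

/-- A power map with exponent prime to the group order maps every subgroup onto itself, so
automorphisms are invisible on these vectors. -/
theorem powClass_bot_mul_chainVec {k : ℕ} (hk : (Nat.card G).Coprime k) (j : ℕ) :
    powClass ⊥ k * chainVec G p j = chainVec G p j := by
  rcases j with _ | j
  · rw [chainVec, mul_zero]
  rw [chainVec, powClass, basis_mul, sndProj_powGraph hk, top_sup_eq, index_top, Nat.cast_one,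
    one_smul]
  congr 1
  ext ⟨a, b⟩
  rw [mem_relComp, mem_prod]
  constructor
  · rintro ⟨c, h1, h2, -⟩
    rw [mem_powGraph, mem_bot, div_eq_one] at h1
    obtain ⟨d, hd, hda⟩ := exists_pow_eq_of_coprime hk h2
    have : d = a := (powCoprime hk).injective (hda.trans h1)
    exact ⟨this ▸ hd, trivial⟩
  · rintro ⟨h, -⟩
    exact ⟨a ^ k, by simp [mem_powGraph], pow_mem h k, trivial⟩

theorem powClass_bot_mul_orthVec {k : ℕ} (hk : (Nat.card G).Coprime k) (j : ℕ) :
    powClass ⊥ k * orthVec G p j = orthVec G p j := by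
  rw [orthVec, mul_sub, powClass_bot_mul_chainVec hk, powClass_bot_mul_chainVec hk]

/-- Each orthogonal vector lies in one block; hence a `blockUnit` acts on it by a sign. -/
theorem blockIdem_mul_orthVec (i j : ℕ) :
    blockIdem G p i * orthVec G p j = if i = j then orthVec G p j else 0 := by
  rw [blockIdem, orthVec, sub_mul, mul_sub, mul_sub, chainIdem_mul_chainVec,
    chainIdem_mul_chainVec, chainIdem_mul_chainVec, chainIdem_mul_chainVec]
  split_ifs with h
  · subst h
    simp
  · rcases lt_or_gt_of_ne h with h | h
    · rw [min_eq_left (by omega), min_eq_left (by omega), min_eq_left (by omega),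
        min_eq_left (by omega)]
      abel
    · rw [min_eq_right (by omega), min_eq_right (by omega), min_eq_right (by omega),
        min_eq_right (by omega)]
      abel

/-- The reflection of `B(G, G)`, available if the prime is `3`. -/
noncomputable def reflection (G : Type u) [CommGroup G] [Finite G] : BurnsideGroup G G :=
  1 - orthVec G 3 1 * star (orthVec G 3 1)

theorem star_reflection : star (reflection G) = reflection G := by
  rw [reflection, star_sub, star_one, star_mul, star_star]

theorem orthNorm_three_one : orthNorm 3 1 = 2 := by
  rw [orthNorm_succ]
  norm_num

/-- The orthogonal unit given by an element `x` with `x x° = x° x = 1`. -/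
noncomputable def mkOrthogonal {G : Type u} [Group G] [Finite G] (x : BurnsideGroup G G)
    (h : x * star x = 1) (h' : star x * x = 1) : orthogonalUnits G :=
  ⟨⟨x, star x, h, h'⟩, h, h'⟩

theorem orthogonal_ext {G : Type u} [Group G] [Finite G] {u v : orthogonalUnits G}
    (h : (u.1 : BurnsideGroup G G) = v.1) : u = v :=
  Subtype.ext (Units.ext h)

theorem blockUnit_mul_orthVec (hp : p.Prime) (hG : Nat.card G = p ^ n) (w : BlockGroup p n)
    (j : Fin (n + 1)) : blockUnit G w * orthVec G p j = ((w j).1 : ℤ) • orthVec G p j := by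
  rw [blockUnit, Finset.sum_mul, Finset.sum_eq_single j]
  · rw [smul_mul_assoc, mul_assoc, blockIdem_mul_orthVec, if_pos rfl,
      powClass_bot_mul_orthVec (coprime_card_unitRep hp hG _)]
  · intro i _ hi
    rw [smul_mul_assoc, mul_assoc, blockIdem_mul_orthVec, if_neg fun h => hi (Fin.ext h), mul_zero,
      smul_zero]
  · exact fun h => (h (Finset.mem_univ j)).elim

variable [IsCyclic G]

theorem star_orthVec_mul_blockUnit (hp : p.Prime) (hG : Nat.card G = p ^ n) (w : BlockGroup p n)
    (j : Fin (n + 1)) :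
    star (orthVec G p j) * blockUnit G w = ((w j).1 : ℤ) • star (orthVec G p j) := by
  rw [← star_star (blockUnit G w), ← star_mul, star_blockUnit hp hG,
    blockUnit_mul_orthVec hp hG, star_zsmul, Pi.inv_apply, Prod.fst_inv, Int.units_inv_eq_self]

theorem blockUnit_neg_first (hp : p.Prime) (hG : Nat.card G = p ^ n) :
    ∃ w : BlockGroup p n, blockUnit G w = 1 - (2 : ℤ) • blockIdem G p 0 := by
  have := NeZero.mk hp.ne_zero
  refine ⟨fun i => (if i = 0 then -1 else 1, 1), eq_of_mul_blockIdem_eq hG fun i => ?_⟩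
  rw [blockUnit_mul_blockIdem, sub_mul, one_mul, smul_mul_assoc, blockIdem_mul,
    powClass_bot_mul_blockIdem_congr hG (Nat.le_of_lt_succ i.2) unitRep_one_modEq,
    powClass_bot_one, one_mul]
  by_cases h : i = 0
  · subst h
    simp [two_smul]
  · rw [if_neg h, if_neg fun h' => h (Fin.ext h'.symm)]
    simp

theorem two_lt_index (hp : p.Prime) (hp2 : 2 < p) (hG : Nat.card G = p ^ n) (P : Subgroup G)
    (hP : P ≠ ⊤) : 2 < P.index := by
  obtain ⟨i, hi, rfl⟩ := exists_eq_powerSubgroup_pow hp hG P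
  rw [index_powerSubgroup_pow hG hi]
  rcases i with _ | i
  · exact (hP (by rw [pow_zero, powerSubgroup_one])).elim
  · exact hp2.trans_le (Nat.le_self_pow (Nat.succ_ne_zero i) p)

/-- For odd `p`, every orthogonal element is the product of an element acting on the blocks and of
an element differing from `1` by a diagonal matrix with entries `0` or `-2 / d`. -/
theorem exists_blockUnit_mul_eq (hp : p.Prime) (hp2 : 2 < p) (hG : Nat.card G = p ^ n)
    {u : BurnsideGroup G G} (hu : star u * u = 1) :
    ∃ (w : BlockGroup p n) (y : Fin n → ℤ),
      blockUnit G w * u =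
        1 + ∑ i : Fin n, y i • (orthVec G p (i + 1) * star (orthVec G p (i + 1))) ∧
      ∀ i : Fin n, y i = 0 ∨ y i * orthNorm p (i + 1) = -2 := by
  obtain ⟨w, hw⟩ := exists_blockUnit_normalising hp hG hu
  have hu' : star (blockUnit G w * u) * (blockUnit G w * u) = 1 := by
    rw [star_mul, mul_assoc, ← mul_assoc (star (blockUnit G w)), star_blockUnit_mul_self hp hG,
      one_mul, hu]
  obtain ⟨Y, hY⟩ := exists_eq_one_add_ofMatrix hp hG
    (fun P _ hP => two_lt_index hp hp2 hG P hP) hu' hw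
  rw [hY] at hu'
  have hcoord := coord_ofMatrix_of_odd hp hp2 hG hu'
  have hsum : blockUnit G w * u = 1 + (Y 0 0 • blockIdem G p 0 +
      ∑ i : Fin n, Y i.succ i.succ • (orthVec G p (i + 1) * star (orthVec G p (i + 1)))) := by
    rw [hY, ofMatrix_apply, ← orthVec_zero_mul_star]
    have h1 (i : Fin (n + 1)) : ∑ j : Fin (n + 1), Y i j • (orthVec G p i * star (orthVec G p j)) =
        Y i i • (orthVec G p i * star (orthVec G p i)) := by
      refine Finset.sum_eq_single i (fun j _ hj => ?_) fun h => (h (Finset.mem_univ i)).elim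
      rw [(hcoord i j).resolve_right fun h => hj h.1.symm, zero_smul]
    rw [Finset.sum_congr rfl fun i _ => h1 i, Fin.sum_univ_succ]
    rfl
  have hy (i : Fin n) : Y i.succ i.succ = 0 ∨ Y i.succ i.succ * orthNorm p (i + 1) = -2 :=
    (hcoord i.succ i.succ).imp_right And.right
  rcases hcoord 0 0 with h0 | ⟨-, h0⟩
  · rw [h0, zero_smul, zero_add] at hsum
    exact ⟨w, _, hsum, hy⟩
  -- The vector of norm `1` spans block `0`, so the entry `-2` there is a sign change of that block
  -- and can be moved into the `blockUnit`.
  · obtain ⟨v, hv⟩ := blockUnit_neg_first hp hG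
    refine ⟨v * w, fun i => Y i.succ i.succ, ?_, hy⟩
    have h2 : Y 0 0 = -2 := by
      simpa [orthNorm_zero] using h0
    have h3 : blockIdem G p 0 * ∑ i : Fin n, Y i.succ i.succ •
        (orthVec G p (i + 1) * star (orthVec G p (i + 1))) = 0 := by
      rw [Finset.mul_sum]
      refine Finset.sum_eq_zero fun i _ => ?_
      rw [mul_smul_comm, ← mul_assoc, blockIdem_mul_orthVec, if_neg (by omega), zero_mul, smul_zero]
    rw [blockUnit_mul hp hG, mul_assoc, hsum, h2, hv]
    simp only [sub_mul, mul_add, one_mul, mul_one, smul_mul_assoc, mul_smul_comm, h3,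
      blockIdem_mul_self]
    module

/-- A nonzero diagonal entry would require `p - 1` to divide `2`. -/
theorem exists_blockUnit_mul_eq_one (hp : p.Prime) (hp3 : 3 < p) (hG : Nat.card G = p ^ n)
    {u : BurnsideGroup G G} (hu : star u * u = 1) :
    ∃ w : BlockGroup p n, blockUnit G w * u = 1 := by
  obtain ⟨w, y, h, hy⟩ := exists_blockUnit_mul_eq hp (by omega) hG hu
  refine ⟨w, ?_⟩
  rw [h, Finset.sum_eq_zero, add_zero]
  intro i _
  rcases hy i with h0 | h0
  · rw [h0, zero_smul]
  · exfalso
    rw [orthNorm_succ] at h0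
    have hp' : (4 : ℤ) ≤ p := by exact_mod_cast hp3
    have h1 : (p : ℤ) - 1 ∣ 2 := ⟨-(y i * p ^ (i : ℕ)), by linear_combination h0⟩
    have := Int.le_of_dvd two_pos h1
    omega

/-- The vector has norm `2`, so subtracting its rank-one matrix from `1` is the usual reflection
formula, with an integral coefficient. -/
theorem reflection_mul_orthVec (hG : Nat.card G = 3 ^ n) (hn : 1 ≤ n) :
    reflection G * orthVec G 3 1 = -orthVec G 3 1 := by
  rw [reflection, sub_mul, one_mul, mul_assoc, star_orthVec_mul_self hG hn, mul_smul_comm,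
    orthVec_mul_basis_top, orthNorm_three_one]
  module

theorem reflection_mul_self (hG : Nat.card G = 3 ^ n) (hn : 1 ≤ n) :
    reflection G * reflection G = 1 := by
  conv_lhs => enter [2]; rw [reflection]
  rw [mul_sub, mul_one, ← mul_assoc, reflection_mul_orthVec hG hn, reflection]
  rw [neg_mul, sub_neg_eq_add, sub_add_cancel]

theorem reflection_mul_blockUnit (hG : Nat.card G = 3 ^ n) (hn : 1 ≤ n) (w : BlockGroup 3 n) :
    reflection G * blockUnit G w = blockUnit G w * reflection G := by
  have h1 := blockUnit_mul_orthVec Nat.prime_three hG w ⟨1, by omega⟩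
  have h2 := star_orthVec_mul_blockUnit Nat.prime_three hG w ⟨1, by omega⟩
  rw [reflection, sub_mul, mul_sub, one_mul, mul_one, mul_assoc, h2, ← mul_assoc, h1,
    smul_mul_assoc, mul_smul_comm]

theorem exists_blockUnit_mul_eq_reflection (hG : Nat.card G = 3 ^ n) {u : BurnsideGroup G G}
    (hu : star u * u = 1) :
    ∃ w : BlockGroup 3 n, blockUnit G w * u = 1 ∨ blockUnit G w * u = reflection G := by
  obtain ⟨w, y, h, hy⟩ := exists_blockUnit_mul_eq Nat.prime_three (by norm_num) hG hu
  refine ⟨w, ?_⟩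
  rw [h]
  rcases n with _ | n
  · exact Or.inl (by simp)
  rw [Fin.sum_univ_succ, Finset.sum_eq_zero, add_zero]
  · rcases hy 0 with h0 | h0
    · rw [h0, zero_smul, add_zero]
      exact Or.inl rfl
    · right
      have h1 : y 0 = -1 := by
        have : y 0 * 2 = -2 := orthNorm_three_one ▸ h0
        omega
      rw [h1, neg_smul, one_smul, ← sub_eq_add_neg]
      rfl
  · intro i _
    rcases hy i.succ with h0 | h0
    · rw [h0, zero_smul]
    -- The norms beyond the first two are multiples of `6`, so `-2` divided by them is not an
    -- integer.
    · exfalso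
      rw [orthNorm_succ, Fin.val_succ, pow_succ] at h0
      have h1 : (6 : ℤ) ∣ 2 := ⟨-(y i.succ * 3 ^ (i : ℕ)), by linear_combination h0⟩
      norm_num at h1

/-- Acting by `-1` on `orthVec G 3 1` would force the sign on block `1` to be `-1`. But the
reflection is `1` modulo the ideal of products, so its coordinate at the identity graph of that
block is `1`, whereas the `blockUnit` would give `-1` or `0`. -/
theorem blockUnit_ne_reflection (hG : Nat.card G = 3 ^ n) (hn : 1 ≤ n) (w : BlockGroup 3 n) :
    blockUnit G w ≠ reflection G := by
  intro h
  have := NeZero.mk Nat.prime_three.ne_zero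
  have h1 := blockUnit_mul_orthVec Nat.prime_three hG w ⟨1, by omega⟩
  simp only [h, reflection_mul_orthVec hG hn] at h1
  have h2 : ((w ⟨1, by omega⟩).1 : ℤ) = -1 := by
    have h3 := congrArg (fun x => star (orthVec G 3 1) * x) h1
    simp only [mul_neg, mul_smul_comm, star_orthVec_mul_self hG hn, orthNorm_three_one,
      ← neg_smul, smul_smul] at h3
    have := smul_basis_injective _ h3
    omega
  have h3 := blockUnit_mul_blockIdem (G := G) w ⟨1, by omega⟩
  have h4 : star (orthVec G 3 1) * blockIdem G 3 1 = star (orthVec G 3 1) := by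
    rw [← star_blockIdem, ← star_mul, blockIdem_mul_orthVec, if_pos rfl]
  simp only [h, h2, reflection, sub_mul, one_mul, mul_assoc, h4] at h3
  have hN : (powerSubgroup G (3 ^ 1)) ≠ ⊤ :=
    powerSubgroup_prime_ne_top Nat.prime_three hG (by omega)
  have hD : (powGraph (powerSubgroup G (3 ^ 1)) 1).sndKer ≠
      (powGraph (powerSubgroup G (3 ^ 1)) 1).sndProj := by
    rwa [sndKer_powGraph, sndProj_powGraph (Nat.coprime_one_right _)]
  have h5 := congrArg ((basis G).coord (powGraph (powerSubgroup G (3 ^ 1)) 1)) h3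
  rw [map_sub, map_smul, coord_orthVec_mul_star_orthVec _ _ hD,
    coord_powClass_mul_blockIdem Nat.prime_three hG hn] at h5
  have h6 := coord_powClass_mul_blockIdem (G := G) Nat.prime_three hG hn 1 1
  rw [powClass_bot_one, one_mul, if_pos (Nat.ModEq.refl _)] at h6
  rw [h6] at h5
  split_ifs at h5 <;> simp at h5

theorem orthogonalUnits_equiv_of_three_lt (hp : p.Prime) (hp3 : 3 < p)
    (hG : Nat.card G = p ^ n) : Nonempty (orthogonalUnits G ≃* BlockGroup p n) := by
  let Φ : BlockGroup p n →* orthogonalUnits G :=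
    { toFun := fun w => mkOrthogonal (blockUnit G w) (blockUnit_mul_star_self hp hG w)
        (star_blockUnit_mul_self hp hG w)
      map_one' := orthogonal_ext (blockUnit_one hp hG)
      map_mul' := fun w v => orthogonal_ext (blockUnit_mul hp hG w v) }
  refine ⟨(MulEquiv.ofBijective Φ ⟨fun w v h => ?_, fun u => ?_⟩).symm⟩
  · exact blockUnit_injective hp hG (congrArg (fun u : orthogonalUnits G => u.1.1) h)
  · obtain ⟨w, hw⟩ := exists_blockUnit_mul_eq_one hp hp3 hG u.2.2
    refine ⟨w⁻¹, ?_⟩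
    rw [map_inv, inv_eq_iff_mul_eq_one]
    exact orthogonal_ext hw

theorem orthogonalUnits_equiv_of_three (hn : 1 ≤ n) (hG : Nat.card G = 3 ^ n) :
    Nonempty (orthogonalUnits G ≃* BlockGroup 3 n × ℤˣ) := by
  have hp := Nat.prime_three
  let ψ : BlockGroup 3 n →* orthogonalUnits G :=
    { toFun := fun w => mkOrthogonal (blockUnit G w) (blockUnit_mul_star_self hp hG w)
        (star_blockUnit_mul_self hp hG w)
      map_one' := orthogonal_ext (blockUnit_one hp hG)
      map_mul' := fun w v => orthogonal_ext (blockUnit_mul hp hG w v) }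
  have hr : reflection G * star (reflection G) = 1 := by
    rw [star_reflection, reflection_mul_self hG hn]
  have hr' : star (reflection G) * reflection G = 1 := by
    rw [star_reflection, reflection_mul_self hG hn]
  let ρ : ℤˣ →* orthogonalUnits G :=
    { toFun := fun s => if s = 1 then 1 else mkOrthogonal (reflection G) hr hr'
      map_one' := if_pos rfl
      map_mul' := fun s t => by
        rcases Int.units_eq_one_or s with rfl | rfl <;> rcases Int.units_eq_one_or t with rfl | rfl
        · simp
        · simp
        · simp
        · simp only [mul_neg, mul_one, neg_neg, if_true]
          rw [if_neg (show ¬(-1 : ℤˣ) = 1 by decide)]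
          exact orthogonal_ext (reflection_mul_self hG hn).symm }
  have hcomm (w : BlockGroup 3 n) (s : ℤˣ) : Commute (ψ w) (ρ s) := by
    rcases Int.units_eq_one_or s with rfl | rfl
    · rw [map_one]
      exact Commute.one_right _
    · exact orthogonal_ext (reflection_mul_blockUnit hG hn w).symm
  let Φ : BlockGroup 3 n × ℤˣ →* orthogonalUnits G := ψ.noncommCoprod ρ hcomm
  have hΦ (w : BlockGroup 3 n) (s : ℤˣ) : Φ (w, s) = ψ w * ρ s := rfl
  have hρ : ρ (-1) = mkOrthogonal (reflection G) hr hr' :=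
    if_neg (t := (1 : orthogonalUnits G)) (show ¬(-1 : ℤˣ) = 1 by decide)
  refine ⟨(MulEquiv.ofBijective Φ ⟨?_, fun u => ?_⟩).symm⟩
  · rw [injective_iff_map_eq_one]
    rintro ⟨w, s⟩ h
    rw [hΦ] at h
    rcases Int.units_eq_one_or s with rfl | rfl
    · rw [map_one, mul_one] at h
      have : w = 1 := blockUnit_injective hp hG
        ((congrArg (fun u : orthogonalUnits G => u.1.1) h).trans (blockUnit_one hp hG).symm)
      rw [this]
      rfl
    · rw [hρ, mul_eq_one_iff_inv_eq, ← map_inv] at h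
      exact (blockUnit_ne_reflection hG hn w⁻¹
        (congrArg (fun u : orthogonalUnits G => u.1.1) h)).elim
  · obtain ⟨w, hw | hw⟩ := exists_blockUnit_mul_eq_reflection hG u.2.2
    · refine ⟨(w⁻¹, 1), ?_⟩
      rw [hΦ, map_one, mul_one, map_inv, inv_eq_iff_mul_eq_one]
      exact orthogonal_ext hw
    · refine ⟨(w⁻¹, -1), ?_⟩
      rw [hΦ, hρ, map_inv, inv_mul_eq_iff_eq_mul]
      exact orthogonal_ext hw.symm

end BurnsideGroup

/-! ### The dihedral group of order eight as the integral orthogonal group of rank two. -/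

namespace DihedralGroup

/-- The rotation by a multiple of a quarter turn. -/
def quarterTurn (i : ZMod 4) : Matrix (Fin 2) (Fin 2) ℤ := !![0, -1; 1, 0] ^ i.val

/-- The action of the dihedral group of order `8` on the square lattice. -/
def toMatrix : DihedralGroup 4 → Matrix (Fin 2) (Fin 2) ℤ
  | r i => quarterTurn i
  | sr i => !![1, 0; 0, -1] * quarterTurn i

theorem toMatrix_mul (a b : DihedralGroup 4) : toMatrix (a * b) = toMatrix a * toMatrix b := by
  revert a b
  decide

theorem toMatrix_inv (a : DihedralGroup 4) : toMatrix a⁻¹ = (toMatrix a).transpose := by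
  revert a
  decide

theorem toMatrix_injective : Function.Injective toMatrix := by
  intro a b
  revert a b
  decide

/-- The columns have norm `1`, so all entries lie between `-1` and `1`; a finite check remains. -/
theorem exists_toMatrix_eq_of_transpose_mul_self {M : Matrix (Fin 2) (Fin 2) ℤ}
    (hM : M.transpose * M = 1) : ∃ a, toMatrix a = M := by
  have h00 : M 0 0 ^ 2 + M 1 0 ^ 2 = 1 := by
    have := congrFun (congrFun hM 0) 0
    simp [Matrix.mul_apply, Fin.sum_univ_two] at this
    linarith
  have h11 : M 0 1 ^ 2 + M 1 1 ^ 2 = 1 := by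
    have := congrFun (congrFun hM 1) 1
    simp [Matrix.mul_apply, Fin.sum_univ_two] at this
    linarith
  have h01 : M 0 0 * M 0 1 + M 1 0 * M 1 1 = 0 := by
    have := congrFun (congrFun hM 0) 1
    simp [Matrix.mul_apply, Fin.sum_univ_two] at this
    linarith
  have hbound (x y : ℤ) (h : x ^ 2 + y ^ 2 = 1) : x ∈ Finset.Icc (-1) 1 ∧ y ∈ Finset.Icc (-1) 1 := by
    rw [Finset.mem_Icc, Finset.mem_Icc]
    refine ⟨⟨?_, ?_⟩, ?_, ?_⟩ <;> nlinarith [sq_nonneg x, sq_nonneg y]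
  have key : ∀ a ∈ Finset.Icc (-1 : ℤ) 1, ∀ b ∈ Finset.Icc (-1 : ℤ) 1, ∀ c ∈ Finset.Icc (-1 : ℤ) 1,
      ∀ d ∈ Finset.Icc (-1 : ℤ) 1, a ^ 2 + c ^ 2 = 1 → b ^ 2 + d ^ 2 = 1 → a * b + c * d = 0 →
      ∃ x, toMatrix x = !![a, b; c, d] := by
    decide
  rw [Matrix.eta_fin_two M]
  exact key _ (hbound _ _ h00).1 _ (hbound _ _ h11).1 _ (hbound _ _ h00).2 _ (hbound _ _ h11).2
    h00 h11 h01

end DihedralGroup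

/-! ### The group of order two. -/

namespace BurnsideGroup

open Subgroup

open scoped Classical

variable {G : Type u} [CommGroup G] [Finite G]

theorem star_ofMatrix {p n : ℕ} (Y : Matrix (Fin (n + 1)) (Fin (n + 1)) ℤ) :
    star (ofMatrix G p Y) = ofMatrix G p Y.transpose := by
  simp only [ofMatrix_apply, star_sum, star_zsmul, star_mul, star_star, Matrix.transpose_apply]
  exact Finset.sum_comm

/-- The element of the Burnside ring of the group of order `2` with given components in
`ℤ × Mat₂(ℤ)`. -/
noncomputable def ofIntMatrix (G : Type u) [CommGroup G] [Finite G] (a : ℤ)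
    (M : Matrix (Fin (1 + 1)) (Fin (1 + 1)) ℤ) : BurnsideGroup G G :=
  a • (1 - ofMatrix G 2 (1 : Matrix (Fin (1 + 1)) (Fin (1 + 1)) ℤ)) + ofMatrix G 2 M

theorem star_ofIntMatrix (a : ℤ) (M : Matrix (Fin (1 + 1)) (Fin (1 + 1)) ℤ) :
    star (ofIntMatrix G a M) = ofIntMatrix G a M.transpose := by
  simp only [ofIntMatrix, star_add, star_zsmul, star_sub, star_one, star_ofMatrix,
    Matrix.transpose_one]

theorem ofIntMatrix_one : ofIntMatrix G 1 1 = 1 := by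
  rw [ofIntMatrix, one_smul, sub_add_cancel]

variable [IsCyclic G]

/-- Multiplication in the ideal is matrix multiplication twisted by the diagonal Gram matrix of the
`orthVec`. For order `2` both norms are `1` and the twist disappears. -/
theorem ofMatrix_mul {p n : ℕ} (hG : Nat.card G = p ^ n)
    (Y Z : Matrix (Fin (n + 1)) (Fin (n + 1)) ℤ) :
    ofMatrix G p Y * ofMatrix G p Z =
      ofMatrix G p (Y * Matrix.diagonal (fun i : Fin (n + 1) => orthNorm p i) * Z) := by
  have h (k : Fin (n + 1)) : ofMatrix G p Y * (∑ j, Z k j • (orthVec G p k * star (orthVec G p j)))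
      = ∑ i, ∑ j, (Y i k * orthNorm p k * Z k j) • (orthVec G p i * star (orthVec G p j)) := by
    simp only [Finset.mul_sum, mul_smul_comm, ← mul_assoc, ofMatrix_mul_orthVec hG, Finset.sum_mul,
      smul_mul_assoc, Finset.smul_sum, smul_smul]
    rw [Finset.sum_comm]
    exact Finset.sum_congr rfl fun i _ => Finset.sum_congr rfl fun j _ => by
      rw [mul_comm (Z k j), mul_assoc, mul_assoc, mul_comm (Z k j)]
  rw [ofMatrix_apply Z, Finset.mul_sum, ofMatrix_apply (_ * Z)]
  simp only [h, Matrix.mul_apply (N := Z), Matrix.mul_diagonal, Finset.sum_smul]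
  rw [Finset.sum_comm]
  exact Finset.sum_congr rfl fun i _ => Finset.sum_comm

theorem ofMatrix_injective {p n : ℕ} (hp : p.Prime) (hG : Nat.card G = p ^ n) :
    Function.Injective (ofMatrix G p : Matrix (Fin (n + 1)) (Fin (n + 1)) ℤ → _) := by
  intro Y Z h
  ext i j
  have key (Y : Matrix (Fin (n + 1)) (Fin (n + 1)) ℤ) :
      star (orthVec G p i) * (ofMatrix G p Y * orthVec G p j) =
        (Y i j * orthNorm p j * orthNorm p i) • basis G (diag ⊤ ⊤) := by
    rw [ofMatrix_mul_orthVec hG, Finset.mul_sum, Finset.sum_eq_single i]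
    · rw [mul_smul_comm, star_orthVec_mul hG, if_pos rfl, smul_smul]
    · intro k _ hk
      rw [mul_smul_comm, star_orthVec_mul hG, if_neg hk.symm, smul_zero]
    · exact fun h => (h (Finset.mem_univ i)).elim
  have h1 := key Y
  rw [h, key Z] at h1
  exact (mul_right_cancel₀ (orthNorm_pos hp j).ne'
    (mul_right_cancel₀ (orthNorm_pos hp i).ne' (smul_basis_injective _ h1))).symm

theorem ofMatrix_mul_two (hG : Nat.card G = 2 ^ 1) (Y Z : Matrix (Fin (1 + 1)) (Fin (1 + 1)) ℤ) :
    ofMatrix G 2 Y * ofMatrix G 2 Z = ofMatrix G 2 (Y * Z) := by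
  have : Matrix.diagonal (fun i : Fin (1 + 1) => orthNorm 2 i) = 1 := by
    decide
  rw [ofMatrix_mul hG, this, mul_one]

theorem ofIntMatrix_mul (hG : Nat.card G = 2 ^ 1) (a b : ℤ)
    (M N : Matrix (Fin (1 + 1)) (Fin (1 + 1)) ℤ) :
    ofIntMatrix G a M * ofIntMatrix G b N = ofIntMatrix G (a * b) (M * N) := by
  simp only [ofIntMatrix, mul_add, add_mul, mul_sub, sub_mul, one_mul, mul_one, smul_mul_assoc,
    mul_smul_comm, ofMatrix_mul_two hG, smul_sub]
  module

/-- The coordinate at the identity relation recovers the integer, because the ideal of products has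
no component there. -/
theorem ofIntMatrix_inj (hG : Nat.card G = 2 ^ 1) {a b : ℤ}
    {M N : Matrix (Fin (1 + 1)) (Fin (1 + 1)) ℤ} (h : ofIntMatrix G a M = ofIntMatrix G b N) :
    a = b ∧ M = N := by
  have hbot : (⊥ : Subgroup G) ≠ ⊤ := by
    intro h
    have h1 := Subgroup.card_top (G := G)
    rw [← h, Subgroup.card_bot, hG] at h1
    norm_num at h1
  have hT : (diag ⊤ ⊥ : Subgroup (G × G)).sndKer ≠ (diag ⊤ ⊥ : Subgroup (G × G)).sndProj := by
    rwa [sndKer_diag bot_le, sndProj_diag]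
  have hab : a = b := by
    have := congrArg ((basis G).coord (diag ⊤ ⊥)) h
    simpa only [ofIntMatrix, map_add, map_zsmul, map_sub, one_eq_basis_diag, coord_basis,
      coord_ofMatrix_eq_zero _ hT, if_true, sub_zero, add_zero, smul_eq_mul, mul_one] using this
  subst hab
  exact ⟨rfl, ofMatrix_injective Nat.prime_two hG (add_left_cancel h)⟩

/-- No subgroup lies strictly between the trivial one and `G`, so the condition excluding index `2`
is vacuous. A sign suffices to normalise, as every exponent prime to `2` gives the identity graph.
-/
theorem exists_ofIntMatrix_eq (hG : Nat.card G = 2 ^ 1) {u : BurnsideGroup G G}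
    (hu : star u * u = 1) :
    ∃ (ε : ℤˣ) (M : Matrix (Fin (1 + 1)) (Fin (1 + 1)) ℤ),
      M.transpose * M = 1 ∧ u = ofIntMatrix G ε M := by
  have hp := Nat.prime_two
  have htriv (N : Subgroup G) : N = ⊤ ∨ N = ⊥ := by
    obtain ⟨i, hi, rfl⟩ := exists_eq_powerSubgroup_pow hp hG N
    rcases i with _ | i
    · rw [pow_zero, powerSubgroup_one]
      exact Or.inl rfl
    · obtain rfl : i = 0 := by omega
      rw [zero_add, ← hG, powerSubgroup_card]
      exact Or.inr rfl
  have hbot : (⊥ : Subgroup G) ≠ ⊤ := by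
    intro h
    have h1 := Subgroup.card_top (G := G)
    rw [← h, Subgroup.card_bot, hG] at h1
    norm_num at h1
  obtain ⟨ε, k, hk, hε⟩ := exists_coord_eq_unit hp hG hu hbot
  have hεε : (ε : ℤ) * ε = 1 := by rw [← Units.val_mul, Int.units_mul_self, Units.val_one]
  have hk1 : powGraph (⊥ : Subgroup G) k = diag ⊤ ⊥ := by
    rw [← powGraph_one]
    refine powGraph_congr ?_
    rw [Subgroup.index_bot, hG, pow_one]
    rw [hG, pow_one, Nat.coprime_two_left] at hk
    exact Nat.odd_iff.1 hk
  have hu' : star ((ε : ℤ) • u) * ((ε : ℤ) • u) = 1 := by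
    rw [star_zsmul, smul_mul_smul_comm, hεε, one_smul, hu]
  obtain ⟨Y, hY⟩ := exists_eq_one_add_ofMatrix (u := (ε : ℤ) • u) hp hG
    (fun P h1 h2 => ((htriv P).elim h2 h1).elim) hu' (fun N hN => by
      rw [(htriv N).resolve_left hN, smul_mul_assoc, map_smul,
        hε _ sndProj_diag (sndKer_diag bot_le), if_pos hk1.symm, smul_eq_mul, hεε])
  have hu1 : u = ofIntMatrix G ε ((ε : ℤ) • (1 + Y)) := by
    rw [← one_smul ℤ u, ← hεε, ← smul_smul, hY, ofIntMatrix, map_zsmul, map_add]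
    module
  refine ⟨ε, _, ?_, hu1⟩
  rw [hu1, star_ofIntMatrix, ofIntMatrix_mul hG, ← ofIntMatrix_one] at hu
  exact (ofIntMatrix_inj hG hu).2

theorem orthogonalUnits_equiv_of_two (hG : Nat.card G = 2 ^ 1) :
    Nonempty (orthogonalUnits G ≃* ℤˣ × DihedralGroup 4) := by
  have hmul (x y : ℤˣ × DihedralGroup 4) :
      ofIntMatrix G ((x * y).1 : ℤ) (DihedralGroup.toMatrix (x * y).2) =
        ofIntMatrix G (x.1 : ℤ) (DihedralGroup.toMatrix x.2) *
          ofIntMatrix G (y.1 : ℤ) (DihedralGroup.toMatrix y.2) := by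
    rw [ofIntMatrix_mul hG, ← DihedralGroup.toMatrix_mul, Prod.fst_mul, Units.val_mul, Prod.snd_mul]
  have hone : ofIntMatrix G ((1 : ℤˣ × DihedralGroup 4).1 : ℤ)
      (DihedralGroup.toMatrix (1 : ℤˣ × DihedralGroup 4).2) = 1 := by
    rw [← ofIntMatrix_one]
    rfl
  have hstar (x : ℤˣ × DihedralGroup 4) :
      star (ofIntMatrix G (x.1 : ℤ) (DihedralGroup.toMatrix x.2)) =
        ofIntMatrix G ((x⁻¹).1 : ℤ) (DihedralGroup.toMatrix (x⁻¹).2) := by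
    rw [star_ofIntMatrix, ← DihedralGroup.toMatrix_inv, Prod.fst_inv, Int.units_inv_eq_self,
      Prod.snd_inv]
  let Φ : ℤˣ × DihedralGroup 4 →* orthogonalUnits G :=
    { toFun := fun x => mkOrthogonal (ofIntMatrix G (x.1 : ℤ) (DihedralGroup.toMatrix x.2))
        (by rw [hstar, ← hmul, mul_inv_cancel, hone]) (by rw [hstar, ← hmul, inv_mul_cancel, hone])
      map_one' := orthogonal_ext hone
      map_mul' := fun x y => orthogonal_ext (hmul x y) }
  refine ⟨(MulEquiv.ofBijective Φ ⟨fun x y h => ?_, fun u => ?_⟩).symm⟩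
  · obtain ⟨h1, h2⟩ := ofIntMatrix_inj hG (congrArg (fun u : orthogonalUnits G => u.1.1) h)
    exact Prod.ext (Units.ext h1) (DihedralGroup.toMatrix_injective h2)
  · obtain ⟨ε, M, hM, hu⟩ := exists_ofIntMatrix_eq hG u.2.2
    obtain ⟨a, rfl⟩ := DihedralGroup.exists_toMatrix_eq_of_transpose_mul_self hM
    exact ⟨(ε, a), orthogonal_ext hu.symm⟩

end BurnsideGroup

/-! ### Identification of the abstract groups. -/

theorem nonempty_units_int_mulEquiv : Nonempty (ℤˣ ≃* CyclicGrp 2) :=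
  ⟨mulEquivOfPrimeCardEq (p := 2) (by simp) (by simp)⟩

theorem nonempty_units_zmod_mulEquiv (m : ℕ) : Nonempty ((ZMod m)ˣ ≃* Out (CyclicGrp m)) := by
  have h : (MulAut.conj (G := CyclicGrp m)).range = ⊥ := by
    rw [eq_bot_iff]
    rintro _ ⟨g, rfl⟩
    rw [Subgroup.mem_bot]
    ext x
    simp
  have hc : Nat.card (CyclicGrp m) = m := Nat.card_zmod m
  exact ⟨((QuotientGroup.quotientMulEquivOfEq h).trans (QuotientGroup.quotientBot.trans
    ((IsCyclic.mulAutMulEquiv (CyclicGrp m)).trans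
      (Units.mapEquiv (ZMod.ringEquivCongr hc).toMulEquiv)))).symm⟩

/-- Block `0` contributes only a sign, since the unit group modulo `p ^ 0 = 1` is trivial. -/
theorem nonempty_blockGroup_mulEquiv (p n : ℕ) : Nonempty (BurnsideGroup.BlockGroup p n ≃*
    (Fin (n + 1) → ℤˣ) × ((i : Fin n) → (ZMod (p ^ (i.val + 1)))ˣ)) := by
  have : Subsingleton (ZMod (p ^ 0))ˣ := by
    rw [pow_zero]
    infer_instance
  let Φ : BurnsideGroup.BlockGroup p n →*
      (Fin (n + 1) → ℤˣ) × ((i : Fin n) → (ZMod (p ^ (i.val + 1)))ˣ) :=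
    { toFun := fun w => (fun i => (w i).1, fun i => (w i.succ).2)
      map_one' := rfl
      map_mul' := fun _ _ => rfl }
  refine ⟨MulEquiv.ofBijective Φ ⟨fun w v h => ?_, fun x => ?_⟩⟩
  · obtain ⟨h1, h2⟩ := Prod.mk_inj.1 h
    refine funext fun i => Prod.ext (congrFun h1 i) ?_
    refine Fin.cases ?_ (fun j => congrFun h2 j) i
    exact Subsingleton.elim (α := (ZMod (p ^ 0))ˣ) _ _
  · refine ⟨fun i => (x.1 i, Fin.cases (motive := fun i => (ZMod (p ^ (i : ℕ)))ˣ) 1 x.2 i), rfl⟩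

theorem nonempty_pi_succ_mulEquiv (M : Type*) [MulOneClass M] (n : ℕ) :
    Nonempty ((Fin (n + 1) → M) ≃* (Fin n → M) × M) := by
  let Φ : (Fin (n + 1) → M) →* (Fin n → M) × M :=
    { toFun := fun f => (fun i => f i.succ, f 0)
      map_one' := rfl
      map_mul' := fun _ _ => rfl }
  refine ⟨MulEquiv.ofBijective Φ ⟨fun f g h => ?_, fun x => ?_⟩⟩
  · obtain ⟨h1, h2⟩ := Prod.mk_inj.1 h
    exact funext fun i => Fin.cases h2 (fun j => congrFun h1 j) i
  · exact ⟨Fin.cons x.2 x.1, rfl⟩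

theorem theorem1p1 (p : ℕ) (hp : p.Prime) (G : Type u) [Group G] [Finite G] [IsCyclic G]
    (hG : IsPGroup p G) :
    (Nat.card G = 1 → Nonempty (orthogonalUnits G ≃* CyclicGrp 2)) ∧
    (Nat.card G = 2 → Nonempty (orthogonalUnits G ≃* CyclicGrp 2 × DihedralGroup 4)) ∧
    (∀ n : ℕ, 1 ≤ n → Nat.card G = p ^ n →
      (p = 3 → Nonempty (orthogonalUnits G ≃*
        (Fin (n + 2) → CyclicGrp 2) × ((i : Fin n) → Out (CyclicGrp (p ^ (i.val + 1)))))) ∧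
      (3 < p → Nonempty (orthogonalUnits G ≃*
        (Fin (n + 1) → CyclicGrp 2) × ((i : Fin n) → Out (CyclicGrp (p ^ (i.val + 1))))))) := by
  let _ : CommGroup G := IsCyclic.commGroup
  obtain ⟨σ⟩ := nonempty_units_int_mulEquiv
  have τ (n : ℕ) : ((i : Fin n) → (ZMod (p ^ (i.val + 1)))ˣ) ≃*
      ((i : Fin n) → Out (CyclicGrp (p ^ (i.val + 1)))) :=
    MulEquiv.piCongrRight fun i => (nonempty_units_zmod_mulEquiv _).some
  refine ⟨fun h => ?_, fun h => ?_, fun n hn h => ⟨?_, fun hp3 => ?_⟩⟩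
  -- The trivial group has order `5 ^ 0`; any prime above `3` would serve, and only the sign of
  -- block `0` remains.
  · obtain ⟨e⟩ := BurnsideGroup.orthogonalUnits_equiv_of_three_lt Nat.prime_five (by norm_num)
      (n := 0) (h.trans (pow_zero 5).symm)
    obtain ⟨f⟩ := nonempty_blockGroup_mulEquiv 5 0
    exact ⟨e.trans (f.trans (MulEquiv.prodUnique.trans
      ((MulEquiv.piUnique (fun _ : Fin 1 => ℤˣ)).trans σ)))⟩
  · obtain ⟨e⟩ := BurnsideGroup.orthogonalUnits_equiv_of_two (h.trans (pow_one 2).symm)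
    exact ⟨e.trans (σ.prodCongr (MulEquiv.refl _))⟩
  · rintro rfl
    obtain ⟨e⟩ := BurnsideGroup.orthogonalUnits_equiv_of_three hn h
    obtain ⟨f⟩ := nonempty_blockGroup_mulEquiv 3 n
    obtain ⟨g⟩ := nonempty_pi_succ_mulEquiv ℤˣ (n + 1)
    let f' : BurnsideGroup.BlockGroup 3 n × ℤˣ ≃*
        (Fin (n + 2) → ℤˣ) × ((i : Fin n) → (ZMod (3 ^ (i.val + 1)))ˣ) :=
      (f.prodCongr (MulEquiv.refl ℤˣ)).trans (MulEquiv.prodAssoc.trans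
        (((MulEquiv.refl _).prodCongr MulEquiv.prodComm).trans (MulEquiv.prodAssoc.symm.trans
          (g.symm.prodCongr (MulEquiv.refl _)))))
    exact ⟨e.trans (f'.trans ((MulEquiv.piCongrRight fun _ => σ).prodCongr (τ n)))⟩
  · obtain ⟨e⟩ := BurnsideGroup.orthogonalUnits_equiv_of_three_lt hp hp3 h
    obtain ⟨f⟩ := nonempty_blockGroup_mulEquiv p n
    exact ⟨e.trans (f.trans ((MulEquiv.piCongrRight fun _ => σ).prodCongr (τ n)))⟩
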